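/- Let $C=(\mathbb R/4\pi\mathbb Z)\times\mathbb R$ with points $\lambda=(\gamma,c)$, and let $M=\mathrm{SH}(2)\cong\mathbb R^3$ with coordinates $q=(x,y,z)$. For $\lambda\in C$ let $(\gamma_t,c_t,x_t,y_t,z_t)$, $t\in\mathbb R$, be the solution of the normal Hamiltonian system $$\dot\gamma=c,\quad \dot c=-\sin\gamma,\quad \dot x=\cos\tfrac{\gamma}{2}\cosh z,\quad \dot y=\cos\tfrac{\gamma}{2}\sinh z,\quad \dot z=\sin\tfrac{\gamma}{2}$$ with $(\gamma_0,c_0)=\lambda$ and $(x_0,y_0,z_0)=(0,0,0)$; the exponential mapping is $\mathrm{Exp}(\lambda,t)=(x_t,y_t,z_t)$, defined on $N=C\times(0,+\infty)$. Put $E(\lambda)=\frac{c^2}{2}-\cos\gamma$ and $$C_1=\{E\in(-1,1)\},\quad C_2=\{E>1\},\quad C_3=\{E=1,\ c\ne0\},\quad C_4=\{E=-1,\ c=0\},\quad C_5=\{E=1,\ c=0\}.$$ With $K(k)=\int_0^{\pi/2}\frac{d\theta}{\sqrt{1-k^2\sin^2\theta}}$ define $\mathbf t:C\to(0,+\infty]$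 by $$\mathbf t(\lambda)=\begin{cases}4K(k),\ k=\sqrt{(E+1)/2}, & \lambda\in C_1,\\ 4kK(k),\ k=\sqrt{2/(E+1)}, & \lambda\in C_2,\\ 2\pi, & \lambda\in C_4,\\ +\infty, & \lambda\in C_3\cup C_5.\end{cases}$$ Let $$\widetilde N=\Big\{(\lambda,t)\in (C_1\cup C_2\cup C_3)\times(0,+\infty)\ :\ t<\mathbf t(\lambda),\ \sin\tfrac{\gamma_{t/2}}{2}\neq0\Big\}\ \cup\ \big(C_5\times(0,+\infty)\big),\qquad \widetilde M=\{q\in M: z\ne0\}.$$ Then $\widetilde N$ is open in $C\times\mathbb R$, $\widetilde M$ is open in $M$, and $\mathrm{Exp}:\widetilde N\to\widetilde M$ is a $C^\infty$ diffeomorphism. -/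

import Mathlib

open Set
open scoped Manifold ContDiff Topology

noncomputable section

namespace SH2

/-! ### The circle `ℝ / pℤ` as a smooth manifold -/

section Circle

variable (p : ℝ) [hp : Fact (0 < p)]

/-- The charts of `ℝ / pℤ` are the inverses of the restrictions of the quotient map `ℝ → ℝ / pℤ`
to the open intervals `(a, a + p)`. -/
instance instChartedSpaceAddCircle : ChartedSpace ℝ (AddCircle p) where
  atlas := {e | ∃ a : ℝ, e = (AddCircle.openPartialHomeomorphCoe p a).symm}
  chartAt x := (AddCircle.openPartialHomeomorphCoe p (x.out - p / 2)).symm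
  mem_chart_source x := by
    have h0 := hp.out
    have h : (AddCircle.openPartialHomeomorphCoe p (x.out - p / 2)) x.out ∈
        (AddCircle.openPartialHomeomorphCoe p (x.out - p / 2)).target := by
      apply OpenPartialHomeomorph.map_source
      simp only [AddCircle.openPartialHomeomorphCoe_source, mem_Ioo]
      constructor <;> linarith
    have h2 : (AddCircle.openPartialHomeomorphCoe p (x.out - p / 2)) x.out = x := by
      simp only [AddCircle.openPartialHomeomorphCoe_apply]
      exact Quotient.out_eq x
    rw [h2] at h
    exact h
  chart_mem_atlas x := ⟨_, rfl⟩

/-- The changes of charts are locally translations by multiples of `p`, hence smooth. -/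
instance instIsManifoldAddCircle : IsManifold 𝓘(ℝ, ℝ) ∞ (AddCircle p) := by
  apply isManifold_of_contDiffOn
  rintro _ _ ⟨a, rfl⟩ ⟨b, rfl⟩ x hx
  simp only [modelWithCornersSelf_coe, modelWithCornersSelf_coe_symm,
    OpenPartialHomeomorph.symm_symm, preimage_id_eq, id_eq, range_id,
    inter_univ, OpenPartialHomeomorph.trans_source, mem_inter_iff, mem_preimage,
    AddCircle.openPartialHomeomorphCoe_apply, OpenPartialHomeomorph.symm_source,
    AddCircle.openPartialHomeomorphCoe_target, mem_compl_iff, mem_singleton_iff] at hx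
  have hne : ¬ x ≡ b [PMOD p] := fun h =>
    hx.2 ((AddCommGroup.modEq_iff_eq_mod_zmultiples).1 h)
  have hev := eventuallyEq_toIcoDiv_nhds hp.out b hne
  apply ContDiffAt.contDiffWithinAt
  have : ContDiffAt ℝ ∞ (fun y : ℝ => y - toIcoDiv hp.out b x • p) x := by fun_prop
  refine this.congr_of_eventuallyEq ?_
  filter_upwards [hev] with y hy
  change toIcoMod hp.out b y = _
  rw [toIcoMod, hy]

end Circle

instance instFactFourPi : Fact (0 < 4 * Real.pi) := ⟨by positivity⟩

/-! ### The Hamiltonian system and the exponential mapping -/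

/-- The phase cylinder `C = (ℝ / 4πℤ) × ℝ` of the vertical subsystem, with points `(γ, c)`. -/
abbrev PhaseCylinder : Type := AddCircle (4 * Real.pi) × ℝ

/-- A normal extremal, parametrised by all of `ℝ`, starting at the identity of `SH(2) ≅ ℝ³` with
initial covector `lam` in the phase cylinder. The curve `γ` is a real-valued lift of the
`ℝ / 4πℤ`-valued angle. -/
structure NormalExtremal (lam : PhaseCylinder) where
  γ : ℝ → ℝ
  c : ℝ → ℝ
  x : ℝ → ℝ
  y : ℝ → ℝ
  z : ℝ → ℝ
  deriv_γ : ∀ t, HasDerivAt γ (c t) t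
  deriv_c : ∀ t, HasDerivAt c (-Real.sin (γ t)) t
  deriv_x : ∀ t, HasDerivAt x (Real.cos (γ t / 2) * Real.cosh (z t)) t
  deriv_y : ∀ t, HasDerivAt y (Real.cos (γ t / 2) * Real.sinh (z t)) t
  deriv_z : ∀ t, HasDerivAt z (Real.sin (γ t / 2)) t
  γ_zero : (γ 0 : AddCircle (4 * Real.pi)) = lam.1
  c_zero : c 0 = lam.2
  x_zero : x 0 = 0
  y_zero : y 0 = 0
  z_zero : z 0 = 0

/-- The pendulum vector field. -/
def pendulum (s : ℝ × ℝ) : ℝ × ℝ := (s.2, -Real.sin s.1)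

theorem lipschitz_pendulum : LipschitzWith 1 pendulum := by
  have h1 : LipschitzWith 1 (fun s : ℝ × ℝ => s.2) := LipschitzWith.prod_snd
  have h2 : LipschitzWith 1 (fun s : ℝ × ℝ => -Real.sin s.1) := by
    refine LipschitzWith.of_dist_le_mul fun s t => ?_
    rw [dist_neg_neg, Real.dist_eq, NNReal.coe_one, one_mul]
    refine le_trans ?_ (le_max_left _ _)
    rw [Real.dist_eq]
    have h := Real.lipschitzWith_sin.dist_le_mul s.1 t.1
    simpa [Real.dist_eq] using h
  simpa [pendulum] using! h1.prodMk h2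

theorem exists_pendulum (s₀ : ℝ × ℝ) :
    ∃ s : ℝ → ℝ × ℝ, s 0 = s₀ ∧ ∀ t, HasDerivAt s (pendulum (s t)) t := by
  have hsmooth : ContDiff ℝ 1 pendulum := by
    unfold pendulum
    fun_prop
  have hloc : ∀ x : ℝ × ℝ, ∃ s : ℝ → ℝ × ℝ, s 0 = x ∧
      IsMIntegralCurveOn (I := 𝓘(ℝ, ℝ × ℝ)) s (fun y => pendulum y) (Ioo (-(1 / 4)) (1 / 4)) := by
    intro x
    have h0 : (0 : ℝ) ∈ Icc (-(1 / 4) : ℝ) (1 / 4) := by constructor <;> norm_num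
    have hPL : IsPicardLindelof (fun _ => pendulum) ⟨0, h0⟩ x (‖x‖₊ + 1) 0 (2 * ‖x‖₊ + 2) 1 := by
      refine IsPicardLindelof.of_time_independent ?_ lipschitz_pendulum.lipschitzOnWith ?_
      · intro y hy
        have h1 : dist (pendulum y) (pendulum x) ≤ dist y x := by
          simpa using lipschitz_pendulum.dist_le_mul y x
        have h2 : dist y x ≤ ‖x‖ + 1 := by simpa using! hy
        have h3 : ‖pendulum x‖ ≤ ‖x‖ + 1 := by
          refine max_le ?_ ?_
          · exact (norm_snd_le x).trans (by linarith)
          · have := Real.abs_sin_le_one x.1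
            have h0 := norm_nonneg x
            change |-Real.sin x.1| ≤ _
            rw [abs_neg]
            linarith
        have h4 : ‖pendulum y‖ ≤ dist (pendulum y) (pendulum x) + ‖pendulum x‖ := by
          rw [dist_eq_norm]
          simpa using norm_add_le (pendulum y - pendulum x) (pendulum x)
        push_cast
        linarith
      · have h0 := norm_nonneg x
        push_cast
        norm_num
        linarith
    obtain ⟨s, hs0, hs⟩ := hPL.exists_eq_forall_mem_Icc_hasDerivWithinAt₀
    refine ⟨s, hs0, fun t ht => ?_⟩
    have h := (hs t (Ioo_subset_Icc_self ht)).hasDerivAt (Icc_mem_nhds ht.1 ht.2)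
    exact (hasMFDerivAt_iff_hasFDerivAt.2 h.hasFDerivAt).hasMFDerivWithinAt
  obtain ⟨s, hs0, hs⟩ := exists_isMIntegralCurve_of_isMIntegralCurveOn (I := 𝓘(ℝ, ℝ × ℝ))
    (v := fun y => pendulum y) (contMDiff_vectorSpace_iff_contDiff.2 hsmooth)
    (by norm_num : (0 : ℝ) < 1 / 4) hloc s₀
  refine ⟨s, hs0, fun t => ?_⟩
  exact hasDerivAt_iff_hasFDerivAt.2 (hasMFDerivAt_iff_hasFDerivAt.1 (hs t))

instance instNonemptyNormalExtremal (lam : PhaseCylinder) : Nonempty (NormalExtremal lam) := by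
  obtain ⟨s, hs0, hs⟩ := exists_pendulum (lam.1.out, lam.2)
  have hγ : ∀ t, HasDerivAt (fun t => (s t).1) (s t).2 t := fun t => by
    simpa [pendulum] using! (hasFDerivAt_fst.comp_hasDerivAt t (hs t))
  have hc : ∀ t, HasDerivAt (fun t => (s t).2) (-Real.sin (s t).1) t := fun t => by
    simpa [pendulum] using! (hasFDerivAt_snd.comp_hasDerivAt t (hs t))
  have hγc : Continuous fun t => (s t).1 :=
    continuous_iff_continuousAt.2 fun t => (hγ t).continuousAt
  have hint : ∀ f : ℝ → ℝ, Continuous f →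
      ∀ t, HasDerivAt (fun t => ∫ u in (0 : ℝ)..t, f u) (f t) t := fun f hf t =>
    intervalIntegral.integral_hasDerivAt_right (hf.intervalIntegrable _ _)
      hf.stronglyMeasurable.stronglyMeasurableAtFilter hf.continuousAt
  have hz := hint (fun u => Real.sin ((s u).1 / 2)) (by fun_prop)
  have hzc : Continuous fun t => ∫ u in (0 : ℝ)..t, Real.sin ((s u).1 / 2) :=
    continuous_iff_continuousAt.2 fun t => (hz t).continuousAt
  refine ⟨{ γ := fun t => (s t).1
            c := fun t => (s t).2
            z := fun t => ∫ u in (0 : ℝ)..t, Real.sin ((s u).1 / 2)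
            x := fun t => ∫ v in (0 : ℝ)..t, Real.cos ((s v).1 / 2) *
              Real.cosh (∫ u in (0 : ℝ)..v, Real.sin ((s u).1 / 2))
            y := fun t => ∫ v in (0 : ℝ)..t, Real.cos ((s v).1 / 2) *
              Real.sinh (∫ u in (0 : ℝ)..v, Real.sin ((s u).1 / 2))
            deriv_γ := hγ
            deriv_c := hc
            deriv_x := hint (fun v => Real.cos ((s v).1 / 2) *
              Real.cosh (∫ u in (0 : ℝ)..v, Real.sin ((s u).1 / 2)))
                ((by fun_prop : Continuous fun v => Real.cos ((s v).1 / 2)).mul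
                  (Real.continuous_cosh.comp hzc))
            deriv_y := hint (fun v => Real.cos ((s v).1 / 2) *
              Real.sinh (∫ u in (0 : ℝ)..v, Real.sin ((s u).1 / 2)))
                ((by fun_prop : Continuous fun v => Real.cos ((s v).1 / 2)).mul
                  (Real.continuous_sinh.comp hzc))
            deriv_z := hz
            γ_zero := ?_
            c_zero := by simp [hs0]
            x_zero := by simp
            y_zero := by simp
            z_zero := by simp }⟩
  simp only [hs0]
  exact Quotient.out_eq lam.1

/-- Two normal extremals with the same initial data have the same projection to `SH(2)`, and their
angles differ by a constant multiple of `4π`. -/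
theorem NormalExtremal.unique {lam : PhaseCylinder} (e f : NormalExtremal lam) :
    (∃ m : ℤ, ∀ t, e.γ t = f.γ t + m * (4 * Real.pi)) ∧
      e.c = f.c ∧ e.x = f.x ∧ e.y = f.y ∧ e.z = f.z := by
  obtain ⟨m, hm⟩ : ∃ m : ℤ, e.γ 0 = f.γ 0 + m * (4 * Real.pi) := by
    have h := e.γ_zero.trans f.γ_zero.symm
    rw [QuotientAddGroup.eq_iff_sub_mem] at h
    obtain ⟨m, hm⟩ := AddSubgroup.mem_zmultiples_iff.1 h
    refine ⟨m, ?_⟩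
    rw [zsmul_eq_mul] at hm
    linarith
  have hpend : (fun t => (e.γ t, e.c t)) = fun t => (f.γ t + m * (4 * Real.pi), f.c t) := by
    refine ODE_solution_unique_univ (t₀ := 0) (v := fun _ => pendulum) (s := fun _ => univ) (K := 1)
      (fun _ => lipschitz_pendulum.lipschitzOnWith)
      (fun t => ⟨(e.deriv_γ t).prodMk (e.deriv_c t), mem_univ _⟩)
      (fun t => ⟨?_, mem_univ _⟩) ?_
    · have h := ((f.deriv_γ t).add_const (m * (4 * Real.pi))).prodMk (f.deriv_c t)
      have hsin : Real.sin (f.γ t + m * (4 * Real.pi)) = Real.sin (f.γ t) := by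
        have := Real.sin_add_int_mul_two_pi (f.γ t) (2 * m)
        rw [← this]
        push_cast
        ring_nf
      simpa only [pendulum, hsin] using h
    · simp only [hm, e.c_zero, f.c_zero]
  have hγ : ∀ t, e.γ t = f.γ t + m * (4 * Real.pi) := fun t => congrArg Prod.fst (congrFun hpend t)
  have hc : e.c = f.c := funext fun t => congrArg Prod.snd (congrFun hpend t)
  have hhalf : ∀ t, e.γ t / 2 = f.γ t / 2 + m * (2 * Real.pi) := fun t => by rw [hγ]; ring
  have hsin : ∀ t, Real.sin (e.γ t / 2) = Real.sin (f.γ t / 2) := fun t => by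
    rw [hhalf, Real.sin_add_int_mul_two_pi]
  have hcos : ∀ t, Real.cos (e.γ t / 2) = Real.cos (f.γ t / 2) := fun t => by
    rw [hhalf, Real.cos_add_int_mul_two_pi]
  have key : ∀ (g h k : ℝ → ℝ), (∀ t, HasDerivAt g (k t) t) → (∀ t, HasDerivAt h (k t) t) →
      g 0 = h 0 → g = h := fun g h k hg hh h0 =>
    ODE_solution_unique_univ (t₀ := 0) (v := fun t _ => k t) (s := fun _ => univ) (K := 0)
      (fun t => (LipschitzWith.const (k t)).lipschitzOnWith)
      (fun t => ⟨hg t, mem_univ _⟩) (fun t => ⟨hh t, mem_univ _⟩) h0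
  have hz : e.z = f.z := key _ _ _ e.deriv_z (fun t => by rw [hsin]; exact f.deriv_z t)
    (e.z_zero.trans f.z_zero.symm)
  refine ⟨⟨m, hγ⟩, hc, ?_, ?_, hz⟩
  · exact key _ _ _ e.deriv_x (fun t => by rw [hcos, hz]; exact f.deriv_x t)
      (e.x_zero.trans f.x_zero.symm)
  · exact key _ _ _ e.deriv_y (fun t => by rw [hcos, hz]; exact f.deriv_y t)
      (e.y_zero.trans f.y_zero.symm)

/-- The normal extremal with initial covector `lam` (it exists, and it is unique up to the choice
of the lift of the angle). -/
def extremal (lam : PhaseCylinder) : NormalExtremal lam := Classical.choice inferInstance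

/-- The exponential mapping `Exp(lam, t) = (x_t, y_t, z_t)`. -/
def expMap (ν : PhaseCylinder × ℝ) : ℝ × ℝ × ℝ :=
  ((extremal ν.1).x ν.2, (extremal ν.1).y ν.2, (extremal ν.1).z ν.2)

/-! ### Stratification of the phase cylinder and the bound `𝐭` -/

theorem cos_periodic_four_pi : Function.Periodic Real.cos (4 * Real.pi) := fun x => by
  have h := Real.cos_add_nat_mul_two_pi x 2
  rw [← h]
  push_cast
  ring_nf

/-- The energy `E = c² / 2 - cos γ` of the pendulum. -/
def energy (lam : PhaseCylinder) : ℝ := lam.2 ^ 2 / 2 - cos_periodic_four_pi.lift lam.1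

theorem energy_coe (γ c : ℝ) :
    energy ((γ : AddCircle (4 * Real.pi)), c) = c ^ 2 / 2 - Real.cos γ := rfl

def C₁ : Set PhaseCylinder := {lam | energy lam ∈ Ioo (-1) 1}
def C₂ : Set PhaseCylinder := {lam | energy lam ∈ Ioi 1}
def C₃ : Set PhaseCylinder := {lam | energy lam = 1 ∧ lam.2 ≠ 0}
def C₄ : Set PhaseCylinder := {lam | energy lam = -1 ∧ lam.2 = 0}
def C₅ : Set PhaseCylinder := {lam | energy lam = 1 ∧ lam.2 = 0}

/-- The complete elliptic integral of the first kind `K(k)`. -/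
def ellipticK (k : ℝ) : ℝ :=
  ∫ θ in (0 : ℝ)..(Real.pi / 2), 1 / Real.sqrt (1 - k ^ 2 * Real.sin θ ^ 2)

/-- The modulus `k` of a point of `C₁`. -/
def modulusC₁ (lam : PhaseCylinder) : ℝ := Real.sqrt ((energy lam + 1) / 2)

/-- The modulus `k` of a point of `C₂`. -/
def modulusC₂ (lam : PhaseCylinder) : ℝ := Real.sqrt (2 / (energy lam + 1))

open Classical in
/-- The function `𝐭 : C → (0, +∞]`; the last case is `lam ∈ C₃ ∪ C₅`. -/
def tBound (lam : PhaseCylinder) : EReal :=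
  if lam ∈ C₁ then ((4 * ellipticK (modulusC₁ lam) : ℝ) : EReal)
  else if lam ∈ C₂ then ((4 * modulusC₂ lam * ellipticK (modulusC₂ lam) : ℝ) : EReal)
  else if lam ∈ C₄ then ((2 * Real.pi : ℝ) : EReal)
  else ⊤

/-! ### The open domains -/

/-- `Ñ ⊆ N = C × (0, +∞)`. -/
def NTilde : Set (PhaseCylinder × ℝ) :=
  {ν | 0 < ν.2 ∧ ν.1 ∈ C₁ ∪ C₂ ∪ C₃ ∧ (ν.2 : EReal) < tBound ν.1 ∧
      Real.sin ((extremal ν.1).γ (ν.2 / 2) / 2) ≠ 0} ∪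
    {ν | 0 < ν.2 ∧ ν.1 ∈ C₅}

/-- `M̃ = {q = (x, y, z) : z ≠ 0}`. -/
def MTilde : Set (ℝ × ℝ × ℝ) := {q | q.2.2 ≠ 0}

end SH2

end

/-! An extremal of length `t` is described by its midpoint: `θ = γ_{t/2}/2`, `p = c_{t/2}/2`, `τ =
t/2`, with squared modulus `h = p² + sin²θ = (E+1)/2`. The addition formulas for the pendulum show
that, in the target coordinates `targetChart`, Exp becomes `midExp`, that is `(θ, p, τ) ↦ (cos θ ·
ef, p · eg, sin θ · sn)` with the elliptic functions taken at `(h, τ)`. Working with `h` and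
defining `ef`, `eg` by an ODE, not by quotients with denominator `1 - h`, makes everything smooth
across the separatrix `h = 1`. The bound `t < 𝐭(λ)` says that `τ` precedes the first positive zero
of `sn` (`BeforeZero`); at `h = 1` there is no such zero, and `C₅` needs no separate treatment. Thus
Ñ corresponds to `midDomain` (`mem_NTilde_iff`), where `sin θ ≠ 0`; a symmetry exchanges the two
signs of `sin θ`.

For `0 < θ < π`, `midExp` is shown to be a bijection onto `ℝ × ℝ × (0, 1)` by a Hadamard argument
(`existsUnique_of_proper`): it is a proper local diffeomorphism onto a connected set, and one fibre
is a single point.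

Local invertibility: for fixed `h`, `τ`, minus the Jacobian determinant is a quadratic polynomial in
`x = sin²θ`. It is concave, nonnegative at `0` and positive at `min(1, h)`, where it factors; and `0
< x ≤ min(1, h)` (`BeforeZero.jacobian_pos`). The two sign conditions come from functions of `τ`
that vanish at `0` and whose derivative is a nonnegative multiple of a square.

Properness: a large `τ` makes `ef` and `eg` large, so bounded values of `midExp` force `cos θ` and
`p` to be small. Near that equilibrium a third coordinate kept away from `0` and `1` bounds the time
(`exists_time_bound`).

Smoothness of all flows in time and parameters comes from the implicit function theorem in `C([0,1],
E)` (`contDiffAt_solution`). -/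

noncomputable section

namespace SH2

/-! ### Smooth dependence of solutions of ordinary differential equations on parameters -/

/-! ### Composition operators on spaces of continuous functions. -/

section Composition

variable {K : Type*} [TopologicalSpace K] [CompactSpace K]

/-- Pointwise application of a continuous family of operators to a continuous function. -/
def pointwiseApply (K : Type*) [TopologicalSpace K] [CompactSpace K]
    (E F : Type*) [NormedAddCommGroup E] [NormedSpace ℝ E]
    [NormedAddCommGroup F] [NormedSpace ℝ F] :
    C(K, E →L[ℝ] F) →L[ℝ] C(K, E) →L[ℝ] C(K, F) :=
  LinearMap.mkContinuous₂
    (LinearMap.mk₂ ℝ (fun (A : C(K, E →L[ℝ] F)) (b : C(K, E)) =>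
        (⟨fun r => A r (b r), by fun_prop⟩ : C(K, F)))
      (fun _ _ _ => by ext; simp) (fun _ _ _ => by ext; simp)
      (fun _ _ _ => by ext; simp) (fun _ _ _ => by ext; simp)) 1
    (fun A b => by
      rw [one_mul]
      refine (ContinuousMap.norm_le _ (by positivity)).2 fun r => ?_
      exact ((A r).le_opNorm (b r)).trans
        (mul_le_mul (A.norm_coe_le_norm r) (b.norm_coe_le_norm r) (norm_nonneg _) (norm_nonneg A)))

@[simp]
theorem pointwiseApply_apply {E F : Type*} [NormedAddCommGroup E] [NormedSpace ℝ E]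
    [NormedAddCommGroup F] [NormedSpace ℝ F] (A : C(K, E →L[ℝ] F)) (b : C(K, E)) (r : K) :
    pointwiseApply K E F A b r = A r (b r) := rfl

/-- The mean value inequality on the segment from `a r` to `a r + b r` bounds the remainder by the
oscillation of `V'` there. Continuity of `b ↦ V' ∘ b` in the uniform norm makes this bound uniform
in `r`. -/
theorem hasFDerivAt_continuousMap_comp {E F : Type*} [NormedAddCommGroup E] [NormedSpace ℝ E]
    [NormedAddCommGroup F] [NormedSpace ℝ F] (V : C(E, F)) (V' : C(E, E →L[ℝ] F))
    (hV : ∀ x, HasFDerivAt V (V' x) x) (a : C(K, E)) :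
    HasFDerivAt (fun a : C(K, E) => V.comp a) (pointwiseApply K E F (V'.comp a)) a := by
  rw [hasFDerivAt_iff_isLittleO_nhds_zero, Asymptotics.isLittleO_iff]
  intro c hc
  have hcont : ContinuousAt (fun b : C(K, E) => V'.comp b) a :=
    (ContinuousMap.continuous_postcomp V').continuousAt
  obtain ⟨δ, hδ, H⟩ := (Metric.continuousAt_iff (α := C(K, E)) (β := C(K, E →L[ℝ] F))).1 hcont c hc
  filter_upwards [Metric.ball_mem_nhds (0 : C(K, E)) hδ] with b hb
  rw [mem_ball_zero_iff] at hb
  refine (ContinuousMap.norm_le _ (by positivity)).2 fun r => ?_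
  have key : ‖V (a r + b r) - V (a r) - V' (a r) (a r + b r - a r)‖ ≤ c * ‖a r + b r - a r‖ := by
    refine (convex_segment (a r) (a r + b r)).norm_image_sub_le_of_norm_hasFDerivWithin_le'
      (f' := fun y => V' y) (fun y _ => (hV y).hasFDerivWithinAt) ?_
      (left_mem_segment ℝ _ _) (right_mem_segment ℝ _ _)
    rintro y hy
    obtain ⟨s, hs, rfl⟩ := (segment_eq_image' ℝ (a r) (a r + b r)) ▸ hy
    have h1 : dist (a + s • b) a < δ := by
      rw [dist_eq_norm, add_sub_cancel_left, norm_smul, Real.norm_of_nonneg hs.1]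
      exact (mul_le_of_le_one_left (norm_nonneg _) hs.2).trans_lt hb
    have h2 := (ContinuousMap.dist_apply_le_dist r).trans (H h1).le
    rw [dist_eq_norm] at h2
    simpa using h2
  simp only [add_sub_cancel_left] at key
  exact key.trans (mul_le_mul_of_nonneg_left (b.norm_coe_le_norm r) hc.le)

theorem contDiff_pointwiseApply {E F : Type} [NormedAddCommGroup E] [NormedSpace ℝ E]
    [NormedAddCommGroup F] [NormedSpace ℝ F] {n : WithTop ℕ∞} :
    ContDiff ℝ n (pointwiseApply K E F) := by
  exact ContinuousLinearMap.contDiff _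

/-- The derivative is a continuous linear map applied to composition with `V'`, which is one degree
less smooth. Since `V'` takes values in `E →L[ℝ] F`, the induction runs over all targets `F` at
once. -/
theorem contDiff_nat_continuousMap_comp {E : Type} [NormedAddCommGroup E] [NormedSpace ℝ E]
    (n : ℕ) : ∀ {F : Type} [NormedAddCommGroup F] [NormedSpace ℝ F] (V : C(E, F)),
      ContDiff ℝ n V → ContDiff ℝ n (fun a : C(K, E) => V.comp a) := by
  induction n with
  | zero =>
    intro F _ _ V _
    exact contDiff_zero.2 (ContinuousMap.continuous_postcomp V)
  | succ n ih =>
    intro F _ _ V hV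
    push_cast at hV ⊢
    obtain ⟨V', hV', h⟩ := contDiff_succ_iff_hasFDerivAt.1 hV
    let W : C(E, E →L[ℝ] F) := ⟨V', hV'.continuous⟩
    exact contDiff_succ_iff_hasFDerivAt.2 ⟨fun a => pointwiseApply K E F (W.comp a),
      contDiff_pointwiseApply.comp (ih W hV'),
      fun a => hasFDerivAt_continuousMap_comp V W h a⟩

theorem contDiff_continuousMap_comp {E F : Type} [NormedAddCommGroup E] [NormedSpace ℝ E]
    [NormedAddCommGroup F] [NormedSpace ℝ F] (V : C(E, F)) (hV : ContDiff ℝ ∞ V) :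
    ContDiff ℝ ∞ (fun a : C(K, E) => V.comp a) :=
  contDiff_infty.2 fun n => contDiff_nat_continuousMap_comp n V (contDiff_infty.1 hV n)

end Composition

/-! ### Invertibility of `1 - N` for a Volterra operator `N`. -/

section Volterra

variable {E : Type} [NormedAddCommGroup E] [NormedSpace ℝ E]

/-- The primitive vanishing at `0` of a continuous function on the unit interval. -/
def primitive (E : Type) [NormedAddCommGroup E] [NormedSpace ℝ E] :
    C(unitInterval, E) →L[ℝ] C(unitInterval, E) :=
  LinearMap.mkContinuous
    { toFun := fun b => ⟨fun r => ∫ s in (0 : ℝ)..r, b (projIcc 0 1 zero_le_one s), by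
        have h : Continuous fun s : ℝ => b (projIcc 0 1 zero_le_one s) := by fun_prop
        exact (intervalIntegral.continuous_primitive (fun _ _ => h.intervalIntegrable _ _) 0).comp
          continuous_subtype_val⟩
      map_add' := fun a b => by
        ext r
        simp only [ContinuousMap.coe_mk, ContinuousMap.add_apply]
        exact intervalIntegral.integral_add
          (Continuous.intervalIntegrable (by fun_prop) _ _)
          (Continuous.intervalIntegrable (by fun_prop) _ _)
      map_smul' := fun c b => by
        ext r
        simp } 1
    (fun b => by
      rw [one_mul]
      refine (ContinuousMap.norm_le _ (norm_nonneg _)).2 fun r => ?_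
      simp only [LinearMap.coe_mk, AddHom.coe_mk, ContinuousMap.coe_mk]
      refine (intervalIntegral.norm_integral_le_of_norm_le_const
        (C := ‖b‖) fun s _ => b.norm_coe_le_norm _).trans ?_
      rw [sub_zero, abs_of_nonneg r.2.1]
      exact mul_le_of_le_one_right (norm_nonneg _) r.2.2)

theorem primitive_apply (b : C(unitInterval, E)) (r : unitInterval) :
    primitive E b r = ∫ s in (0 : ℝ)..r, b (projIcc 0 1 zero_le_one s) := rfl

/-- Each application integrates the previous bound, which produces the factorial. -/
theorem norm_volterra_pow_apply_le (A : C(unitInterval, E →L[ℝ] E)) (b : C(unitInterval, E))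
    (n : ℕ) (r : unitInterval) :
    ‖((primitive E ∘L pointwiseApply unitInterval E E A) ^ n) b r‖ ≤
      ‖b‖ * ((‖A‖ * r) ^ n / n.factorial) := by
  induction n generalizing r with
  | zero => simpa using b.norm_coe_le_norm r
  | succ n ih =>
    rw [pow_succ', mul_apply_eq_comp, ContinuousLinearMap.comp_apply, primitive_apply]
    have hint : ∫ s in (0 : ℝ)..r, ‖A‖ * (‖b‖ * ((‖A‖ * s) ^ n / n.factorial)) =
        ‖b‖ * ((‖A‖ * r) ^ (n + 1) / (n + 1).factorial) := by
      have : (fun s : ℝ => ‖A‖ * (‖b‖ * ((‖A‖ * s) ^ n / n.factorial))) =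
          fun s => (‖b‖ * ‖A‖ ^ (n + 1) / n.factorial) * s ^ n := by
        ext s; rw [mul_pow]; ring
      rw [this, intervalIntegral.integral_const_mul, integral_pow, Nat.factorial_succ]
      push_cast
      have : (n.factorial : ℝ) ≠ 0 := by positivity
      have : (n + 1 : ℝ) ≠ 0 := by positivity
      field_simp
      simp [mul_pow, mul_assoc]
    rw [← hint]
    refine intervalIntegral.norm_integral_le_of_norm_le r.2.1 ?_
      (Continuous.intervalIntegrable (by fun_prop) _ _)
    refine Filter.Eventually.of_forall fun s hs => ?_
    have hs' : s ∈ Icc (0 : ℝ) 1 := ⟨hs.1.le, hs.2.trans r.2.2⟩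
    rw [projIcc_of_mem _ hs', pointwiseApply_apply]
    refine ((A _).le_opNorm _).trans (mul_le_mul (A.norm_coe_le_norm _) (ih ⟨s, hs'⟩)
      (norm_nonneg _) (norm_nonneg A))

/-- The norm of `N` need not be small, but that of some power is. So `1 - N ^ n` is a unit, and it
factors as `1 - N` times a geometric sum commuting with it. -/
theorem isUnit_one_sub_volterra [CompleteSpace E] (A : C(unitInterval, E →L[ℝ] E)) :
    IsUnit (1 - primitive E ∘L pointwiseApply unitInterval E E A) := by
  set N := primitive E ∘L pointwiseApply unitInterval E E A with hN
  obtain ⟨n, hn⟩ : ∃ n : ℕ, ‖A‖ ^ n / n.factorial < 1 :=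
    ((FloorSemiring.tendsto_pow_div_factorial_atTop ‖A‖).eventually
      (gt_mem_nhds one_pos)).exists
  have h1 : ‖N ^ n‖ < 1 := by
    refine lt_of_le_of_lt (ContinuousLinearMap.opNorm_le_bound _ (by positivity) fun b => ?_) hn
    refine (ContinuousMap.norm_le _ (by positivity)).2 fun r => ?_
    refine (norm_volterra_pow_apply_le A b n r).trans ?_
    rw [mul_comm]
    gcongr
    · exact mul_nonneg (norm_nonneg A) r.2.1
    · exact mul_le_of_le_one_right (norm_nonneg A) r.2.2
  have h2 := isUnit_one_sub_of_norm_lt_one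
    (R := C(unitInterval, E) →L[ℝ] C(unitInterval, E)) h1
  rw [← mul_neg_geom_sum] at h2
  refine ((Commute.isUnit_mul_iff ?_).1 h2).1
  exact (Commute.one_left _).sub_left (Commute.sum_right _ _ _ fun i _ => (Commute.refl N).pow_right i)

end Volterra
end SH2
end

/-! ### The implicit function argument for flows. -/

noncomputable section

namespace SH2

/-- The integral equation is the ODE rescaled to `[0, 1]`, so that any time `T`, negative ones
included, becomes a parameter. Uniqueness identifies its solution with `b (T * ·)`. -/
theorem eq_of_integral_equation {E : Type} [NormedAddCommGroup E] [NormedSpace ℝ E]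
    [FiniteDimensional ℝ E] {V : E → E} (hV : ContDiff ℝ ∞ V) {b : ℝ → E} {e : E} (hb0 : b 0 = e)
    {T : ℝ} (hb : ∀ t, HasDerivAt b (V (b t)) t) (a : C(unitInterval, E))
    (ha : ∀ r : unitInterval,
      a r = e + T • ∫ s in (0 : ℝ)..r, V (a (projIcc 0 1 zero_le_one s))) :
    a 1 = b T := by
  have hc : Continuous fun s : ℝ => V (a (projIcc 0 1 zero_le_one s)) :=
    hV.continuous.comp (by fun_prop)
  set c : ℝ → E := fun t => e + T • ∫ s in (0 : ℝ)..t, V (a (projIcc 0 1 zero_le_one s)) with hcdef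
  have hca : ∀ t ∈ Icc (0 : ℝ) 1, c t = a (projIcc 0 1 zero_le_one t) := fun t ht => by
    rw [projIcc_of_mem _ ht, ha]
  have hcd : ∀ t ∈ Icc (0 : ℝ) 1, HasDerivAt c (T • V (c t)) t := fun t ht => by
    rw [hca t ht]
    exact ((intervalIntegral.integral_hasDerivAt_right (hc.intervalIntegrable _ _)
      hc.stronglyMeasurable.stronglyMeasurableAtFilter hc.continuousAt).const_smul T).const_add e
  have hbd : ∀ t : ℝ, HasDerivAt (fun t => b (T * t)) (T • V (b (T * t))) t := fun t => by
    have h := (hb (T * t)).scomp t ((hasDerivAt_id t).const_mul T)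
    simpa [Function.comp_def] using h
  have hcc : ContinuousOn c (Icc 0 1) := fun t ht => (hcd t ht).continuousAt.continuousWithinAt
  have hbc : Continuous fun t => b (T * t) :=
    continuous_iff_continuousAt.2 fun t => (hbd t).continuousAt
  -- `V` is only locally Lipschitz, so uniqueness is applied inside a ball containing both compact
  -- trajectories.
  obtain ⟨R, hR⟩ := ((isCompact_Icc.image_of_continuousOn hcc).union
    (isCompact_Icc.image hbc)).isBounded.subset_closedBall (0 : E)
  obtain ⟨K, hK⟩ := hV.contDiffOn.exists_lipschitzOnWith (s := Metric.closedBall (0 : E) R)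
    (by simp) (convex_closedBall _ _) (isCompact_closedBall _ _)
  have key := ODE_solution_unique_of_mem_Icc_right (v := fun _ x => T • V x)
    (s := fun _ => Metric.closedBall (0 : E) R) (K := ‖T‖₊ * K) (f := c) (g := fun t => b (T * t))
    (a := 0) (b := 1)
    (fun t _ => (lipschitzWith_smul T).comp_lipschitzOnWith hK) hcc
    (fun t ht => (hcd t (Ico_subset_Icc_self ht)).hasDerivWithinAt)
    (fun t ht => hR (Or.inl ⟨t, Ico_subset_Icc_self ht, rfl⟩)) hbc.continuousOn
    (fun t _ => (hbd t).hasDerivWithinAt)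
    (fun t ht => hR (Or.inr ⟨t, Ico_subset_Icc_self ht, rfl⟩))
    (by simp [hcdef, hb0]) (right_mem_Icc.2 zero_le_one)
  have h1 := hca 1 (right_mem_Icc.2 zero_le_one)
  rw [projIcc_right] at h1
  have h2 : c 1 = b (T * 1) := key
  rw [mul_one] at h2
  exact h1.symm.trans h2

/-- Global solutions of a smooth autonomous system depend smoothly on time and on parameters
entering through the initial value. -/
theorem contDiffAt_solution {P E : Type} [NormedAddCommGroup P] [NormedSpace ℝ P] [CompleteSpace P]
    [NormedAddCommGroup E] [NormedSpace ℝ E] [FiniteDimensional ℝ E] {V : E → E}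
    (hV : ContDiff ℝ ∞ V) {ι : P → E} {φ : P → ℝ → E} {U : Set P} (hU : IsOpen U)
    (hι : ContDiffOn ℝ ∞ ι U) (h0 : ∀ p ∈ U, φ p 0 = ι p)
    (hφ : ∀ p ∈ U, ∀ t, HasDerivAt (φ p) (V (φ p t)) t) {p : P} (hp : p ∈ U) (T : ℝ) :
    ContDiffAt ℝ ∞ (fun q : P × ℝ => φ q.1 q.2) (p, T) := by
  have : CompleteSpace E := FiniteDimensional.complete ℝ E
  let Vc : C(E, E) := ⟨V, hV.continuous⟩
  let W : C(E, E →L[ℝ] E) := ⟨fderiv ℝ V, hV.continuous_fderiv (by simp)⟩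
  have hW : ∀ x, HasFDerivAt Vc (W x) x := fun x =>
    (hV.differentiable (by simp) x).hasFDerivAt
  -- Zeros of `G` are trajectories rescaled to `[0, 1]`. Time enters as a parameter, so one implicit
  -- function theorem gives joint smoothness in parameter and time.
  let G : (P × ℝ) × C(unitInterval, E) → C(unitInterval, E) := fun u =>
    u.2 - ContinuousLinearMap.const ℝ unitInterval (ι u.1.1) - u.1.2 • primitive E (Vc.comp u.2)
  have hφc : Continuous (φ p) := continuous_iff_continuousAt.2 fun t => (hφ p hp t).continuousAt
  let a₀ : C(unitInterval, E) := ⟨fun r => φ p (T * r), by fun_prop⟩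
  have hGzero : G ((p, T), a₀) = 0 := by
    ext r
    have hint : ∫ s in (0 : ℝ)..r, T • V (φ p (T * s)) = φ p (T * r) - φ p (T * 0) := by
      refine intervalIntegral.integral_eq_sub_of_hasDerivAt (f := fun s => φ p (T * s))
        (fun t _ => ?_) (Continuous.intervalIntegrable
          ((hV.continuous.comp (by fun_prop)).const_smul T) _ _)
      have h := (hφ p hp (T * t)).scomp t ((hasDerivAt_id t).const_mul T)
      simpa [Function.comp_def] using h
    have hcongr : ∫ s in (0 : ℝ)..r, V (a₀ (projIcc 0 1 zero_le_one s)) =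
        ∫ s in (0 : ℝ)..r, V (φ p (T * s)) := by
      refine intervalIntegral.integral_congr fun s hs => ?_
      rw [uIcc_of_le r.2.1] at hs
      have hs' : s ∈ Icc (0 : ℝ) 1 := ⟨hs.1, hs.2.trans r.2.2⟩
      simp only [projIcc_of_mem _ hs']
      rfl
    have h : G ((p, T), a₀) r = φ p (T * r) - ι p -
        T • ∫ s in (0 : ℝ)..r, V (a₀ (projIcc 0 1 zero_le_one s)) := rfl
    rw [h, hcongr, ← intervalIntegral.integral_smul, hint, mul_zero, h0 p hp]
    simp
  have hG : ContDiffAt ℝ ∞ G ((p, T), a₀) := by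
    have h1 : ContDiffAt ℝ ∞ (fun u : (P × ℝ) × C(unitInterval, E) => ι u.1.1) ((p, T), a₀) :=
      ContDiffAt.comp (x := ((p, T), a₀)) (hι.contDiffAt (hU.mem_nhds hp))
        (contDiffAt_fst.fst)
    have h2 : ContDiffAt ℝ ∞ (fun u : (P × ℝ) × C(unitInterval, E) => Vc.comp u.2)
        ((p, T), a₀) := (contDiff_continuousMap_comp Vc hV).contDiffAt.comp _ contDiffAt_snd
    have h3 : ContDiff ℝ ∞ (primitive E) := by exact ContinuousLinearMap.contDiff _
    have h4 : ContDiff ℝ ∞ (ContinuousLinearMap.const ℝ unitInterval : E →L[ℝ] _) := by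
      exact ContinuousLinearMap.contDiff _
    exact (contDiffAt_snd.sub (h4.contDiffAt.comp _ h1)).sub
      (contDiffAt_fst.snd.smul (h3.contDiffAt.comp _ h2))
  -- The partial derivative in the trajectory is the identity minus a Volterra operator, hence
  -- invertible.
  have hinv : (fderiv ℝ G ((p, T), a₀) ∘L
      ContinuousLinearMap.inr ℝ (P × ℝ) C(unitInterval, E)).IsInvertible := by
    have h1 : HasFDerivAt (fun a => G ((p, T), a)) (fderiv ℝ G ((p, T), a₀) ∘L
        ContinuousLinearMap.inr ℝ (P × ℝ) C(unitInterval, E)) a₀ :=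
      ((hG.differentiableAt (by simp)).hasFDerivAt).comp a₀ (hasFDerivAt_prodMk_right (p, T) a₀)
    have h2 : HasFDerivAt (fun a => G ((p, T), a))
        (1 - primitive E ∘L pointwiseApply unitInterval E E (T • W.comp a₀)) a₀ := by
      have h3 := (hasFDerivAt_continuousMap_comp Vc W hW a₀)
      have h4 := ((primitive E).hasFDerivAt.comp a₀ h3).const_smul T
      have h5 := ((hasFDerivAt_id a₀).sub_const
        (ContinuousLinearMap.const ℝ unitInterval (ι p))).sub h4
      convert! h5 using 1
      ext b r
      simp
    rw [h1.unique h2]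
    obtain ⟨w, hw⟩ := isUnit_one_sub_volterra (T • W.comp a₀)
    rw [← hw]
    exact ⟨ContinuousLinearEquiv.unitsEquiv ℝ _ w, rfl⟩
  have hψ := hG.contDiffAt_implicitFunction (by simp) hinv
  set ψ := hG.implicitFunction (by simp) hinv
  have hev := hG.eventually_apply_implicitFunction (by simp) hinv
  have h1 : ContDiffAt ℝ ∞ (fun q : P × ℝ => ψ q 1) (p, T) := by
    have h3 : ContDiff ℝ ∞ (ContinuousMap.evalCLM ℝ (1 : unitInterval) : C(unitInterval, E) →L[ℝ] E) := by
      exact ContinuousLinearMap.contDiff _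
    exact h3.contDiffAt.comp (p, T) hψ
  refine h1.congr_of_eventuallyEq ?_
  have hevU : ∀ᶠ q : P × ℝ in 𝓝 (p, T), q.1 ∈ U := continuousAt_fst.eventually (hU.mem_nhds hp)
  filter_upwards [hev, hevU] with q hq hqU
  -- The implicit function keeps `G` at its value at the base point, which is zero. Uniqueness then
  -- identifies it with the given solution, with no prior continuity in the parameter.
  rw [hGzero] at hq
  refine (eq_of_integral_equation hV (h0 q.1 hqU) (hφ q.1 hqU) (ψ q) fun r => ?_).symm
  have h : G (q, ψ q) r = ψ q r - ι q.1 -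
        q.2 • ∫ s in (0 : ℝ)..r, V (ψ q (projIcc 0 1 zero_le_one s)) := rfl
  have h' : G (q, ψ q) r = 0 := by rw [hq]; rfl
  rw [h, sub_sub, sub_eq_zero] at h'
  exact h'

end SH2
end

noncomputable section

namespace SH2

theorem hasDerivAt_comp_fst {E F : Type*} [NormedAddCommGroup E] [NormedSpace ℝ E]
    [NormedAddCommGroup F] [NormedSpace ℝ F] {a : ℝ → E × F} {a' : E × F} {t : ℝ}
    (ha : HasDerivAt a a' t) : HasDerivAt (fun t => (a t).1) a'.1 t :=
  (hasFDerivAt_fst (𝕜 := ℝ) (E := E) (F := F)).comp_hasDerivAt t ha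

theorem hasDerivAt_comp_snd {E F : Type*} [NormedAddCommGroup E] [NormedSpace ℝ E]
    [NormedAddCommGroup F] [NormedSpace ℝ F] {a : ℝ → E × F} {a' : E × F} {t : ℝ}
    (ha : HasDerivAt a a' t) : HasDerivAt (fun t => (a t).2) a'.2 t :=
  (hasFDerivAt_snd (𝕜 := ℝ) (E := E) (F := F)).comp_hasDerivAt t ha

/-! ### The flow of the pendulum -/

/-- The flow of the pendulum. -/
def pendulumFlow (s : ℝ × ℝ) : ℝ → ℝ × ℝ := Classical.choose (exists_pendulum s)

theorem pendulumFlow_zero (s : ℝ × ℝ) : pendulumFlow s 0 = s :=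
  (Classical.choose_spec (exists_pendulum s)).1

theorem hasDerivAt_pendulumFlow (s : ℝ × ℝ) (t : ℝ) :
    HasDerivAt (pendulumFlow s) (pendulum (pendulumFlow s t)) t :=
  (Classical.choose_spec (exists_pendulum s)).2 t

theorem contDiff_pendulumFlow : ContDiff ℝ ∞ fun q : (ℝ × ℝ) × ℝ => pendulumFlow q.1 q.2 := by
  rw [contDiff_iff_contDiffAt]
  rintro ⟨s, t⟩
  have hV : ContDiff ℝ ∞ pendulum := by unfold pendulum; fun_prop
  exact contDiffAt_solution hV isOpen_univ contDiffOn_id (fun p _ => pendulumFlow_zero p)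
    (fun p _ => hasDerivAt_pendulumFlow p) (mem_univ s) t

theorem hasDerivAt_pendulumFlow_fst (s : ℝ × ℝ) (t : ℝ) :
    HasDerivAt (fun t => (pendulumFlow s t).1) (pendulumFlow s t).2 t := by
  exact hasDerivAt_comp_fst (hasDerivAt_pendulumFlow s t)

theorem hasDerivAt_pendulumFlow_snd (s : ℝ × ℝ) (t : ℝ) :
    HasDerivAt (fun t => (pendulumFlow s t).2) (-Real.sin (pendulumFlow s t).1) t := by
  exact hasDerivAt_comp_snd (hasDerivAt_pendulumFlow s t)

theorem pendulum_unique {a b : ℝ → ℝ × ℝ} (ha : ∀ t, HasDerivAt a (pendulum (a t)) t)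
    (hb : ∀ t, HasDerivAt b (pendulum (b t)) t) {t₀ : ℝ} (h : a t₀ = b t₀) : a = b :=
  ODE_solution_unique_univ (v := fun _ => pendulum) (s := fun _ => univ) (K := 1)
    (fun _ => lipschitz_pendulum.lipschitzOnWith) (fun t => ⟨ha t, mem_univ _⟩)
    (fun t => ⟨hb t, mem_univ _⟩) h

/-! ### Half-angle variables -/

theorem hasDerivAt_sin_half {γ c : ℝ → ℝ} {t : ℝ} (hγ : HasDerivAt γ (c t) t) :
    HasDerivAt (fun t => Real.sin (γ t / 2)) (Real.cos (γ t / 2) * (c t / 2)) t :=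
  (hγ.div_const 2).sin

theorem hasDerivAt_cos_half {γ c : ℝ → ℝ} {t : ℝ} (hγ : HasDerivAt γ (c t) t) :
    HasDerivAt (fun t => Real.cos (γ t / 2)) (-(Real.sin (γ t / 2) * (c t / 2))) t := by
  convert! (hγ.div_const 2).cos using 1
  ring

theorem hasDerivAt_half_snd {γ c : ℝ → ℝ} {t : ℝ} (hc : HasDerivAt c (-Real.sin (γ t)) t) :
    HasDerivAt (fun t => c t / 2) (-(Real.sin (γ t / 2) * Real.cos (γ t / 2))) t := by
  convert! hc.div_const 2 using 1
  have := Real.sin_two_mul (γ t / 2)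
  rw [mul_div_cancel₀ _ (two_ne_zero)] at this
  rw [this]
  ring

/-! ### Jacobi's elliptic functions with parameter `h = k ^ 2` -/

/-- The polynomial system satisfied by `sn`, `cn`, `dn` and the two functions `ef`, `eg`, with the
parameter as an additional constant. -/
def jacobiField (s : ℝ × ℝ × ℝ × ℝ × ℝ × ℝ) : ℝ × ℝ × ℝ × ℝ × ℝ × ℝ :=
  (0, s.2.2.1 * s.2.2.2.1, -(s.2.1 * s.2.2.2.1), -(s.1 * s.2.1 * s.2.2.1),
    s.2.2.2.1 + s.1 * s.2.1 * s.2.2.2.2.2, s.2.1 * s.2.2.2.2.1)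

/-- Variation of constants. -/
theorem exists_linear_solution {a b : ℝ → ℝ} (ha : Continuous a) (hb : Continuous b) :
    ∃ y : ℝ → ℝ, y 0 = 0 ∧ ∀ t, HasDerivAt y (b t + a t * y t) t := by
  have hint : ∀ f : ℝ → ℝ, Continuous f →
      ∀ t, HasDerivAt (fun t => ∫ u in (0 : ℝ)..t, f u) (f t) t := fun f hf t =>
    intervalIntegral.integral_hasDerivAt_right (hf.intervalIntegrable _ _)
      hf.stronglyMeasurable.stronglyMeasurableAtFilter hf.continuousAt
  have hA := hint a ha
  set A : ℝ → ℝ := fun t => ∫ u in (0 : ℝ)..t, a u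
  have hAc : Continuous A := continuous_iff_continuousAt.2 fun t => (hA t).continuousAt
  have hB := hint (fun t => Real.exp (-A t) * b t) (by fun_prop)
  set B : ℝ → ℝ := fun t => ∫ u in (0 : ℝ)..t, Real.exp (-A u) * b u
  refine ⟨fun t => Real.exp (A t) * B t, by simp [B], fun t => ?_⟩
  convert! (hA t).exp.mul (hB t) using 1
  have : Real.exp (A t) * Real.exp (-A t) = 1 := by rw [← Real.exp_add]; simp
  linear_combination (- b t) * this

/-- The field is not globally Lipschitz, so global existence is read off the pendulum started at
angle `0` with velocity `2 * k`: there `sin (γ / 2) = k * sn`, `c / 2 = k * cn` and `cos (γ / 2) =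
dn`. The equations for `ef` and `eg` are then linear. -/
theorem exists_jacobi (h : ℝ) (hh : 0 < h) : ∃ X : ℝ → ℝ × ℝ × ℝ × ℝ × ℝ × ℝ,
    X 0 = (h, 0, 1, 1, 0, 0) ∧ ∀ t, HasDerivAt X (jacobiField (X t)) t := by
  set k := Real.sqrt h with hk
  have hk0 : k ≠ 0 := (Real.sqrt_pos.2 hh).ne'
  have hk2 : k ^ 2 = h := Real.sq_sqrt hh.le
  obtain ⟨γ, c, hγ0, hc0, hγ, hc⟩ : ∃ γ c : ℝ → ℝ, γ 0 = 0 ∧ c 0 = 2 * k ∧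
      (∀ t, HasDerivAt γ (c t) t) ∧ ∀ t, HasDerivAt c (-Real.sin (γ t)) t :=
    ⟨_, _, congrArg Prod.fst (pendulumFlow_zero (0, 2 * k)),
      congrArg Prod.snd (pendulumFlow_zero (0, 2 * k)),
      hasDerivAt_pendulumFlow_fst _, hasDerivAt_pendulumFlow_snd _⟩
  have hγc : Continuous γ := continuous_iff_continuousAt.2 fun t => (hγ t).continuousAt
  -- The combinations `α = ef - k * eg` and `β = ef + k * eg` decouple the linear system.
  obtain ⟨α, hα0, hα⟩ := exists_linear_solution (a := fun t => -Real.sin (γ t / 2))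
    (b := fun t => Real.cos (γ t / 2)) (by fun_prop) (by fun_prop)
  obtain ⟨β, hβ0, hβ⟩ := exists_linear_solution (a := fun t => Real.sin (γ t / 2))
    (b := fun t => Real.cos (γ t / 2)) (by fun_prop) (by fun_prop)
  refine ⟨fun t => (h, Real.sin (γ t / 2) / k, c t / 2 / k, Real.cos (γ t / 2),
    (α t + β t) / 2, (β t - α t) / (2 * k)), ?_, fun t => ?_⟩
  · simp [hγ0, hc0, hα0, hβ0, hk0]
  · have h1 : HasDerivAt (fun t => Real.sin (γ t / 2) / k)
        (c t / 2 / k * Real.cos (γ t / 2)) t :=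
      ((hasDerivAt_sin_half (hγ t)).div_const k).congr_deriv (by ring)
    have h2 : HasDerivAt (fun t => c t / 2 / k)
        (-(Real.sin (γ t / 2) / k * Real.cos (γ t / 2))) t :=
      ((hasDerivAt_half_snd (hc t)).div_const k).congr_deriv (by ring)
    have h3 : HasDerivAt (fun t => Real.cos (γ t / 2))
        (-(h * (Real.sin (γ t / 2) / k) * (c t / 2 / k))) t :=
      (hasDerivAt_cos_half (hγ t)).congr_deriv (by rw [← hk2]; field_simp)
    have h4 : HasDerivAt (fun t => (α t + β t) / 2)
        (Real.cos (γ t / 2) + h * (Real.sin (γ t / 2) / k) * ((β t - α t) / (2 * k))) t :=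
      (((hα t).add (hβ t)).div_const 2).congr_deriv (by rw [← hk2]; field_simp; ring)
    have h5 : HasDerivAt (fun t => (β t - α t) / (2 * k))
        (Real.sin (γ t / 2) / k * ((α t + β t) / 2)) t :=
      (((hβ t).sub (hα t)).div_const (2 * k)).congr_deriv (by field_simp; ring)
    exact (hasDerivAt_const t h).prodMk (h1.prodMk (h2.prodMk (h3.prodMk (h4.prodMk h5))))

/-- The solution of the Jacobi system, for a positive parameter. -/
def jacobi (h : ℝ) : ℝ → ℝ × ℝ × ℝ × ℝ × ℝ × ℝ :=
  if hh : 0 < h then Classical.choose (exists_jacobi h hh) else 0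

theorem jacobi_zero {h : ℝ} (hh : 0 < h) : jacobi h 0 = (h, 0, 1, 1, 0, 0) := by
  rw [jacobi, dif_pos hh]
  exact (Classical.choose_spec (exists_jacobi h hh)).1

theorem hasDerivAt_jacobi {h : ℝ} (hh : 0 < h) (t : ℝ) :
    HasDerivAt (jacobi h) (jacobiField (jacobi h t)) t := by
  rw [jacobi, dif_pos hh]
  exact (Classical.choose_spec (exists_jacobi h hh)).2 t

theorem contDiffAt_jacobi {h : ℝ} (hh : 0 < h) (t : ℝ) :
    ContDiffAt ℝ ∞ (fun q : ℝ × ℝ => jacobi q.1 q.2) (h, t) := by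
  have hV : ContDiff ℝ ∞ jacobiField := by unfold jacobiField; fun_prop
  exact contDiffAt_solution hV (isOpen_Ioi (a := (0 : ℝ)))
    (ι := fun h => (h, 0, 1, 1, 0, 0)) (by fun_prop)
    (fun p hp => jacobi_zero hp) (fun p hp => hasDerivAt_jacobi hp) hh t

/-- Jacobi's sine amplitude. -/
def sn (h t : ℝ) : ℝ := (jacobi h t).2.1
/-- Jacobi's cosine amplitude. -/
def cn (h t : ℝ) : ℝ := (jacobi h t).2.2.1
/-- Jacobi's delta amplitude. -/
def dn (h t : ℝ) : ℝ := (jacobi h t).2.2.2.1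
/-- The function `(E dn - h sn cn) / (1 - h)`, where `E` is the integral of `dn ^ 2`. -/
def ef (h t : ℝ) : ℝ := (jacobi h t).2.2.2.2.1
/-- The function `(sn dn - E cn) / (1 - h)`, where `E` is the integral of `dn ^ 2`. -/
def eg (h t : ℝ) : ℝ := (jacobi h t).2.2.2.2.2

variable {h : ℝ}

theorem jacobi_fst (hh : 0 < h) (t : ℝ) : (jacobi h t).1 = h := by
  have hd : ∀ t, HasDerivAt (fun t => (jacobi h t).1) 0 t := fun t =>
    hasDerivAt_comp_fst (hasDerivAt_jacobi hh t)
  have := is_const_of_deriv_eq_zero (fun t => (hd t).differentiableAt) (fun t => (hd t).deriv) t 0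
  rw [this, jacobi_zero hh]

theorem hasDerivAt_sn (hh : 0 < h) (t : ℝ) : HasDerivAt (sn h) (cn h t * dn h t) t :=
  hasDerivAt_comp_fst (hasDerivAt_comp_snd (hasDerivAt_jacobi hh t))

theorem hasDerivAt_cn (hh : 0 < h) (t : ℝ) : HasDerivAt (cn h) (-(sn h t * dn h t)) t :=
  hasDerivAt_comp_fst (hasDerivAt_comp_snd (hasDerivAt_comp_snd (hasDerivAt_jacobi hh t)))

theorem hasDerivAt_dn (hh : 0 < h) (t : ℝ) : HasDerivAt (dn h) (-(h * sn h t * cn h t)) t := by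
  have := hasDerivAt_comp_fst (hasDerivAt_comp_snd (hasDerivAt_comp_snd
    (hasDerivAt_comp_snd (hasDerivAt_jacobi hh t))))
  simp only [jacobiField, jacobi_fst hh] at this
  exact this

theorem hasDerivAt_ef (hh : 0 < h) (t : ℝ) :
    HasDerivAt (ef h) (dn h t + h * sn h t * eg h t) t := by
  have := hasDerivAt_comp_fst (hasDerivAt_comp_snd (hasDerivAt_comp_snd
    (hasDerivAt_comp_snd (hasDerivAt_comp_snd (hasDerivAt_jacobi hh t)))))
  simp only [jacobiField, jacobi_fst hh] at this
  exact this

theorem hasDerivAt_eg (hh : 0 < h) (t : ℝ) : HasDerivAt (eg h) (sn h t * ef h t) t :=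
  hasDerivAt_comp_snd (hasDerivAt_comp_snd (hasDerivAt_comp_snd
    (hasDerivAt_comp_snd (hasDerivAt_comp_snd (hasDerivAt_jacobi hh t)))))

theorem sn_zero (hh : 0 < h) : sn h 0 = 0 := by simp [sn, jacobi_zero hh]
theorem cn_zero (hh : 0 < h) : cn h 0 = 1 := by simp [cn, jacobi_zero hh]
theorem dn_zero (hh : 0 < h) : dn h 0 = 1 := by simp [dn, jacobi_zero hh]
theorem ef_zero (hh : 0 < h) : ef h 0 = 0 := by simp [ef, jacobi_zero hh]
theorem eg_zero (hh : 0 < h) : eg h 0 = 0 := by simp [eg, jacobi_zero hh]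

theorem contDiffAt_sn (hh : 0 < h) (t : ℝ) :
    ContDiffAt ℝ ∞ (fun q : ℝ × ℝ => sn q.1 q.2) (h, t) := (contDiffAt_jacobi hh t).snd.fst
theorem contDiffAt_cn (hh : 0 < h) (t : ℝ) :
    ContDiffAt ℝ ∞ (fun q : ℝ × ℝ => cn q.1 q.2) (h, t) := (contDiffAt_jacobi hh t).snd.snd.fst
theorem contDiffAt_dn (hh : 0 < h) (t : ℝ) :
    ContDiffAt ℝ ∞ (fun q : ℝ × ℝ => dn q.1 q.2) (h, t) := (contDiffAt_jacobi hh t).snd.snd.snd.fst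
theorem contDiffAt_ef (hh : 0 < h) (t : ℝ) :
    ContDiffAt ℝ ∞ (fun q : ℝ × ℝ => ef q.1 q.2) (h, t) :=
  (contDiffAt_jacobi hh t).snd.snd.snd.snd.fst
theorem contDiffAt_eg (hh : 0 < h) (t : ℝ) :
    ContDiffAt ℝ ∞ (fun q : ℝ × ℝ => eg q.1 q.2) (h, t) :=
  (contDiffAt_jacobi hh t).snd.snd.snd.snd.snd

theorem eq_of_hasDerivAt_zero {F : ℝ → ℝ} (hF : ∀ t, HasDerivAt F 0 t) (t : ℝ) : F t = F 0 :=
  is_const_of_deriv_eq_zero (fun t => (hF t).differentiableAt) (fun t => (hF t).deriv) t 0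

theorem sn_sq_add_cn_sq (hh : 0 < h) (t : ℝ) : sn h t ^ 2 + cn h t ^ 2 = 1 := by
  have := eq_of_hasDerivAt_zero (F := fun t => sn h t ^ 2 + cn h t ^ 2) (fun t =>
    (((hasDerivAt_sn hh t).pow 2).add ((hasDerivAt_cn hh t).pow 2)).congr_deriv (by simp; ring)) t
  simpa [sn_zero hh, cn_zero hh] using this

theorem dn_sq_add_sn_sq (hh : 0 < h) (t : ℝ) : dn h t ^ 2 + h * sn h t ^ 2 = 1 := by
  have := eq_of_hasDerivAt_zero (F := fun t => dn h t ^ 2 + h * sn h t ^ 2) (fun t =>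
    (((hasDerivAt_dn hh t).pow 2).add (((hasDerivAt_sn hh t).pow 2).const_mul h)).congr_deriv
      (by simp; ring)) t
  simpa [sn_zero hh, dn_zero hh] using this

/-- A first integral of the system. It holds at `h = 1` as well and rules out common zeros of `cn`
and `dn`, since `sn` would vanish there too. -/
theorem ef_mul_cn_add_eg_mul_dn (hh : 0 < h) (t : ℝ) :
    ef h t * cn h t + eg h t * dn h t = sn h t := by
  have := eq_of_hasDerivAt_zero (F := fun t => ef h t * cn h t + eg h t * dn h t - sn h t)
    (fun t => ((((hasDerivAt_ef hh t).mul (hasDerivAt_cn hh t)).add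
      ((hasDerivAt_eg hh t).mul (hasDerivAt_dn hh t))).sub (hasDerivAt_sn hh t)).congr_deriv
      (by ring)) t
  simp only [ef_zero hh, eg_zero hh, sn_zero hh] at this
  linarith

/-- The incomplete elliptic integral of the second kind `∫ dn ^ 2`. -/
def ee (h t : ℝ) : ℝ := ef h t * dn h t + h * eg h t * cn h t

theorem ee_zero (hh : 0 < h) : ee h 0 = 0 := by simp [ee, ef_zero hh, eg_zero hh]

theorem hasDerivAt_ee (hh : 0 < h) (t : ℝ) : HasDerivAt (ee h) (dn h t ^ 2) t :=
  (((hasDerivAt_ef hh t).mul (hasDerivAt_dn hh t)).add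
    (((hasDerivAt_eg hh t).const_mul h).mul (hasDerivAt_cn hh t))).congr_deriv (by ring)

theorem one_sub_mul_ef (hh : 0 < h) (t : ℝ) :
    (1 - h) * ef h t = ee h t * dn h t - h * sn h t * cn h t := by
  rw [ee]
  linear_combination (-h * cn h t) * ef_mul_cn_add_eg_mul_dn hh t
    - ef h t * dn_sq_add_sn_sq hh t + h * ef h t * sn_sq_add_cn_sq hh t

theorem one_sub_mul_eg (hh : 0 < h) (t : ℝ) :
    (1 - h) * eg h t = sn h t * dn h t - ee h t * cn h t := by
  rw [ee]
  linear_combination dn h t * ef_mul_cn_add_eg_mul_dn hh t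
    - eg h t * dn_sq_add_sn_sq hh t + h * eg h t * sn_sq_add_cn_sq hh t

end SH2
end

noncomputable section

namespace SH2

/-! ### Derivatives with respect to the parameter -/

/-- Symmetry of second derivatives: parameter derivatives of a flow solve the linearised equation.
-/
theorem hasDerivAt_fderiv_param {y W : ℝ × ℝ → ℝ} {h t w : ℝ} (hY : ContDiffAt ℝ 2 y (h, t))
    (hW : ∀ᶠ q : ℝ × ℝ in 𝓝 (h, t), HasDerivAt (fun s => y (q.1, s)) (W q) q.2)
    (hw : HasDerivAt (fun h => W (h, t)) w h) :
    HasDerivAt (fun t => deriv (fun h => y (h, t)) h) w t := by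
  have hev : ∀ᶠ q in 𝓝 (h, t), HasFDerivAt y (fderiv ℝ y q) q := by
    filter_upwards [hY.eventually (by simp)] with q hq
    exact (hq.differentiableAt (by simp)).hasFDerivAt
  have h2 : HasFDerivAt (fderiv ℝ y) (fderiv ℝ (fderiv ℝ y) (h, t)) (h, t) :=
    ((hY.fderiv_right (m := 1) (by norm_num)).differentiableAt (by simp)).hasFDerivAt
  generalize fderiv ℝ (fderiv ℝ y) (h, t) = D2 at h2
  generalize fderiv ℝ y = D1 at hev h2
  have hsymm : D2 (1, 0) (0, 1) = D2 (0, 1) (1, 0) :=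
    second_derivative_symmetric_of_eventually_of_real hev h2 (1, 0) (0, 1)
  have hpath1 : ∀ a b : ℝ, HasDerivAt (fun s => (s, b)) ((1 : ℝ), (0 : ℝ)) a := fun a b =>
    (hasDerivAt_id a).prodMk (hasDerivAt_const a b)
  have hpath2 : ∀ a b : ℝ, HasDerivAt (fun s => (a, s)) ((0 : ℝ), (1 : ℝ)) b := fun a b =>
    (hasDerivAt_const b a).prodMk (hasDerivAt_id b)
  have e1 : (fun s => deriv (fun h => y (h, s)) h) =ᶠ[𝓝 t] fun s => D1 (h, s) (1, 0) := by
    have hc : Filter.Tendsto (fun s => (h, s)) (𝓝 t) (𝓝 (h, t)) :=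
      (hpath2 h t).continuousAt.tendsto
    filter_upwards [hc.eventually hev] with s hs
    exact (HasFDerivAt.comp_hasDerivAt (f := fun a => (a, s)) h hs (hpath1 h s)).deriv
  have e2 : (fun s => W (s, t)) =ᶠ[𝓝 h] fun s => D1 (s, t) (0, 1) := by
    have hc : Filter.Tendsto (fun s => (s, t)) (𝓝 h) (𝓝 (h, t)) :=
      (hpath1 h t).continuousAt.tendsto
    filter_upwards [hc.eventually hev, hc.eventually hW] with s hs hs'
    exact hs'.unique (HasFDerivAt.comp_hasDerivAt (f := fun a => (s, a)) t hs (hpath2 s t))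
  have d1 : HasDerivAt (fun s => D1 (h, s) (1, 0)) (D2 (0, 1) (1, 0)) t := by
    have := (HasFDerivAt.comp_hasDerivAt (f := fun s => (h, s)) t h2 (hpath2 h t)).clm_apply
      (hasDerivAt_const t ((1 : ℝ), (0 : ℝ)))
    simpa using! this
  have d2 : HasDerivAt (fun s => D1 (s, t) (0, 1)) (D2 (1, 0) (0, 1)) h := by
    have := (HasFDerivAt.comp_hasDerivAt (f := fun s => (s, t)) h h2 (hpath1 h t)).clm_apply
      (hasDerivAt_const h ((0 : ℝ), (1 : ℝ)))
    simpa using! this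
  rw [(hw.unique (d2.congr_of_eventuallyEq e2)).trans hsymm]
  exact d1.congr_of_eventuallyEq e1

theorem hasDerivAt_deriv_param {Y : ℝ → ℝ → ℝ} (W : ℝ → ℝ → ℝ) {h t w : ℝ}
    (hY : ContDiffAt ℝ ∞ (fun q : ℝ × ℝ => Y q.1 q.2) (h, t)) (hh : 0 < h)
    (hW : ∀ h, 0 < h → ∀ t, HasDerivAt (Y h) (W h t) t)
    (hw : HasDerivAt (fun h => W h t) w h) :
    HasDerivAt (fun t => deriv (fun h => Y h t) h) w t :=
  hasDerivAt_fderiv_param (y := fun q => Y q.1 q.2) (W := fun q => W q.1 q.2)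
    (hY.of_le (by norm_cast))
    ((continuousAt_fst.eventually (lt_mem_nhds hh)).mono fun q hq => hW q.1 hq q.2) hw

variable {h : ℝ}

theorem abs_sn_le_one (hh : 0 < h) (t : ℝ) : |sn h t| ≤ 1 := by
  rw [abs_le_one_iff_mul_self_le_one]
  nlinarith [sn_sq_add_cn_sq hh t, sq_nonneg (cn h t)]

theorem abs_cn_le_one (hh : 0 < h) (t : ℝ) : |cn h t| ≤ 1 := by
  rw [abs_le_one_iff_mul_self_le_one]
  nlinarith [sn_sq_add_cn_sq hh t, sq_nonneg (sn h t)]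

theorem abs_dn_le_one (hh : 0 < h) (t : ℝ) : |dn h t| ≤ 1 := by
  rw [abs_le_one_iff_mul_self_le_one]
  nlinarith [dn_sq_add_sn_sq hh t, mul_nonneg hh.le (sq_nonneg (sn h t))]

/-- The derivative of `sn` with respect to the parameter. -/
def snParam (h t : ℝ) : ℝ := deriv (fun h => sn h t) h
/-- The derivative of `cn` with respect to the parameter. -/
def cnParam (h t : ℝ) : ℝ := deriv (fun h => cn h t) h
/-- The derivative of `dn` with respect to the parameter. -/
def dnParam (h t : ℝ) : ℝ := deriv (fun h => dn h t) h
/-- The derivative of `ef` with respect to the parameter. -/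
def efParam (h t : ℝ) : ℝ := deriv (fun h => ef h t) h
/-- The derivative of `eg` with respect to the parameter. -/
def egParam (h t : ℝ) : ℝ := deriv (fun h => eg h t) h

theorem hasDerivAt_param_of_contDiffAt {Y : ℝ → ℝ → ℝ} {t : ℝ}
    (hY : ContDiffAt ℝ ∞ (fun q : ℝ × ℝ => Y q.1 q.2) (h, t)) :
    HasDerivAt (fun h => Y h t) (deriv (fun h => Y h t) h) h := by
  have h1 : ContDiffAt ℝ ∞ (fun s : ℝ => (s, t)) h := by fun_prop
  exact ((hY.comp h h1).differentiableAt (by simp)).hasDerivAt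

theorem deriv_param_zero {Y : ℝ → ℝ → ℝ} {a : ℝ} (hh : 0 < h) (hY : ∀ h, 0 < h → Y h 0 = a) :
    deriv (fun h => Y h 0) h = 0 := by
  have : (fun h => Y h 0) =ᶠ[𝓝 h] fun _ => a := by
    filter_upwards [lt_mem_nhds hh] with s hs using hY s hs
  rw [this.deriv_eq, deriv_const]

theorem hasDerivAt_snParam (hh : 0 < h) (t : ℝ) :
    HasDerivAt (snParam h) (cnParam h t * dn h t + cn h t * dnParam h t) t :=
  hasDerivAt_deriv_param (fun h t => cn h t * dn h t) (contDiffAt_sn hh t) hh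
    (fun _ => hasDerivAt_sn)
    ((hasDerivAt_param_of_contDiffAt (contDiffAt_cn hh t)).mul
      (hasDerivAt_param_of_contDiffAt (contDiffAt_dn hh t)))

theorem hasDerivAt_cnParam (hh : 0 < h) (t : ℝ) :
    HasDerivAt (cnParam h) (-(snParam h t * dn h t + sn h t * dnParam h t)) t :=
  hasDerivAt_deriv_param (fun h t => -(sn h t * dn h t)) (contDiffAt_cn hh t) hh
    (fun _ => hasDerivAt_cn)
    ((hasDerivAt_param_of_contDiffAt (contDiffAt_sn hh t)).mul
      (hasDerivAt_param_of_contDiffAt (contDiffAt_dn hh t))).neg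

theorem hasDerivAt_dnParam (hh : 0 < h) (t : ℝ) : HasDerivAt (dnParam h)
    (-((1 * sn h t + h * snParam h t) * cn h t + h * sn h t * cnParam h t)) t :=
  hasDerivAt_deriv_param (fun h t => -(h * sn h t * cn h t)) (contDiffAt_dn hh t) hh
    (fun _ => hasDerivAt_dn)
    ((((hasDerivAt_id h).mul (hasDerivAt_param_of_contDiffAt (contDiffAt_sn hh t))).mul
      (hasDerivAt_param_of_contDiffAt (contDiffAt_cn hh t))).neg)

theorem hasDerivAt_efParam (hh : 0 < h) (t : ℝ) : HasDerivAt (efParam h)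
    (dnParam h t + ((1 * sn h t + h * snParam h t) * eg h t + h * sn h t * egParam h t)) t :=
  hasDerivAt_deriv_param (fun h t => dn h t + h * sn h t * eg h t) (contDiffAt_ef hh t) hh
    (fun _ => hasDerivAt_ef)
    ((hasDerivAt_param_of_contDiffAt (contDiffAt_dn hh t)).add
      (((hasDerivAt_id h).mul (hasDerivAt_param_of_contDiffAt (contDiffAt_sn hh t))).mul
      (hasDerivAt_param_of_contDiffAt (contDiffAt_eg hh t))))

theorem hasDerivAt_egParam (hh : 0 < h) (t : ℝ) :
    HasDerivAt (egParam h) (snParam h t * ef h t + sn h t * efParam h t) t :=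
  hasDerivAt_deriv_param (fun h t => sn h t * ef h t) (contDiffAt_eg hh t) hh
    (fun _ => hasDerivAt_eg)
    ((hasDerivAt_param_of_contDiffAt (contDiffAt_sn hh t)).mul
      (hasDerivAt_param_of_contDiffAt (contDiffAt_ef hh t)))

/-- The differences of the two sides vanish at time `0` and solve a homogeneous linear system, whose
coefficients are bounded because `sn`, `cn` and `dn` are. Grönwall's inequality then kills them. -/
theorem param_formulas (hh : 0 < h) {t : ℝ} (ht : 0 ≤ t) :
    2 * h * snParam h t = cn h t * (t * dn h t - ef h t) ∧
    2 * h * cnParam h t = -(sn h t * (t * dn h t - ef h t)) ∧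
    2 * dnParam h t = -(sn h t * (eg h t + t * cn h t)) := by
  have hS := hasDerivAt_sn hh
  have hC := hasDerivAt_cn hh
  have hD := hasDerivAt_dn hh
  have hf := hasDerivAt_ef hh
  have hg := hasDerivAt_eg hh
  have da : ∀ s, HasDerivAt (fun s => 2 * h * snParam h s - cn h s * (s * dn h s - ef h s))
      ((2 * h * cnParam h s - -(sn h s * (s * dn h s - ef h s))) * dn h s +
        cn h s * h * (2 * dnParam h s - -(sn h s * (eg h s + s * cn h s)))) s := fun s => by
    refine (((hasDerivAt_snParam hh s).const_mul (2 * h)).sub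
      ((hC s).mul (((hasDerivAt_id s).mul (hD s)).sub (hf s)))).congr_deriv ?_
    simp only [Pi.mul_apply, Pi.sub_apply, id]
    ring
  have db : ∀ s, HasDerivAt (fun s => 2 * h * cnParam h s - -(sn h s * (s * dn h s - ef h s)))
      (-((2 * h * snParam h s - cn h s * (s * dn h s - ef h s)) * dn h s +
        sn h s * h * (2 * dnParam h s - -(sn h s * (eg h s + s * cn h s))))) s := fun s => by
    refine (((hasDerivAt_cnParam hh s).const_mul (2 * h)).sub
      (((hS s).mul (((hasDerivAt_id s).mul (hD s)).sub (hf s))).neg)).congr_deriv ?_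
    simp only [Pi.mul_apply, Pi.sub_apply, id]
    ring
  have dc : ∀ s, HasDerivAt (fun s => 2 * dnParam h s - -(sn h s * (eg h s + s * cn h s)))
      (-((2 * h * snParam h s - cn h s * (s * dn h s - ef h s)) * cn h s +
        sn h s * (2 * h * cnParam h s - -(sn h s * (s * dn h s - ef h s))))) s := fun s => by
    refine (((hasDerivAt_dnParam hh s).const_mul 2).sub
      (((hS s).mul ((hg s).add ((hasDerivAt_id s).mul (hC s)))).neg)).congr_deriv ?_
    simp only [Pi.mul_apply, Pi.add_apply, id]
    have h1 := ef_mul_cn_add_eg_mul_dn hh s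
    linear_combination cn h s * h1
  set a := fun s => 2 * h * snParam h s - cn h s * (s * dn h s - ef h s) with ha
  set b := fun s => 2 * h * cnParam h s - -(sn h s * (s * dn h s - ef h s)) with hb
  set c := fun s => 2 * dnParam h s - -(sn h s * (eg h s + s * cn h s)) with hc
  have hdiff : ∀ s, HasDerivAt (fun s => (a s, b s, c s)) _ s := fun s =>
    (da s).prodMk ((db s).prodMk (dc s))
  have hzero : (fun s => (a s, b s, c s)) 0 = 0 := by
    simp [ha, hb, hc, snParam, cnParam, dnParam, deriv_param_zero hh (fun h hh => sn_zero hh),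
      deriv_param_zero hh (fun h hh => cn_zero hh), deriv_param_zero hh (fun h hh => dn_zero hh),
      ef_zero hh, sn_zero hh]
  have key := eq_zero_of_abs_deriv_le_mul_abs_self_of_eq_zero_right (K := 2 + 2 * h) (b := t)
    (fun s _ => (hdiff s).continuousAt.continuousWithinAt)
    (fun s _ => (hdiff s).hasDerivWithinAt) hzero (fun s _ => ?_) t (right_mem_Icc.2 ht)
  · simp only [Prod.mk_eq_zero, ha, hb, hc, sub_eq_zero] at key
    exact key
  · have hn1 : |a s| ≤ ‖(a s, b s, c s)‖ := le_max_left _ _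
    have hn2 : |b s| ≤ ‖(a s, b s, c s)‖ := (le_max_left _ _).trans (le_max_right _ _)
    have hn3 : |c s| ≤ ‖(a s, b s, c s)‖ := (le_max_right _ _).trans (le_max_right _ _)
    set N := ‖(a s, b s, c s)‖
    have hs := abs_sn_le_one hh s
    have hcn := abs_cn_le_one hh s
    have hd := abs_dn_le_one hh s
    have hN : 0 ≤ N := norm_nonneg _
    have hm : ∀ x y : ℝ, |x| ≤ 1 → |y| ≤ N → |x * y| ≤ N := fun x y hx hy => by
      rw [abs_mul]
      nlinarith [abs_nonneg x, abs_nonneg y]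
    have m1 := hm _ _ hd hn2
    have m2 := hm _ _ hcn hn3
    have m3 := hm _ _ hd hn1
    have m4 := hm _ _ hs hn3
    have m5 := hm _ _ hcn hn1
    have m6 := hm _ _ hs hn2
    rw [abs_le] at m1 m2 m3 m4 m5 m6
    refine max_le ?_ (max_le ?_ ?_) <;> refine abs_le.2 ⟨?_, ?_⟩ <;> nlinarith

/-- As in `param_formulas`, the two defects satisfy `a' = h * sn * b` and `b' = sn * a`, starting
from zero. The factor `1 - h` makes the formulas uninformative at `h = 1`, a value later reached by
continuity. -/
theorem param_formulas' (hh : 0 < h) {t : ℝ} (ht : 0 ≤ t) :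
    2 * h * (1 - h) * efParam h t = h * ef h t - h * eg h t * cn h t * dn h t - t * dn h t
      - h * sn h t * eg h t * ee h t + (1 - h) * t * (dn h t + h * sn h t * eg h t) ∧
    2 * h * (1 - h) * egParam h t = h * eg h t - cn h t * dn h t * ef h t + t * cn h t
      - sn h t * ef h t * ee h t + (1 - h) * t * (sn h t * ef h t) := by
  have hS := hasDerivAt_sn hh
  have hC := hasDerivAt_cn hh
  have hD := hasDerivAt_dn hh
  have hf := hasDerivAt_ef hh
  have hg := hasDerivAt_eg hh
  have hE := hasDerivAt_ee hh
  set a := fun s => 2 * h * (1 - h) * efParam h s - (h * ef h s - h * eg h s * cn h s * dn h s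
      - s * dn h s - h * sn h s * eg h s * ee h s
      + (1 - h) * s * (dn h s + h * sn h s * eg h s)) with ha
  set b := fun s => 2 * h * (1 - h) * egParam h s - (h * eg h s - cn h s * dn h s * ef h s
      + s * cn h s - sn h s * ef h s * ee h s + (1 - h) * s * (sn h s * ef h s)) with hb
  have da : ∀ s, 0 ≤ s → HasDerivAt a (h * sn h s * b s) s := fun s hs => by
    refine (((hasDerivAt_efParam hh s).const_mul (2 * h * (1 - h))).sub
      (((((((hf s).const_mul h).sub ((((hg s).const_mul h).mul (hC s)).mul (hD s))).sub
        ((hasDerivAt_id s).mul (hD s))).sub ((((hS s).const_mul h).mul (hg s)).mul (hE s))).add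
        (((hasDerivAt_id s).const_mul (1 - h)).mul
          ((hD s).add (((hS s).const_mul h).mul (hg s))))))).congr_deriv ?_
    obtain ⟨p1, -, p3⟩ := param_formulas hh hs
    simp only [Pi.mul_apply, Pi.add_apply, id, hb]
    linear_combination h * (1 - h) * p3 + h * (1 - h) * eg h s * p1
      - h * cn h s * eg h s * one_sub_mul_ef hh s
  have db : ∀ s, 0 ≤ s → HasDerivAt b (sn h s * a s) s := fun s hs => by
    refine (((hasDerivAt_egParam hh s).const_mul (2 * h * (1 - h))).sub
      (((((((hg s).const_mul h).sub (((hC s).mul (hD s)).mul (hf s))).add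
        ((hasDerivAt_id s).mul (hC s))).sub (((hS s).mul (hf s)).mul (hE s))).add
        (((hasDerivAt_id s).const_mul (1 - h)).mul ((hS s).mul (hf s)))))).congr_deriv ?_
    obtain ⟨p1, -, p3⟩ := param_formulas hh hs
    simp only [Pi.mul_apply, id, ha]
    linear_combination (1 - h) * ef h s * p1
      - (cn h s * ef h s + sn h s) * one_sub_mul_ef hh s + cn h s * dn_sq_add_sn_sq hh s
  have hdiff : ∀ s, 0 ≤ s → HasDerivAt (fun s => (a s, b s)) (h * sn h s * b s, sn h s * a s) s :=
    fun s hs => (da s hs).prodMk (db s hs)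
  have hzero : (fun s => (a s, b s)) 0 = 0 := by
    simp [ha, hb, efParam, egParam, deriv_param_zero hh (fun h hh => ef_zero hh),
      deriv_param_zero hh (fun h hh => eg_zero hh), eg_zero hh, ef_zero hh, sn_zero hh]
  have key := eq_zero_of_abs_deriv_le_mul_abs_self_of_eq_zero_right (K := 1 + h) (b := t)
    (fun s hs => (hdiff s hs.1).continuousAt.continuousWithinAt)
    (fun s hs => (hdiff s hs.1).hasDerivWithinAt) hzero (fun s _ => ?_) t (right_mem_Icc.2 ht)
  · simp only [Prod.mk_eq_zero, ha, hb, sub_eq_zero] at key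
    exact key
  · have hn1 : |a s| ≤ ‖(a s, b s)‖ := le_max_left _ _
    have hn2 : |b s| ≤ ‖(a s, b s)‖ := le_max_right _ _
    set N := ‖(a s, b s)‖
    have hs := abs_sn_le_one hh s
    have hN : 0 ≤ N := norm_nonneg _
    have hm : ∀ y : ℝ, |y| ≤ N → |sn h s * y| ≤ N := fun y hy => by
      rw [abs_mul]
      nlinarith [abs_nonneg (sn h s), abs_nonneg y]
    have m1 := hm _ hn1
    have m2 := hm _ hn2
    rw [abs_le] at m1 m2
    refine max_le ?_ ?_ <;> refine abs_le.2 ⟨?_, ?_⟩ <;> nlinarith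

end SH2
end

noncomputable section

namespace SH2

variable {h t : ℝ}

/-! ### Signs of the elliptic functions before the first zero of `sn` -/

theorem pos_of_hasDerivAt_pos {F F' : ℝ → ℝ} (ht : 0 < t) (h0 : F 0 = 0)
    (hF : ∀ s ∈ Icc 0 t, HasDerivAt F (F' s) s) (hpos : ∀ s ∈ Ioo 0 t, 0 < F' s) : 0 < F t := by
  have := strictMonoOn_of_deriv_pos (convex_Icc 0 t)
    (fun s hs => (hF s hs).continuousAt.continuousWithinAt)
    (fun s hs => by
      rw [interior_Icc] at hs
      rw [(hF s (Ioo_subset_Icc_self hs)).deriv]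
      exact hpos s hs) (left_mem_Icc.2 ht.le) (right_mem_Icc.2 ht.le) ht
  rwa [h0] at this

theorem le_of_hasDerivAt_nonneg {F F' : ℝ → ℝ} {a b : ℝ} (hab : a ≤ b)
    (hc : ContinuousOn F (Icc a b)) (hF : ∀ s ∈ Ioo a b, HasDerivAt F (F' s) s)
    (hpos : ∀ s ∈ Ioo a b, 0 ≤ F' s) : F a ≤ F b :=
  monotoneOn_of_deriv_nonneg (convex_Icc a b) hc
    (fun s hs => by
      rw [interior_Icc] at hs
      exact (hF s hs).differentiableAt.differentiableWithinAt)
    (fun s hs => by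
      rw [interior_Icc] at hs
      rw [(hF s hs).deriv]
      exact hpos s hs) (left_mem_Icc.2 hab) (right_mem_Icc.2 hab) hab

theorem continuous_of_hasDerivAt {F F' : ℝ → ℝ} (hF : ∀ s, HasDerivAt F (F' s) s) : Continuous F :=
  continuous_iff_continuousAt.2 fun s => (hF s).continuousAt

theorem pos_of_continuous_of_ne_zero {F : ℝ → ℝ} (hF : Continuous F) (h0 : 0 < F 0)
    (hne : ∀ s, F s ≠ 0) (t : ℝ) : 0 < F t := by
  by_contra! hlt
  obtain ⟨s, hs⟩ := mem_range_of_exists_le_of_exists_ge hF ⟨t, hlt⟩ ⟨0, h0.le⟩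
  exact hne s hs

/-- For `h ≤ 1` a zero of `dn` would also be a zero of `cn`, which the first integral forbids. -/
theorem dn_pos_of_le_one (hh : 0 < h) (h1 : h ≤ 1) (t : ℝ) : 0 < dn h t := by
  refine pos_of_continuous_of_ne_zero (continuous_of_hasDerivAt (hasDerivAt_dn hh))
    (by simp [dn_zero hh]) (fun s hs => ?_) t
  have e1 := sn_sq_add_cn_sq hh s
  have e2 := dn_sq_add_sn_sq hh s
  have e3 := ef_mul_cn_add_eg_mul_dn hh s
  rw [hs] at e2 e3
  have hc : cn h s = 0 := by
    have : cn h s ^ 2 ≤ 0 := by nlinarith [sq_nonneg (sn h s)]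
    exact pow_eq_zero_iff two_ne_zero |>.1 (le_antisymm this (sq_nonneg _))
  rw [hc] at e3
  simp only [mul_zero, add_zero] at e3
  rw [← e3, hc] at e1
  norm_num at e1

theorem cn_pos_of_one_le (hh : 0 < h) (h1 : 1 ≤ h) (t : ℝ) : 0 < cn h t := by
  refine pos_of_continuous_of_ne_zero (continuous_of_hasDerivAt (hasDerivAt_cn hh))
    (by simp [cn_zero hh]) (fun s hs => ?_) t
  have e1 := sn_sq_add_cn_sq hh s
  have e2 := dn_sq_add_sn_sq hh s
  have e3 := ef_mul_cn_add_eg_mul_dn hh s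
  rw [hs] at e1 e3
  have hd : dn h s = 0 := by
    have : dn h s ^ 2 ≤ 0 := by nlinarith [sq_nonneg (sn h s)]
    exact pow_eq_zero_iff two_ne_zero |>.1 (le_antisymm this (sq_nonneg _))
  rw [hd] at e3
  simp only [mul_zero, add_zero] at e3
  rw [← e3] at e1
  norm_num at e1

/-- The times before the first positive zero of `sn h`. -/
structure BeforeZero (h t : ℝ) : Prop where
  param_pos : 0 < h
  time_pos : 0 < t
  sn_pos : ∀ s ∈ Ioc 0 t, 0 < sn h s

namespace BeforeZero

theorem mono (H : BeforeZero h t) {s : ℝ} (hs : s ∈ Ioc 0 t) : BeforeZero h s :=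
  ⟨H.1, hs.1, fun r hr => H.3 r ⟨hr.1, hr.2.trans hs.2⟩⟩

theorem sn_pos' (H : BeforeZero h t) : 0 < sn h t := H.3 t ⟨H.2, le_rfl⟩

theorem sn_nonneg (H : BeforeZero h t) {s : ℝ} (hs : s ∈ Icc 0 t) : 0 ≤ sn h s := by
  rcases hs.1.eq_or_lt with rfl | h0
  · exact (sn_zero H.1).ge
  · exact (H.3 s ⟨h0, hs.2⟩).le

/-- The quotient `ef / dn` has derivative `1 / dn ^ 2`. -/
theorem ef_pos_of_dn_pos (H : BeforeZero h t) (hd : ∀ s ∈ Icc 0 t, 0 < dn h s) : 0 < ef h t := by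
  have key := pos_of_hasDerivAt_pos (F := fun s => ef h s / dn h s) (F' := fun s => 1 / dn h s ^ 2)
    H.2 (by simp [ef_zero H.1]) (fun s hs => ?_)
    (fun s hs => by have := hd s (Ioo_subset_Icc_self hs); positivity)
  · exact (div_pos_iff_of_pos_right (hd t ⟨H.2.le, le_rfl⟩)).1 key
  · have hne := (hd s hs).ne'
    refine ((hasDerivAt_ef H.1 s).div (hasDerivAt_dn H.1 s) hne).congr_deriv ?_
    field_simp
    linear_combination dn_sq_add_sn_sq H.1 s + h * sn h s * ef_mul_cn_add_eg_mul_dn H.1 s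

theorem dn_antitone (H : BeforeZero h t) (h1 : 1 ≤ h) {s : ℝ} (hs : s ∈ Icc 0 t) :
    dn h t ≤ dn h s := by
  have := le_of_hasDerivAt_nonneg (F := fun s => -dn h s) hs.2
    (continuous_of_hasDerivAt (hasDerivAt_dn H.1)).neg.continuousOn
    (fun r _ => (hasDerivAt_dn H.1 r).neg) (fun r hr => by
      have h2 := H.3 r ⟨hs.1.trans_lt hr.1, hr.2.le⟩
      have h3 := cn_pos_of_one_le H.1 h1 r
      have h4 := H.1
      rw [neg_neg]
      positivity)
  linarith

theorem cn_antitone (H : BeforeZero h t) (h1 : h ≤ 1) {s r : ℝ} (hs : 0 ≤ s) (hsr : s ≤ r)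
    (hr : r ≤ t) : cn h r ≤ cn h s := by
  have := le_of_hasDerivAt_nonneg (F := fun s => -cn h s) hsr
    (continuous_of_hasDerivAt (hasDerivAt_cn H.1)).neg.continuousOn
    (fun r _ => (hasDerivAt_cn H.1 r).neg) (fun q hq => by
      have h2 := H.3 q ⟨hs.trans_lt hq.1, hq.2.le.trans hr⟩
      have h3 := dn_pos_of_le_one H.1 h1 q
      rw [neg_neg]
      positivity)
  linarith

/-- For `h ≤ 1`, `dn` stays positive, so `ef` is positive, and then so is `eg' = sn * ef`. For `h ≥
1` the roles change: `eg / cn` increases. There `ef` follows from the first integral if `dn h t ≤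
0`, and otherwise `dn` is positive up to time `t`. -/
theorem ef_eg_pos (H : BeforeZero h t) : 0 < ef h t ∧ 0 < eg h t := by
  rcases le_total h 1 with h1 | h1
  · have hd := dn_pos_of_le_one H.1 h1
    refine ⟨H.ef_pos_of_dn_pos fun s _ => hd s, ?_⟩
    refine pos_of_hasDerivAt_pos H.2 (eg_zero H.1) (fun s _ => hasDerivAt_eg H.1 s) fun s hs => ?_
    have Hs := H.mono (Ioo_subset_Ioc_self hs)
    exact mul_pos Hs.sn_pos' (Hs.ef_pos_of_dn_pos fun s _ => hd s)
  · have hc := cn_pos_of_one_le H.1 h1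
    have hg : 0 < eg h t := by
      have key := pos_of_hasDerivAt_pos (F := fun s => eg h s / cn h s)
        (F' := fun s => sn h s ^ 2 / cn h s ^ 2) H.2 (by simp [eg_zero H.1]) (fun s hs => ?_)
        (fun s hs => by
          have := hc s
          have := H.3 s (Ioo_subset_Ioc_self hs)
          positivity)
      · exact (div_pos_iff_of_pos_right (hc t)).1 key
      · have hne := (hc s).ne'
        refine ((hasDerivAt_eg H.1 s).div (hasDerivAt_cn H.1 s) hne).congr_deriv ?_
        field_simp
        linear_combination sn h s * ef_mul_cn_add_eg_mul_dn H.1 s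
    refine ⟨?_, hg⟩
    rcases le_or_gt (dn h t) 0 with hd | hd
    · have e := ef_mul_cn_add_eg_mul_dn H.1 t
      have := H.sn_pos'
      have : 0 < ef h t * cn h t := by nlinarith
      exact (mul_pos_iff_of_pos_right (hc t)).1 this
    · exact H.ef_pos_of_dn_pos fun s hs => hd.trans_le (H.dn_antitone h1 hs)

theorem ef_pos (H : BeforeZero h t) : 0 < ef h t := H.ef_eg_pos.1
theorem eg_pos (H : BeforeZero h t) : 0 < eg h t := H.ef_eg_pos.2

/-- While `dn` is positive, `ef / dn - s` has derivative `h * sn ^ 2 / dn ^ 2`. This is the factor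
deciding the sign of `jacobian h t 1`. -/
theorem ef_sub_mul_dn_pos (H : BeforeZero h t) (h1 : 1 ≤ h) : 0 < ef h t - t * dn h t := by
  rcases le_or_gt (dn h t) 0 with hd | hd
  · nlinarith [H.ef_pos, H.2]
  · have hd' : ∀ s ∈ Icc 0 t, 0 < dn h s := fun s hs => hd.trans_le (H.dn_antitone h1 hs)
    have key := pos_of_hasDerivAt_pos (F := fun s => ef h s / dn h s - s)
      (F' := fun s => h * sn h s ^ 2 / dn h s ^ 2) H.2 (by simp [ef_zero H.1]) (fun s hs => ?_)
      (fun s hs => by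
        have := hd' s (Ioo_subset_Icc_self hs)
        have := H.3 s (Ioo_subset_Ioc_self hs)
        have := H.1
        positivity)
    · rw [sub_pos, lt_div_iff₀ hd] at key
      linarith
    · have hne := (hd' s hs).ne'
      refine (((hasDerivAt_ef H.1 s).div (hasDerivAt_dn H.1 s) hne).sub
        (hasDerivAt_id s)).congr_deriv ?_
      field_simp
      linear_combination h * sn h s * ef_mul_cn_add_eg_mul_dn H.1 s

theorem one_sub_mul_le_ee (H : BeforeZero h t) : (1 - h) * t ≤ ee h t := by
  have := le_of_hasDerivAt_nonneg (F := fun s => ee h s - (1 - h) * s) H.2.le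
    ((continuous_of_hasDerivAt (hasDerivAt_ee H.1)).sub (by fun_prop)).continuousOn
    (fun s _ => (hasDerivAt_ee H.1 s).sub ((hasDerivAt_id s).const_mul (1 - h)))
    (fun s _ => by
      have e1 := sn_sq_add_cn_sq H.1 s
      have e2 := dn_sq_add_sn_sq H.1 s
      have : dn h s ^ 2 - (1 - h) * 1 = h * cn h s ^ 2 := by linear_combination e2 - h * e1
      rw [this]
      exact mul_nonneg H.1.le (sq_nonneg _))
  simp only [ee_zero H.1] at this
  linarith

theorem ee_mono (H : BeforeZero h t) {s : ℝ} (hs : s ≤ t) : ee h s ≤ ee h t :=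
  le_of_hasDerivAt_nonneg hs (continuous_of_hasDerivAt (hasDerivAt_ee H.1)).continuousOn
    (fun r _ => hasDerivAt_ee H.1 r) fun _ _ => sq_nonneg _

theorem ee_pos (H : BeforeZero h t) : 0 < ee h t := by
  have hc := (continuous_of_hasDerivAt (hasDerivAt_dn H.1)).tendsto 0
  rw [dn_zero H.1] at hc
  obtain ⟨δ, hδ, hd⟩ := Metric.eventually_nhds_iff.1 (hc.eventually (lt_mem_nhds one_pos))
  set s := min (δ / 2) t
  have hs0 : 0 < s := lt_min (by positivity) H.2
  refine lt_of_lt_of_le ?_ (H.ee_mono (min_le_right (δ / 2) t))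
  refine pos_of_hasDerivAt_pos hs0 (ee_zero H.1) (fun r _ => hasDerivAt_ee H.1 r) fun r hr => ?_
  have : r < δ := hr.2.trans ((min_le_left _ _).trans_lt (by linarith))
  have := hd (y := r) (by rwa [Real.dist_eq, sub_zero, abs_of_pos hr.1])
  positivity

/-- When `cn` is negative, `(1 - h) * (eg + t * cn)` equals `sn * dn - cn * (ee - (1 - h) * t)`, a
positive term plus a nonnegative one. -/
theorem eg_add_mul_cn_pos (H : BeforeZero h t) (h1 : h < 1) : 0 < eg h t + t * cn h t := by
  rcases le_or_gt 0 (cn h t) with hc | hc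
  · have := H.eg_pos
    have := H.2
    positivity
  · have e := one_sub_mul_eg H.1 t
    have hE := H.one_sub_mul_le_ee
    have hS := H.sn_pos'
    have hD := dn_pos_of_le_one H.1 h1.le t
    have : 0 < (1 - h) * (eg h t + t * cn h t) := by nlinarith [mul_pos hS hD]
    exact (mul_pos_iff_of_pos_left (by linarith)).1 this

theorem tendsto_div_nhdsGT {a b : ℝ → ℝ} {α β : ℝ} (ha : HasDerivAt a α 0) (hb : HasDerivAt b β 0)
    (ha0 : a 0 = 0) (hb0 : b 0 = 0) (hβ : β ≠ 0) :
    Filter.Tendsto (fun s => a s / b s) (𝓝[≠] 0) (𝓝 (α / β)) := by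
  have h1 := (hasDerivAt_iff_tendsto_slope.1 ha).div (hasDerivAt_iff_tendsto_slope.1 hb) hβ
  refine h1.congr' ?_
  filter_upwards [self_mem_nhdsWithin] with s hs
  have hs' : s ≠ 0 := hs
  simp only [slope_def_field, ha0, hb0, sub_zero, Pi.div_apply]
  field_simp

/-- The value `0 / 0 = 0` of the quotient at the origin agrees with its limit because the numerator
has zero derivative. -/
theorem continuousAt_div_zero {a b : ℝ → ℝ} {β : ℝ} (ha : HasDerivAt a 0 0) (hb : HasDerivAt b β 0)
    (ha0 : a 0 = 0) (hb0 : b 0 = 0) (hβ : β ≠ 0) : ContinuousAt (fun s => a s / b s) 0 := by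
  rw [continuousAt_iff_punctured_nhds]
  simpa [ha0] using tendsto_div_nhdsGT ha hb ha0 hb0 hβ

/-- Divided by `ee`, the expression starts from `0` and has derivative `h * (cn - sn * dn / ee) ^
2`. It controls the sign of `jacobianQuad`. -/
theorem ee_sq_sub_nonneg (H : BeforeZero h t) :
    0 ≤ ee h t ^ 2 - h * sn h t ^ 2 - (1 - h) * t * ee h t := by
  have hpos : ∀ s ∈ Ioc 0 t, 0 < ee h s := fun s hs => (H.mono hs).ee_pos
  have hd : ∀ s ∈ Ioc 0 t, HasDerivAt (fun s => ee h s - (1 - h) * s - h * (sn h s ^ 2 / ee h s))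
      (h * (cn h s - sn h s * dn h s / ee h s) ^ 2) s := fun s hs => by
    have hne := (hpos s hs).ne'
    refine (((hasDerivAt_ee H.1 s).sub ((hasDerivAt_id s).const_mul (1 - h))).sub
      ((((hasDerivAt_sn H.1 s).pow 2).div (hasDerivAt_ee H.1 s) hne).const_mul h)).congr_deriv ?_
    have e1 := sn_sq_add_cn_sq H.1 s
    have e2 := dn_sq_add_sn_sq H.1 s
    simp only [Pi.pow_apply]
    field_simp
    push_cast
    linear_combination (ee h s ^ 2) * e2 - (h * ee h s ^ 2) * e1
  have key := le_of_hasDerivAt_nonneg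
    (F := fun s => ee h s - (1 - h) * s - h * (sn h s ^ 2 / ee h s)) H.2.le
    (fun s hs => ?_) (fun s hs => hd s (Ioo_subset_Ioc_self hs))
    (fun s _ => mul_nonneg H.1.le (sq_nonneg _))
  · have hE := H.ee_pos
    simp only [ee_zero H.1, sn_zero H.1] at key
    have h2 : 0 ≤ (ee h t - (1 - h) * t - h * (sn h t ^ 2 / ee h t)) * ee h t :=
      mul_nonneg (by simpa using key) hE.le
    have h3 : (ee h t - (1 - h) * t - h * (sn h t ^ 2 / ee h t)) * ee h t =
        ee h t ^ 2 - h * sn h t ^ 2 - (1 - h) * t * ee h t := by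
      field_simp
      ring
    rwa [h3] at h2
  · rcases hs.1.eq_or_lt with rfl | h0
    · refine ContinuousAt.continuousWithinAt ?_
      refine (((continuous_of_hasDerivAt (hasDerivAt_ee H.1)).continuousAt.sub
        (by fun_prop)).sub (continuousAt_const.mul ?_))
      refine continuousAt_div_zero (a := fun s => sn h s ^ 2) (β := 1)
        (((hasDerivAt_sn H.1 0).pow 2).congr_deriv (by simp [sn_zero H.1]))
        ((hasDerivAt_ee H.1 0).congr_deriv (by simp [dn_zero H.1])) (by simp [sn_zero H.1])
        (ee_zero H.1) one_ne_zero
    · exact (hd s ⟨h0, hs.2⟩).continuousAt.continuousWithinAt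

end BeforeZero
end SH2
end

/-! ### The sign of the Jacobian polynomial at `x = 0`, openness, and its closed forms. -/

noncomputable section

namespace SH2

variable {h t : ℝ}

/-- The function `sn E + cn dn`. -/
def ez (h t : ℝ) : ℝ := sn h t * ee h t + cn h t * dn h t

theorem ez_zero (hh : 0 < h) : ez h 0 = 1 := by simp [ez, sn_zero hh, cn_zero hh, dn_zero hh]

theorem hasDerivAt_ez (hh : 0 < h) (t : ℝ) :
    HasDerivAt (ez h) ((1 - h) * (cn h t * ef h t)) t := by
  refine (((hasDerivAt_sn hh t).mul (hasDerivAt_ee hh t)).add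
    ((hasDerivAt_cn hh t).mul (hasDerivAt_dn hh t))).congr_deriv ?_
  linear_combination (-cn h t) * one_sub_mul_ef hh t

namespace BeforeZero

/-- The derivative of `ez` has the sign of `(1 - h) * cn`. For `h ≤ 1`, where `cn` decreases, `ez`
first rises from `1` and then falls; for `h ≥ 1` it only falls. Positivity at the end therefore
gives positivity throughout. -/
theorem ez_pos_of_le (H : BeforeZero h t) (hZ : 0 < ez h t) {s : ℝ} (hs : s ∈ Icc 0 t) :
    0 < ez h s := by
  have hc := continuous_of_hasDerivAt (hasDerivAt_ez H.1)
  have hf : ∀ r ∈ Ioc 0 t, 0 < ef h r := fun r hr => (H.mono hr).ef_pos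
  rcases le_total h 1 with h1 | h1
  · rcases le_or_gt 0 (cn h s) with hcs | hcs
    · have := le_of_hasDerivAt_nonneg hs.1 hc.continuousOn (fun r _ => hasDerivAt_ez H.1 r)
        fun r hr => mul_nonneg (sub_nonneg.2 h1) (mul_nonneg
          (hcs.trans (H.cn_antitone h1 hr.1.le hr.2.le hs.2)) (hf r ⟨hr.1, hr.2.le.trans hs.2⟩).le)
      rw [ez_zero H.1] at this
      linarith
    · have := le_of_hasDerivAt_nonneg (F := fun s => -ez h s) hs.2 hc.neg.continuousOn
        (fun r _ => (hasDerivAt_ez H.1 r).neg)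
        fun r hr => by
          have e1 := H.cn_antitone h1 hs.1 hr.1.le hr.2.le
          have e2 := hf r ⟨hs.1.trans_lt hr.1, hr.2.le⟩
          have e3 : cn h r * ef h r ≤ 0 := mul_nonpos_of_nonpos_of_nonneg (e1.trans hcs.le) e2.le
          nlinarith [sub_nonneg.2 h1]
      linarith
  · have := le_of_hasDerivAt_nonneg (F := fun s => -ez h s) hs.2 hc.neg.continuousOn
        (fun r _ => (hasDerivAt_ez H.1 r).neg)
        fun r hr => by
          have e1 := cn_pos_of_one_le H.1 h1 r
          have e2 := hf r ⟨hs.1.trans_lt hr.1, hr.2.le⟩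
          nlinarith [mul_pos e1 e2]
    linarith

theorem neg_one_add_le_ez (H : BeforeZero h t) : sn h t * ee h t ≤ 1 + ez h t := by
  have e1 := abs_le.1 (abs_cn_le_one H.1 t)
  have e2 := abs_le.1 (abs_dn_le_one H.1 t)
  have : -1 ≤ cn h t * dn h t := by nlinarith
  rw [ez]
  linarith

/-- If `Z = ez h t` is at most `0`, the expression equals `(1 + Z) - Z * ((1 + Z) - (1 - h) * t *
sn)`, with nonnegative terms. If `Z > 0`, it is divided by `sn * ez`: the quotient starts from `0`
and has derivative `((1 - h) * ef / ez) ^ 2`. -/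
theorem one_sub_ez_sq_nonneg (H : BeforeZero h t) :
    0 ≤ 1 - ez h t ^ 2 + (1 - h) * t * (sn h t * ez h t) := by
  have hS := H.sn_pos'
  have hE := H.ee_pos
  rcases le_or_gt (ez h t) 0 with hZ | hZ
  · have e1 := H.neg_one_add_le_ez
    have e2 := H.one_sub_mul_le_ee
    have e3 : sn h t * ((1 - h) * t) ≤ 1 + ez h t :=
      (mul_le_mul_of_nonneg_left e2 hS.le).trans e1
    have e4 : 0 ≤ 1 + ez h t := (mul_pos hS hE).le.trans e1
    nlinarith [mul_nonneg (neg_nonneg.2 hZ) (sub_nonneg.2 e3)]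
  · have hZs : ∀ s ∈ Icc 0 t, 0 < ez h s := fun s hs => H.ez_pos_of_le hZ hs
    have hd : ∀ s ∈ Ioc 0 t, HasDerivAt
        (fun s => (1 - ez h s ^ 2) / (sn h s * ez h s) + (1 - h) * s)
        (((1 - h) * ef h s / ez h s) ^ 2) s := fun s hs => by
      have hz := (hZs s (Ioc_subset_Icc_self hs)).ne'
      have hn := (H.3 s hs).ne'
      refine (((((hasDerivAt_ez H.1 s).pow 2).const_sub 1).div
        ((hasDerivAt_sn H.1 s).mul (hasDerivAt_ez H.1 s)) (mul_ne_zero hn hz)).add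
        ((hasDerivAt_id s).const_mul (1 - h))).congr_deriv ?_
      have e1 := sn_sq_add_cn_sq H.1 s
      have e2 := dn_sq_add_sn_sq H.1 s
      have e3 := one_sub_mul_ef H.1 s
      have e4 : ez h s = sn h s * ee h s + cn h s * dn h s := rfl
      have e5 : sn h s * ((1 - h) * ef h s) = ez h s * dn h s - cn h s := by
        linear_combination sn h s * e3 - dn h s * e4 - cn h s * e2
      simp only [Pi.pow_apply, Pi.mul_apply]
      have e6 : ((1 - h) * ef h s / ez h s) ^ 2 =
          (sn h s * ((1 - h) * ef h s)) ^ 2 / (sn h s * ez h s) ^ 2 := by field_simp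
      rw [e6, div_add' _ _ _ (pow_ne_zero 2 (mul_ne_zero hn hz))]
      congr 1
      push_cast
      linear_combination (-(1 + ez h s ^ 2) * cn h s -
        (sn h s * ((1 - h) * ef h s) + ez h s * dn h s - cn h s)) * e5 +
        ez h s ^ 2 * e1 - ez h s ^ 2 * e2
    have key := le_of_hasDerivAt_nonneg
      (F := fun s => (1 - ez h s ^ 2) / (sn h s * ez h s) + (1 - h) * s) H.2.le
      (fun s hs => ?_) (fun s hs => hd s (Ioo_subset_Ioc_self hs)) (fun s _ => sq_nonneg _)
    · have h2 := mul_nonneg (by simpa [sn_zero H.1] using key) (mul_pos hS hZ).le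
      have h3 : ((1 - ez h t ^ 2) / (sn h t * ez h t) + (1 - h) * t) * (sn h t * ez h t) =
          1 - ez h t ^ 2 + (1 - h) * t * (sn h t * ez h t) := by
        field_simp
      rwa [h3] at h2
    · rcases hs.1.eq_or_lt with rfl | h0
      · refine ContinuousAt.continuousWithinAt (ContinuousAt.add ?_ (by fun_prop))
        refine continuousAt_div_zero (a := fun s => 1 - ez h s ^ 2)
          (b := fun s => sn h s * ez h s) (β := 1)
          ((((hasDerivAt_ez H.1 0).pow 2).const_sub 1).congr_deriv (by simp [ef_zero H.1]))
          (((hasDerivAt_sn H.1 0).mul (hasDerivAt_ez H.1 0)).congr_deriv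
            (by simp [ez_zero H.1, sn_zero H.1, cn_zero H.1, dn_zero H.1]))
          (by simp [ez_zero H.1]) (by simp [sn_zero H.1]) one_ne_zero
      · exact (hd s ⟨h0, hs.2⟩).continuousAt.continuousWithinAt

/-! ### Openness -/

/-- Positivity of `sn` degenerates at time `0`; there the positive derivative `cn * dn` replaces it,
uniformly in nearby parameters. -/
theorem eventually_sn_pos_near_zero (hh : 0 < h) :
    ∀ᶠ q : ℝ × ℝ in 𝓝 (h, 0), 0 < q.2 → 0 < sn q.1 q.2 := by
  have h1 : ContinuousAt (fun q : ℝ × ℝ => cn q.1 q.2) (h, 0) := (contDiffAt_cn hh 0).continuousAt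
  have h2 : ContinuousAt (fun q : ℝ × ℝ => dn q.1 q.2) (h, 0) := (contDiffAt_dn hh 0).continuousAt
  have e1 : ∀ᶠ q : ℝ × ℝ in 𝓝 (h, 0), 0 < cn q.1 q.2 :=
    h1.eventually (lt_mem_nhds (by simp [cn_zero hh]))
  have e2 : ∀ᶠ q : ℝ × ℝ in 𝓝 (h, 0), 0 < dn q.1 q.2 :=
    h2.eventually (lt_mem_nhds (by simp [dn_zero hh]))
  have e3 : ∀ᶠ q : ℝ × ℝ in 𝓝 (h, 0), 0 < q.1 := continuousAt_fst.eventually (lt_mem_nhds hh)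
  obtain ⟨δ, hδ, H⟩ := Metric.eventually_nhds_iff.1 (e1.and (e2.and e3))
  refine Metric.eventually_nhds_iff.2 ⟨δ, hδ, fun q hq hpos => ?_⟩
  have hq0 := H hq
  rw [Prod.dist_eq, max_lt_iff] at hq
  refine pos_of_hasDerivAt_pos hpos (sn_zero hq0.2.2) (fun s _ => hasDerivAt_sn hq0.2.2 s)
    fun s hs => ?_
  have : dist (q.1, s) (h, 0) < δ := by
    rw [Prod.dist_eq, max_lt_iff]
    refine ⟨hq.1, ?_⟩
    have := hq.2
    rw [Real.dist_eq, sub_zero, abs_of_pos hpos] at this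
    rw [Real.dist_eq, sub_zero, abs_of_pos hs.1]
    exact hs.2.trans this
  exact mul_pos (H this).1 (H this).2.1

/-- The times are written as `r * t` with `r` in the compact interval `[0, 1]`, which turns
pointwise persistence of positivity into uniform persistence. -/
theorem eventually (H : BeforeZero h t) : ∀ᶠ q : ℝ × ℝ in 𝓝 (h, t), BeforeZero q.1 q.2 := by
  have hloc : ∀ r ∈ Icc (0 : ℝ) 1, ∀ᶠ z : (ℝ × ℝ) × ℝ in 𝓝 ((h, t), r),
      0 < z.2 * z.1.2 → 0 < sn z.1.1 (z.2 * z.1.2) := by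
    intro r hr
    have hc : ContinuousAt (fun z : (ℝ × ℝ) × ℝ => (z.1.1, z.2 * z.1.2)) ((h, t), r) := by fun_prop
    rcases hr.1.eq_or_lt with rfl | h0
    · have : ∀ᶠ q : ℝ × ℝ in 𝓝 (h, 0 * t), 0 < q.2 → 0 < sn q.1 q.2 := by
        rw [zero_mul]
        exact eventually_sn_pos_near_zero H.1
      exact hc.eventually this
    · have hpos : 0 < sn h (r * t) := H.3 _ ⟨mul_pos h0 H.2, mul_le_of_le_one_left H.2.le hr.2⟩
      have : ∀ᶠ q : ℝ × ℝ in 𝓝 (h, r * t), 0 < sn q.1 q.2 :=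
        (contDiffAt_sn H.1 (r * t)).continuousAt.eventually (lt_mem_nhds hpos)
      exact (hc.eventually this).mono fun z hz _ => hz
  have hall := isCompact_Icc.eventually_forall_of_forall_eventually
    (P := fun (q : ℝ × ℝ) (r : ℝ) => 0 < r * q.2 → 0 < sn q.1 (r * q.2)) hloc
  have e3 : ∀ᶠ q : ℝ × ℝ in 𝓝 (h, t), 0 < q.1 := continuousAt_fst.eventually (lt_mem_nhds H.1)
  have e4 : ∀ᶠ q : ℝ × ℝ in 𝓝 (h, t), 0 < q.2 := continuousAt_snd.eventually (lt_mem_nhds H.2)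
  filter_upwards [hall, e3, e4] with q hq h1 h2
  refine ⟨h1, h2, fun s hs => ?_⟩
  have := hq (s / q.2) ⟨div_nonneg hs.1.le h2.le, (div_le_one h2).2 hs.2⟩
  rw [div_mul_cancel₀ _ h2.ne'] at this
  exact this hs.1

end BeforeZero

/-! ### The Jacobian -/

/-- Minus the Jacobian of `(θ, p, t) ↦ (cos θ * ef, p * eg, sin θ * sn)` as a function of
`x = sin θ ^ 2`. -/
def jacobian (h t x : ℝ) : ℝ :=
  eg h t * (x * ef h t * (cn h t * dn h t) + (1 - x) * sn h t * (dn h t + h * sn h t * eg h t)) +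
  2 * (h - x) *
    (x * ef h t * (egParam h t * (cn h t * dn h t) - snParam h t * (sn h t * ef h t)) -
     (1 - x) * sn h t * (efParam h t * (sn h t * ef h t) -
        egParam h t * (dn h t + h * sn h t * eg h t))) -
  2 * x * (1 - x) * eg h t *
    (efParam h t * (cn h t * dn h t) - snParam h t * (dn h t + h * sn h t * eg h t))

/-- The coefficient of `x ^ 2` in `jacobian h t x`. -/
def jacobianQuad (h t : ℝ) : ℝ :=
  2 * eg h t *
    (efParam h t * (cn h t * dn h t) - snParam h t * (dn h t + h * sn h t * eg h t)) -
  2 * (ef h t * (egParam h t * (cn h t * dn h t) - snParam h t * (sn h t * ef h t)) +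
     sn h t * (efParam h t * (sn h t * ef h t) -
        egParam h t * (dn h t + h * sn h t * eg h t)))

/-- Quadratic interpolation at `0` and `m`: once `jacobianQuad` is nonpositive, the signs at two
nodes decide the sign in between. -/
theorem jacobian_interpolate (h t x m : ℝ) : m * jacobian h t x =
    (m - x) * jacobian h t 0 + x * jacobian h t m - jacobianQuad h t * (x * (m - x)) * m := by
  simp only [jacobian, jacobianQuad]
  ring

theorem jacobianQuad_mul (h t : ℝ) : h * (1 - h) * jacobianQuad h t =
    (1 - h) * jacobian h t 0 + h * jacobian h t 1 - jacobian h t h := by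
  simp only [jacobian, jacobianQuad]
  ring

/-- At the three nodes `x = 0`, `h`, `1`, where `sin θ`, `p` or `cos θ` vanishes, parts of the
determinant drop out. The parameter formulas then give closed forms. -/
theorem jacobian_one (hh : 0 < h) (ht : 0 ≤ t) :
    h * jacobian h t 1 = ef h t * cn h t ^ 2 * (ef h t - t * dn h t) := by
  obtain ⟨pS, -, -⟩ := param_formulas hh ht
  obtain ⟨pf, pg⟩ := param_formulas' hh ht
  have h3 := dn_sq_add_sn_sq hh t
  have h4 := one_sub_mul_ef hh t
  simp only [jacobian]
  linear_combination (-ef h t * cn h t * dn h t) * pg + (1 - h) * ef h t ^ 2 * sn h t * pS +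
    ef h t ^ 2 * cn h t * (-sn h t * h4 + cn h t * h3)

theorem jacobian_self (hh : 0 < h) (ht : 0 ≤ t) :
    jacobian h t h = eg h t * dn h t ^ 2 * (eg h t + t * cn h t) := by
  obtain ⟨pS, -, -⟩ := param_formulas hh ht
  obtain ⟨pf, pg⟩ := param_formulas' hh ht
  have h1 := ef_mul_cn_add_eg_mul_dn hh t
  have h2 := sn_sq_add_cn_sq hh t
  have h5 := one_sub_mul_eg hh t
  simp only [jacobian]
  linear_combination eg h t * (-cn h t * dn h t * pf +
    (1 - h) * (dn h t + h * sn h t * eg h t) * pS -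
    (1 - h) * (dn h t + h * sn h t * eg h t) * h1 +
    h * dn h t * eg h t * (sn h t * h5 + dn h t * h2))

/-- The numerator is the one controlled by `one_sub_ez_sq_nonneg`. -/
theorem jacobian_zero (hh : 0 < h) (h1 : h ≠ 1) (ht : 0 ≤ t) :
    (1 - h) ^ 2 * jacobian h t 0 =
      1 - ez h t ^ 2 + (1 - h) * t * (sn h t * ez h t) := by
  obtain ⟨pf, pg⟩ := param_formulas' hh ht
  have h2 := sn_sq_add_cn_sq hh t
  have h3 := dn_sq_add_sn_sq hh t
  have h4 := one_sub_mul_ef hh t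
  have h5 := one_sub_mul_eg hh t
  have hne : 1 - h ≠ 0 := sub_ne_zero.2 h1.symm
  have hE : ee h t = ef h t * dn h t + h * eg h t * cn h t := rfl
  have key : (1 - h) * jacobian h t 0 = sn h t * (eg h t * dn h t +
      h * sn h t * eg h t ^ 2 - h * sn h t * ef h t ^ 2 - ef h t * dn h t * ez h t) +
      t * (sn h t * ez h t) := by
    simp only [jacobian, ez]
    linear_combination (-sn h t ^ 2 * ef h t) * pf +
      sn h t * (dn h t + h * sn h t * eg h t) * pg - t * sn h t ^ 2 * hE
  -- After `key` has removed the parameter derivatives, the remaining `ef` and `eg` are eliminated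
  -- in favour of `ee`, at the cost of another factor `1 - h`.
  have key2 : (1 - h) * (sn h t * (eg h t * dn h t + h * sn h t * eg h t ^ 2 -
      h * sn h t * ef h t ^ 2 - ef h t * dn h t * ez h t)) = 1 - ez h t ^ 2 := by
    refine mul_left_cancel₀ hne ?_
    simp only [ez]
    linear_combination sn h t * ((1 - h) * dn h t +
        h * sn h t * ((1 - h) * eg h t + sn h t * dn h t - ee h t * cn h t)) * h5 -
      sn h t * (h * sn h t * ((1 - h) * ef h t + ee h t * dn h t - h * sn h t * cn h t) +
        (1 - h) * dn h t * (sn h t * ee h t + cn h t * dn h t)) * h4 +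
      ((1 - h) * sn h t ^ 2 + h * sn h t ^ 4 - h * sn h t ^ 2 * ee h t ^ 2 +
        (1 - h) * (-sn h t ^ 2 * ee h t ^ 2 - ee h t * cn h t * dn h t * sn h t +
        (1 + h * sn h t ^ 2) * cn h t ^ 2)) * h3 +
      (-h ^ 3 * sn h t ^ 4 + h * sn h t ^ 2 * ee h t ^ 2 +
        (1 - h) * (1 + h * sn h t ^ 2) * (1 - h * sn h t ^ 2)) * h2
  linear_combination (1 - h) * key + key2

/-- The leading coefficient is recovered from the values at the three nodes; its sign is that of
`ee_sq_sub_nonneg`, reversed. -/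
theorem jacobianQuad_eq (hh : 0 < h) (h1 : h ≠ 1) (ht : 0 ≤ t) :
    h * (1 - h) ^ 2 * jacobianQuad h t =
      -(sn h t ^ 2 * (ee h t ^ 2 - h * sn h t ^ 2 - (1 - h) * t * ee h t)) := by
  have e1 := jacobianQuad_mul h t
  have e2 := jacobian_zero hh h1 ht
  have e3 := jacobian_one hh ht
  have e4 := jacobian_self hh ht
  have h1 := ef_mul_cn_add_eg_mul_dn hh t
  have h2 := sn_sq_add_cn_sq hh t
  have h3 := dn_sq_add_sn_sq hh t
  have h4 := one_sub_mul_ef hh t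
  have h5 := one_sub_mul_eg hh t
  simp only [ez] at e2
  linear_combination (1 - h) * e1 + e2 + (1 - h) * e3 - (1 - h) * e4 +
    (1 - h) * (ef h t * cn h t - eg h t * dn h t - t * cn h t * dn h t) * h1 +
    sn h t * (cn h t * h4 - dn h t * h5) - (dn h t ^ 2 + h * sn h t ^ 2) * h2 - h3

end SH2
end

/-! ### Positivity of the Jacobian and local invertibility of `midExp`. -/

noncomputable section

namespace SH2

variable {h t : ℝ}

theorem continuousAt_param {Y : ℝ → ℝ → ℝ}
    (hY : ContDiffAt ℝ ∞ (fun q : ℝ × ℝ => Y q.1 q.2) (h, t)) :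
    ContinuousAt (fun h => Y h t) h := by
  have h1 : ContDiffAt ℝ ∞ (fun s : ℝ => (s, t)) h := by fun_prop
  exact (ContDiffAt.comp (g := fun q : ℝ × ℝ => Y q.1 q.2) (f := fun s => (s, t)) h hY h1).continuousAt

theorem continuousAt_deriv_param {Y : ℝ → ℝ → ℝ}
    (hY : ContDiffAt ℝ ∞ (fun q : ℝ × ℝ => Y q.1 q.2) (h, t)) :
    ContinuousAt (fun h => deriv (fun h => Y h t) h) h := by
  have h1 : ContDiffAt ℝ ∞ (fun s : ℝ => (s, t)) h := by fun_prop
  have h2 : ContDiffAt ℝ ∞ (fun s => Y s t) h :=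
    ContDiffAt.comp (g := fun q : ℝ × ℝ => Y q.1 q.2) (f := fun s => (s, t)) h hY h1
  have h3 := (h2.fderiv_right (m := 0) (by simp)).continuousAt
  exact h3.clm_apply continuousAt_const

theorem continuousAt_jacobian (hh : 0 < h) (t : ℝ) :
    ContinuousAt (fun h => jacobian h t 0) h ∧ ContinuousAt (fun h => jacobianQuad h t) h := by
  have a1 := continuousAt_param (contDiffAt_sn hh t)
  have a2 := continuousAt_param (contDiffAt_cn hh t)
  have a3 := continuousAt_param (contDiffAt_dn hh t)
  have a4 := continuousAt_param (contDiffAt_ef hh t)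
  have a5 := continuousAt_param (contDiffAt_eg hh t)
  have b1 : ContinuousAt (fun h => snParam h t) h := continuousAt_deriv_param (contDiffAt_sn hh t)
  have b4 : ContinuousAt (fun h => efParam h t) h := continuousAt_deriv_param (contDiffAt_ef hh t)
  have b5 : ContinuousAt (fun h => egParam h t) h := continuousAt_deriv_param (contDiffAt_eg hh t)
  unfold jacobian jacobianQuad
  constructor <;> fun_prop

namespace BeforeZero

theorem jacobian_nonneg_of_ne_one (H : BeforeZero h t) (h1 : h ≠ 1) :
    0 ≤ jacobian h t 0 ∧ jacobianQuad h t ≤ 0 := by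
  have hsq : 0 < (1 - h) ^ 2 := by
    have : 1 - h ≠ 0 := sub_ne_zero.2 h1.symm
    positivity
  constructor
  · have e := jacobian_zero H.1 h1 H.2.le
    have := H.one_sub_ez_sq_nonneg
    rw [← e] at this
    exact nonneg_of_mul_nonneg_right this hsq
  · have e := jacobianQuad_eq H.1 h1 H.2.le
    have := mul_nonneg (sq_nonneg (sn h t)) H.ee_sq_sub_nonneg
    by_contra! hneg
    have := mul_pos (mul_pos H.1 hsq) hneg
    linarith

/-- The closed forms carry the factor `(1 - h) ^ 2`, so `h = 1` is reached as a limit; `BeforeZero`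
is open, which keeps nearby parameters admissible. -/
theorem jacobian_nonneg (H : BeforeZero h t) : 0 ≤ jacobian h t 0 ∧ jacobianQuad h t ≤ 0 := by
  have hc : ContinuousAt (fun s => (s, t)) h := by fun_prop
  have hev : ∀ᶠ s in 𝓝 h, BeforeZero s t := hc.eventually H.eventually
  rcases eq_or_ne h 1 with rfl | h1
  · have hev' : ∀ᶠ s in 𝓝[≠] (1 : ℝ), 0 ≤ jacobian s t 0 ∧ jacobianQuad s t ≤ 0 := by
      filter_upwards [hev.filter_mono nhdsWithin_le_nhds, self_mem_nhdsWithin] with s hs hs1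
      exact hs.jacobian_nonneg_of_ne_one hs1
    obtain ⟨c1, c2⟩ := continuousAt_jacobian H.1 t
    exact ⟨ge_of_tendsto (c1.tendsto.mono_left nhdsWithin_le_nhds) (hev'.mono fun _ h => h.1),
      le_of_tendsto (c2.tendsto.mono_left nhdsWithin_le_nhds) (hev'.mono fun _ h => h.2)⟩
  · exact H.jacobian_nonneg_of_ne_one h1

/-- Concavity in `x` reduces the claim to the right node `m = min 1 h`, where the closed form is a
product of positive factors. The bound at the left node is not strict, hence `0 < x`. -/
theorem jacobian_pos (H : BeforeZero h t) {x : ℝ} (hx : 0 < x) (hx1 : x ≤ 1) (hxh : x ≤ h) :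
    0 < jacobian h t x := by
  obtain ⟨n1, n2⟩ := H.jacobian_nonneg
  have main : ∀ m, x ≤ m → 0 < jacobian h t m → 0 < jacobian h t x := fun m hm hJ => by
    have hm0 : 0 < m := hx.trans_le hm
    have e := jacobian_interpolate h t x m
    have h1 : 0 ≤ (m - x) * jacobian h t 0 := mul_nonneg (sub_nonneg.2 hm) n1
    have h2 : 0 ≤ -jacobianQuad h t * (x * (m - x)) * m :=
      mul_nonneg (mul_nonneg (neg_nonneg.2 n2) (mul_nonneg hx.le (sub_nonneg.2 hm))) hm0.le
    have h3 := mul_pos hx hJ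
    have : 0 < m * jacobian h t x := by rw [e]; linarith
    exact (mul_pos_iff_of_pos_left hm0).1 this
  rcases lt_or_ge h 1 with h1 | h1
  · refine main h hxh ?_
    rw [jacobian_self H.1 H.2.le]
    have := H.eg_pos
    have := dn_pos_of_le_one H.1 h1.le t
    have := H.eg_add_mul_cn_pos h1
    positivity
  · refine main 1 hx1 ?_
    have h2 := jacobian_one H.1 H.2.le
    have h3 : 0 < h * jacobian h t 1 := by
      rw [h2]
      have := H.ef_pos
      have := cn_pos_of_one_le H.1 h1 t
      have := H.ef_sub_mul_dn_pos h1
      positivity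
    exact (mul_pos_iff_of_pos_left H.1).1 h3

end BeforeZero

/-! ### The exponential mapping in midpoint coordinates -/

/-- The squared modulus of the pendulum trajectory through `(2 θ, 2 p)`. -/
def param (m : ℝ × ℝ × ℝ) : ℝ := m.2.1 ^ 2 + Real.sin m.1 ^ 2

/-- The exponential mapping in terms of the half-angle and its velocity at the midpoint and of half
the length, up to a diffeomorphism of the target. -/
def midExp (m : ℝ × ℝ × ℝ) : ℝ × ℝ × ℝ :=
  (Real.cos m.1 * ef (param m) m.2.2, m.2.1 * eg (param m) m.2.2, Real.sin m.1 * sn (param m) m.2.2)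

theorem contDiff_param : ContDiff ℝ ∞ param := by unfold param; fun_prop

theorem contDiffAt_midExp {m : ℝ × ℝ × ℝ} (hm : 0 < param m) : ContDiffAt ℝ ∞ midExp m := by
  have hp : ContDiffAt ℝ ∞ (fun m : ℝ × ℝ × ℝ => (param m, m.2.2)) m :=
    contDiff_param.contDiffAt.prodMk (by fun_prop)
  have h1 : ContDiffAt ℝ ∞ (fun m : ℝ × ℝ × ℝ => sn (param m) m.2.2) m :=
    ContDiffAt.comp (g := fun q : ℝ × ℝ => sn q.1 q.2)
      (f := fun m : ℝ × ℝ × ℝ => (param m, m.2.2)) m (contDiffAt_sn hm m.2.2) hp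
  have h2 : ContDiffAt ℝ ∞ (fun m : ℝ × ℝ × ℝ => ef (param m) m.2.2) m :=
    ContDiffAt.comp (g := fun q : ℝ × ℝ => ef q.1 q.2)
      (f := fun m : ℝ × ℝ × ℝ => (param m, m.2.2)) m (contDiffAt_ef hm m.2.2) hp
  have h3 : ContDiffAt ℝ ∞ (fun m : ℝ × ℝ × ℝ => eg (param m) m.2.2) m :=
    ContDiffAt.comp (g := fun q : ℝ × ℝ => eg q.1 q.2)
      (f := fun m : ℝ × ℝ × ℝ => (param m, m.2.2)) m (contDiffAt_eg hm m.2.2) hp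
  unfold midExp
  fun_prop

theorem hasFDerivAt_of_partial {Y : ℝ → ℝ → ℝ} {Y' : ℝ}
    (hY : ContDiffAt ℝ ∞ (fun q : ℝ × ℝ => Y q.1 q.2) (h, t)) (ht : HasDerivAt (Y h) Y' t) :
    HasFDerivAt (fun q : ℝ × ℝ => Y q.1 q.2)
      (deriv (fun h => Y h t) h • ContinuousLinearMap.fst ℝ ℝ ℝ +
        Y' • ContinuousLinearMap.snd ℝ ℝ ℝ) (h, t) := by
  have hd := (hY.differentiableAt (by simp)).hasFDerivAt
  have e1 := HasFDerivAt.comp_hasDerivAt (f := fun s => (s, t)) h hd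
    ((hasDerivAt_id h).prodMk (hasDerivAt_const h t))
  have e2 := HasFDerivAt.comp_hasDerivAt (f := fun s => (h, s)) t hd
    ((hasDerivAt_const t h).prodMk (hasDerivAt_id t))
  have e3 := ht.unique e2
  have e4 : deriv (fun h => Y h t) h = _ := e1.deriv
  convert! hd using 1
  ext
  · simp [e4]
  · simp [e3]

theorem linear_system_eq_zero {a b c d e f g h i x y z : ℝ}
    (hdet : a * (e * i - f * h) - b * (d * i - f * g) + c * (d * h - e * g) ≠ 0)
    (h1 : a * x + b * y + c * z = 0) (h2 : d * x + e * y + f * z = 0)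
    (h3 : g * x + h * y + i * z = 0) : x = 0 ∧ y = 0 ∧ z = 0 := by
  refine ⟨?_, ?_, ?_⟩ <;> refine (mul_eq_zero.1 ?_).resolve_left hdet
  · linear_combination (e * i - f * h) * h1 - (b * i - c * h) * h2 + (b * f - c * e) * h3
  · linear_combination -(d * i - f * g) * h1 + (a * i - c * g) * h2 - (a * f - c * d) * h3
  · linear_combination (d * h - e * g) * h1 - (a * h - b * g) * h2 + (a * e - b * d) * h3

/-- The domain of `midExp`. -/
def midDomain : Set (ℝ × ℝ × ℝ) := {m | Real.sin m.1 ≠ 0 ∧ BeforeZero (param m) m.2.2}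

theorem isOpen_midDomain : IsOpen midDomain := by
  rw [isOpen_iff_mem_nhds]
  rintro m ⟨h1, h2⟩
  have c1 : ContinuousAt (fun m : ℝ × ℝ × ℝ => Real.sin m.1) m := by fun_prop
  have c2 : ContinuousAt (fun m : ℝ × ℝ × ℝ => (param m, m.2.2)) m :=
    contDiff_param.continuous.continuousAt.prodMk (by fun_prop)
  filter_upwards [c1.eventually_ne h1, c2.eventually h2.eventually] with q hq1 hq2
  exact ⟨hq1, hq2⟩

/-- The determinant is `-jacobian` at `x = sin θ ^ 2`, and `h = p ^ 2 + sin θ ^ 2` puts `x` in the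
range of `jacobian_pos`. -/
theorem exists_equiv_hasFDerivAt_midExp {m : ℝ × ℝ × ℝ} (hm : m ∈ midDomain) :
    ∃ e : (ℝ × ℝ × ℝ) ≃L[ℝ] (ℝ × ℝ × ℝ), HasFDerivAt midExp (e : (ℝ × ℝ × ℝ) →L[ℝ] _) m := by
  obtain ⟨hsin, H⟩ := hm
  obtain ⟨θ, p, τ⟩ := m
  have hd := ((contDiffAt_midExp H.1).differentiableAt (by simp)).hasFDerivAt
  set L := fderiv ℝ midExp (θ, p, τ)
  set hh := param (θ, p, τ) with hparam
  have hJ := H.jacobian_pos (x := Real.sin θ ^ 2) (by positivity) (Real.sin_sq_le_one θ)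
    (by rw [hparam, param]; nlinarith [sq_nonneg p])
  have F1 := hasFDerivAt_of_partial (contDiffAt_ef H.1 τ) (hasDerivAt_ef H.1 τ)
  have F2 := hasFDerivAt_of_partial (contDiffAt_eg H.1 τ) (hasDerivAt_eg H.1 τ)
  have F3 := hasFDerivAt_of_partial (contDiffAt_sn H.1 τ) (hasDerivAt_sn H.1 τ)
  have hinj : Function.Injective L := by
    rw [injective_iff_map_eq_zero]
    rintro ⟨x, y, z⟩ hL
    -- A kernel vector is tested along a straight line; the three coordinates of the derivative give
    -- a homogeneous linear system.
    have hl : HasDerivAt (fun s : ℝ => (θ + s * x, p + s * y, τ + s * z)) (x, y, z) 0 := by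
      have h1 : ∀ a b : ℝ, HasDerivAt (fun s : ℝ => a + s * b) b 0 := fun a b => by
        simpa using ((hasDerivAt_id (0 : ℝ)).mul_const b).const_add a
      exact (h1 θ x).prodMk ((h1 p y).prodMk (h1 τ z))
    have hl0 : (fun s : ℝ => (θ + s * x, p + s * y, τ + s * z)) 0 = (θ, p, τ) := by simp
    have hcurve : HasDerivAt (fun s : ℝ => midExp (θ + s * x, p + s * y, τ + s * z)) 0 0 := by
      have := HasFDerivAt.comp_hasDerivAt (f := fun s : ℝ => (θ + s * x, p + s * y, τ + s * z)) 0
        (hl0 ▸ hd) hl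
      rwa [hL] at this
    have hθ : HasDerivAt (fun s : ℝ => θ + s * x) x 0 := hasDerivAt_comp_fst hl
    have hp : HasDerivAt (fun s : ℝ => p + s * y) y 0 :=
      hasDerivAt_comp_fst (hasDerivAt_comp_snd hl)
    have hτ : HasDerivAt (fun s : ℝ => τ + s * z) z 0 :=
      hasDerivAt_comp_snd (hasDerivAt_comp_snd hl)
    have hq : HasDerivAt (fun s : ℝ => (param (θ + s * x, p + s * y, τ + s * z), τ + s * z))
        (2 * p * y + 2 * Real.sin θ * Real.cos θ * x, z) 0 := by
      refine HasDerivAt.prodMk ?_ hτ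
      unfold param
      refine ((hp.pow 2).add (hθ.sin.pow 2)).congr_deriv ?_
      simp
      ring
    have hq0 : (fun s : ℝ => (param (θ + s * x, p + s * y, τ + s * z), τ + s * z)) 0 = (hh, τ) := by
      simp [hparam]
    have G1 := HasFDerivAt.comp_hasDerivAt
      (f := fun s : ℝ => (param (θ + s * x, p + s * y, τ + s * z), τ + s * z)) 0 (hq0 ▸ F1) hq
    have G2 := HasFDerivAt.comp_hasDerivAt
      (f := fun s : ℝ => (param (θ + s * x, p + s * y, τ + s * z), τ + s * z)) 0 (hq0 ▸ F2) hq
    have G3 := HasFDerivAt.comp_hasDerivAt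
      (f := fun s : ℝ => (param (θ + s * x, p + s * y, τ + s * z), τ + s * z)) 0 (hq0 ▸ F3) hq
    have E1 := (hθ.cos.mul G1).unique (hasDerivAt_comp_fst hcurve)
    have E2 := (hp.mul G2).unique (hasDerivAt_comp_fst (hasDerivAt_comp_snd hcurve))
    have E3 := (hθ.sin.mul G3).unique (hasDerivAt_comp_snd (hasDerivAt_comp_snd hcurve))
    simp only [add_apply, smul_apply, smul_eq_mul,
      ContinuousLinearMap.coe_fst', ContinuousLinearMap.coe_snd', Function.comp_apply,
      zero_mul, add_zero, ← hparam, Prod.fst_zero, Prod.snd_zero] at E1 E2 E3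
    have hv : 1 - Real.sin θ ^ 2 = Real.cos θ ^ 2 := by linarith [Real.sin_sq_add_cos_sq θ]
    have hp2 : hh - Real.sin θ ^ 2 = p ^ 2 := by rw [hparam, param]; ring
    rw [jacobian, hv, hp2] at hJ
    rw [show deriv (fun h => ef h τ) hh = efParam hh τ from rfl] at E1
    rw [show deriv (fun h => eg h τ) hh = egParam hh τ from rfl] at E2
    rw [show deriv (fun h => sn h τ) hh = snParam hh τ from rfl] at E3
    have hz := linear_system_eq_zero
      (a := -Real.sin θ * ef hh τ + 2 * Real.sin θ * Real.cos θ ^ 2 * efParam hh τ)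
      (b := 2 * p * Real.cos θ * efParam hh τ)
      (c := Real.cos θ * (dn hh τ + hh * sn hh τ * eg hh τ))
      (d := 2 * Real.sin θ * Real.cos θ * p * egParam hh τ)
      (e := eg hh τ + 2 * p ^ 2 * egParam hh τ) (f := p * (sn hh τ * ef hh τ))
      (g := Real.cos θ * sn hh τ + 2 * Real.sin θ ^ 2 * Real.cos θ * snParam hh τ)
      (h := 2 * p * Real.sin θ * snParam hh τ) (i := Real.sin θ * (cn hh τ * dn hh τ))
      (x := x) (y := y) (z := z) ?_ (by linear_combination E1) (by linear_combination E2)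
      (by linear_combination E3)
    · simpa using hz
    · refine ne_of_lt (neg_pos.1 (hJ.trans_eq ?_))
      ring
  let e := (LinearEquiv.ofInjectiveEndo (L : (ℝ × ℝ × ℝ) →ₗ[ℝ] ℝ × ℝ × ℝ) hinj)
    |>.toContinuousLinearEquiv
  refine ⟨e, ?_⟩
  convert! hd using 1

end SH2
end

noncomputable section

namespace SH2

variable {h t : ℝ}

/-! ### Estimates for the elliptic functions before the first zero of `sn` -/

namespace BeforeZero

theorem cn_mul_dn_antitone (H : BeforeZero h t) {s r : ℝ} (hs : 0 ≤ s) (hsr : s ≤ r) (hr : r ≤ t) :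
    cn h r * dn h r ≤ cn h s * dn h s := by
  have := le_of_hasDerivAt_nonneg (F := fun s => -(cn h s * dn h s)) hsr
    ((continuous_of_hasDerivAt (hasDerivAt_cn H.1)).mul
      (continuous_of_hasDerivAt (hasDerivAt_dn H.1))).neg.continuousOn
    (fun r _ => ((hasDerivAt_cn H.1 r).mul (hasDerivAt_dn H.1 r)).neg) (fun q hq => by
      have h2 := H.3 q ⟨hs.trans_lt hq.1, hq.2.le.trans hr⟩
      have h3 := H.1
      have : 0 ≤ sn h q * (dn h q ^ 2 + h * cn h q ^ 2) := by positivity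
      linarith)
  linarith

/-- The derivative `cn * dn` of `sn` decreases, so `sn` is concave up to its first zero. -/
theorem mul_cn_mul_dn_le_sn (H : BeforeZero h t) : t * (cn h t * dn h t) ≤ sn h t := by
  have := le_of_hasDerivAt_nonneg (F := fun s => sn h s - s * (cn h t * dn h t)) H.2.le
    ((continuous_of_hasDerivAt (hasDerivAt_sn H.1)).sub (by fun_prop)).continuousOn
    (fun s _ => (hasDerivAt_sn H.1 s).sub ((hasDerivAt_id s).mul_const _)) (fun s hs => by
      have := H.cn_mul_dn_antitone hs.1.le hs.2.le le_rfl
      linarith)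
  simp only [sn_zero H.1] at this
  linarith

theorem sn_div_antitone (H : BeforeZero h t) {s : ℝ} (hs : s ∈ Ioc 0 t) :
    s / t * sn h t ≤ sn h s := by
  have hle : sn h t / t ≤ sn h s / s := by
    have := le_of_hasDerivAt_nonneg (F := fun s => -(sn h s / s)) hs.2
      (ContinuousOn.neg (ContinuousOn.div
        (continuous_of_hasDerivAt (hasDerivAt_sn H.1)).continuousOn (by fun_prop)
        fun r hr => (hs.1.trans_le hr.1).ne'))
      (fun r hr => ((hasDerivAt_sn H.1 r).div (hasDerivAt_id r) (hs.1.trans hr.1).ne').neg)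
      (fun r hr => by
        have := (H.mono ⟨hs.1.trans hr.1, hr.2.le⟩).mul_cn_mul_dn_le_sn
        rw [neg_nonneg]
        exact div_nonpos_of_nonpos_of_nonneg (by simp only [id]; linarith) (sq_nonneg _))
    linarith
  rw [div_le_div_iff₀ H.2 hs.1] at hle
  rw [div_mul_eq_mul_div, div_le_iff₀ H.2]
  linarith

/-- While `dn ≥ 0`, the derivative of `ef - sn` is `dn * (1 - cn) + h * sn * eg ≥ 0`. If `dn < 0`,
the first integral gives `ef * cn ≥ sn`, and `cn ≤ 1`. -/
theorem sn_le_ef (H : BeforeZero h t) : sn h t ≤ ef h t := by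
  rcases le_or_gt 0 (dn h t) with hd | hd
  · have hd' : ∀ s ∈ Ioo 0 t, 0 ≤ dn h s := fun s hs => by
      rcases le_total h 1 with h1 | h1
      · exact (dn_pos_of_le_one H.1 h1 s).le
      · exact hd.trans (H.dn_antitone h1 (Ioo_subset_Icc_self hs))
    have := le_of_hasDerivAt_nonneg (F := fun s => ef h s - sn h s) H.2.le
      ((continuous_of_hasDerivAt (hasDerivAt_ef H.1)).sub
        (continuous_of_hasDerivAt (hasDerivAt_sn H.1))).continuousOn
      (fun s _ => (hasDerivAt_ef H.1 s).sub (hasDerivAt_sn H.1 s)) (fun s hs => by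
        have Hs := H.mono (Ioo_subset_Ioc_self hs)
        have h1 := Hs.sn_pos'
        have h2 := Hs.eg_pos
        have h3 := H.1
        have h4 : 0 ≤ dn h s * (1 - cn h s) :=
          mul_nonneg (hd' s hs) (by linarith [(abs_le.1 (abs_cn_le_one H.1 s)).2])
        have : 0 ≤ h * sn h s * eg h s := by positivity
        linarith)
    simp only [sn_zero H.1, ef_zero H.1] at this
    linarith
  · have e := ef_mul_cn_add_eg_mul_dn H.1 t
    have := H.eg_pos
    have := H.ef_pos
    have := (abs_le.1 (abs_cn_le_one H.1 t)).2
    nlinarith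

/-- Concavity bounds `sn h s` below by `s / t * sn h t`, so `eg' = sn * ef` is at least the square
of this; integration gives the `1 / 3`. -/
theorem sn_sq_mul_le_eg (H : BeforeZero h t) : sn h t ^ 2 * t / 3 ≤ eg h t := by
  have ht := H.2
  have := le_of_hasDerivAt_nonneg (F := fun s => eg h s - (sn h t / t) ^ 2 / 3 * s ^ 3) H.2.le
    ((continuous_of_hasDerivAt (hasDerivAt_eg H.1)).sub (by fun_prop)).continuousOn
    (fun s _ => (hasDerivAt_eg H.1 s).sub ((hasDerivAt_pow 3 s).const_mul _)) (fun s hs => by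
      have Hs := H.mono (Ioo_subset_Ioc_self hs)
      have h1 := H.sn_div_antitone (Ioo_subset_Ioc_self hs)
      have h2 := Hs.sn_le_ef
      have h3 : 0 ≤ s / t * sn h t := mul_nonneg (div_nonneg hs.1.le ht.le) H.sn_pos'.le
      have h4 : (s / t * sn h t) * (s / t * sn h t) ≤ sn h s * ef h s :=
        mul_le_mul h1 (h1.trans h2) h3 (h3.trans h1)
      have h5 : (s / t * sn h t) * (s / t * sn h t) = (sn h t / t) ^ 2 / 3 * (3 * s ^ 2) := by ring
      simp only [Nat.cast_ofNat, Nat.add_one_sub_one]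
      linarith)
  simp only [eg_zero H.1] at this
  have e : (sn h t / t) ^ 2 / 3 * t ^ 3 = sn h t ^ 2 * t / 3 := by field_simp
  rw [e] at this
  linarith

/-- In `ef' = dn + h * sn * eg` the first term is at least `-1` and the second grows like `s ^ 4` by
the bound on `eg`; `15 = 3 * 5` comes from two integrations. -/
theorem mul_sn_pow_mul_sub_le_ef (H : BeforeZero h t) :
    h * sn h t ^ 3 * t ^ 2 / 15 - t ≤ ef h t := by
  have ht := H.2
  have hS := H.sn_pos'
  have := le_of_hasDerivAt_nonneg
    (F := fun s => ef h s - (h * (sn h t / t) ^ 3 / 15 * s ^ 5 - s)) H.2.le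
    ((continuous_of_hasDerivAt (hasDerivAt_ef H.1)).sub (by fun_prop)).continuousOn
    (fun s _ => (hasDerivAt_ef H.1 s).sub (((hasDerivAt_pow 5 s).const_mul _).sub
      (hasDerivAt_id s))) (fun s hs => by
      have Hs := H.mono (Ioo_subset_Ioc_self hs)
      have h1 := H.sn_div_antitone (Ioo_subset_Ioc_self hs)
      have h2 := Hs.sn_sq_mul_le_eg
      have h0 := hs.1
      have hh := H.1
      have h3 : 0 ≤ s / t * sn h t := mul_nonneg (div_nonneg hs.1.le ht.le) H.sn_pos'.le
      have h4 : (s / t * sn h t) ^ 2 * s / 3 ≤ eg h s := le_trans (by gcongr) h2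
      have h5 : (s / t * sn h t) * ((s / t * sn h t) ^ 2 * s / 3) ≤ sn h s * eg h s :=
        mul_le_mul h1 h4 (by positivity) (h3.trans h1)
      have h6 := mul_le_mul_of_nonneg_left h5 hh.le
      have h7 : h * ((s / t * sn h t) * ((s / t * sn h t) ^ 2 * s / 3)) =
        h * (sn h t / t) ^ 3 / 15 * (5 * s ^ 4) := by ring
      have h8 := (abs_le.1 (abs_dn_le_one hh s)).1
      simp only [Nat.cast_ofNat, Nat.add_one_sub_one]
      linarith)
  simp only [ef_zero H.1] at this
  have e : h * (sn h t / t) ^ 3 / 15 * t ^ 5 = h * sn h t ^ 3 * t ^ 2 / 15 := by field_simp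
  rw [e] at this
  linarith

/-- The estimate behind the properness of the exponential mapping: near the fixed point `u = 1`,
`v = p = 0` of the pendulum, the time is bounded. -/
theorem mul_time_le_one {u v p A w₀ q : ℝ} (H : BeforeZero h t) (hh : h = p ^ 2 + u ^ 2)
    (huv : u ^ 2 + v ^ 2 = 1) (hu : 0 < u) (hw₀ : 0 < w₀)
    (hf : (v * ef h t) ^ 2 ≤ A ^ 2) (hg : (p * eg h t) ^ 2 ≤ A ^ 2)
    (h0 : w₀ ≤ u * sn h t) (h1 : (u * sn h t) ^ 2 ≤ 1 - 2 * q)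
    (hq : 0 < q) {ε : ℝ} (hε : 4 * ε ≤ q) (hεA : 4 * (ε * A ^ 2) < w₀ ^ 2 * q)
    (hv : v ^ 2 ≤ ε) (hp : p ^ 2 ≤ ε) : t * q ≤ 1 := by
  have i1 := sn_sq_add_cn_sq H.1 t
  have i2 := dn_sq_add_sn_sq H.1 t
  have i3 := one_sub_mul_ef H.1 t
  have i4 := one_sub_mul_eg H.1 t
  have hE := H.ee_pos
  have hS := H.sn_pos'
  have hf0 := H.ef_pos
  have hg0 := H.eg_pos
  have hline := H.mul_cn_mul_dn_le_sn
  have ht := H.2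
  have hD := dn_pos_of_le_one H.1 (t := t)
  have hC := cn_pos_of_one_le H.1 (t := t)
  have hu1 : u ^ 2 ≤ 1 := by linarith [sq_nonneg v]
  have hu1' : u ≤ 1 := (sq_le_one_iff₀ hu.le).1 hu1
  have hSw : w₀ ≤ sn h t := h0.trans (mul_le_of_le_one_left hS.le hu1')
  have hS1 : sn h t ≤ 1 := (abs_le.1 (abs_sn_le_one H.1 t)).2
  have hq1 : q ≤ 1 / 2 := by linarith [sq_nonneg (u * sn h t)]
  have hε0 : 0 ≤ ε := (sq_nonneg v).trans hv
  have hu2 : 1 - ε ≤ u ^ 2 := by linarith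
  have hh1 : h ≤ 1 + ε := by linarith
  have hh2 : 1 - ε ≤ h := by linarith [sq_nonneg p]
  have hh3 : 7 / 8 ≤ h := by linarith
  generalize sn h t = S at *
  generalize cn h t = C at *
  generalize dn h t = D at *
  generalize ee h t = E at *
  generalize ef h t = f at *
  generalize eg h t = g at *
  -- Since `u` and `h` are within `ε` of `1` in the relevant sense, `u * S` being away from `1`
  -- keeps both `C` and `D` away from `0`.
  have hC2 : q ≤ C ^ 2 := by
    have e : u ^ 2 * C ^ 2 = u ^ 2 - (u * S) ^ 2 := by linear_combination u ^ 2 * i1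
    have := mul_le_mul_of_nonneg_right hu1 (sq_nonneg C)
    linarith
  have hD2 : q ≤ D ^ 2 := by
    have e : u ^ 2 * D ^ 2 = u ^ 2 - h * (u * S) ^ 2 := by linear_combination u ^ 2 * i2
    have := mul_le_mul_of_nonneg_right hu1 (sq_nonneg D)
    have := mul_le_mul hh1 h1 (sq_nonneg _) (by linarith)
    have := mul_nonneg hε0 hq.le
    linarith
  have hSq : w₀ ^ 2 * q ≤ S ^ 2 * q := by gcongr
  -- With both signs positive, `C * D ≥ q`, and concavity of `sn` gives `t * C * D ≤ S ≤ 1`.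
  have key : 0 < C → 0 < D → t * q ≤ 1 := fun c d => by
    have h3 : q * q ≤ C ^ 2 * D ^ 2 := mul_le_mul hC2 hD2 hq.le (sq_nonneg _)
    have h4 : q ≤ C * D := by
      refine le_of_sq_le_sq ?_ (mul_pos c d).le
      linarith
    have := mul_le_mul_of_nonneg_left h4 ht.le
    linarith
  rcases le_total h 1 with hle | hle
  · rcases lt_or_ge 0 C with c | c
    · exact key c (hD hle)
    · exfalso
      have d := hD hle
      -- A wrong sign is impossible: `h * S * (-C)` would be at most `(1 - h) * f`, which is small
      -- because `1 - h ≤ v ^ 2 ≤ ε` and `v * f` is bounded by `A`. The case `h ≥ 1` is the same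
      -- with `D`, `g` and `h - 1 ≤ p ^ 2`.
      have hX : h * S * (-C) ≤ (1 - h) * f := by
        have := mul_pos hE d
        linarith
      have hX0 : 0 ≤ h * S * (-C) := by
        have := H.1
        have : 0 ≤ -C := by linarith
        positivity
      have hX2 : (h * S * (-C)) ^ 2 ≤ ((1 - h) * f) ^ 2 := pow_le_pow_left₀ hX0 hX 2
      have hY : ((1 - h) * f) ^ 2 ≤ ε * A ^ 2 := by
        have e1 : (1 - h) * f ^ 2 ≤ A ^ 2 := by
          refine le_trans ?_ hf
          rw [mul_pow]
          gcongr
          linarith [sq_nonneg p]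
        calc ((1 - h) * f) ^ 2 = (1 - h) * ((1 - h) * f ^ 2) := by ring
          _ ≤ ε * A ^ 2 := mul_le_mul (by linarith) e1
            (mul_nonneg (by linarith) (sq_nonneg _)) hε0
      have hZ : 1 / 2 * (S ^ 2 * q) ≤ (h * S * (-C)) ^ 2 := by
        calc 1 / 2 * (S ^ 2 * q) ≤ h ^ 2 * (S ^ 2 * C ^ 2) :=
              mul_le_mul (by nlinarith only [hh3]) (by gcongr) (by positivity) (by positivity)
          _ = _ := by ring
      have := mul_pos (pow_pos hw₀ 2) hq
      linarith
  · rcases lt_or_ge 0 D with d | d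
    · exact key (hC hle) d
    · exfalso
      have c := hC hle
      have hX : S * (-D) ≤ (h - 1) * g := by
        have := mul_pos hE c
        linarith
      have hX0 : 0 ≤ S * (-D) := mul_nonneg hS.le (by linarith)
      have hX2 : (S * (-D)) ^ 2 ≤ ((h - 1) * g) ^ 2 := pow_le_pow_left₀ hX0 hX 2
      have hY : ((h - 1) * g) ^ 2 ≤ ε * A ^ 2 := by
        have e1 : (h - 1) * g ^ 2 ≤ A ^ 2 := by
          refine le_trans ?_ hg
          rw [mul_pow]
          gcongr
          linarith
        calc ((h - 1) * g) ^ 2 = (h - 1) * ((h - 1) * g ^ 2) := by ring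
          _ ≤ ε * A ^ 2 := mul_le_mul (by linarith) e1
            (mul_nonneg (by linarith) (sq_nonneg _)) hε0
      have hZ : S ^ 2 * q ≤ (S * (-D)) ^ 2 := by
        calc S ^ 2 * q ≤ S ^ 2 * D ^ 2 := by gcongr
          _ = _ := by ring
      have := mul_pos (pow_pos hw₀ 2) hq
      linarith

theorem mul_param_le_one (H : BeforeZero h t) {w₀ : ℝ} (hw : 0 ≤ w₀) (hS : w₀ ≤ sn h t) :
    w₀ ^ 2 * h ≤ 1 := by
  have i2 := dn_sq_add_sn_sq H.1 t
  have : w₀ ^ 2 ≤ sn h t ^ 2 := pow_le_pow_left₀ hw hS 2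
  nlinarith [sq_nonneg (dn h t), H.1]

end BeforeZero

/-- For long times `ef` and `eg` exceed `A / δ`, so the bounds by `A` force `v` and `p` below `δ`;
then `mul_time_le_one` bounds the time. -/
theorem exists_time_bound (A : ℝ) {w₀ w₁ : ℝ} (hw₀ : 0 < w₀) (hw₁ : w₁ < 1) :
    ∃ T, ∀ h u v p t, BeforeZero h t → h = p ^ 2 + u ^ 2 → u ^ 2 + v ^ 2 = 1 → 0 < u →
      |v * ef h t| ≤ A → |p * eg h t| ≤ A → w₀ ≤ u * sn h t → u * sn h t ≤ w₁ → t ≤ T := by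
  rcases le_or_gt w₁ 0 with hw | hw
  · exact ⟨0, fun _ _ _ _ _ _ _ _ _ _ _ h1 h2 => by linarith⟩
  rcases lt_or_ge A 0 with hA | hA
  · exact ⟨0, fun _ _ _ _ _ _ _ _ _ h1 _ _ _ => by
      have := h1.trans_lt hA
      exact absurd this (abs_nonneg _).not_gt⟩
  obtain ⟨q, hqd⟩ : ∃ q, q = (1 - w₁ ^ 2) / 2 := ⟨_, rfl⟩
  have hw2 := pow_lt_one₀ hw.le hw₁ two_ne_zero
  have hq : 0 < q := by linarith
  obtain ⟨ε, hε0, hε1, hε2⟩ : ∃ ε : ℝ, 0 < ε ∧ 4 * ε ≤ q ∧ 4 * (ε * A ^ 2) < w₀ ^ 2 * q := by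
    have hc : ContinuousAt (fun ε : ℝ => 4 * ε) 0 := by fun_prop
    have hc' : ContinuousAt (fun ε : ℝ => 4 * (ε * A ^ 2)) 0 := by fun_prop
    have e1 := hc.tendsto.eventually_lt_const (u := q) (by simpa using hq)
    have e2 := hc'.tendsto.eventually_lt_const (u := w₀ ^ 2 * q) (by simpa using by positivity)
    obtain ⟨ε, hε, hε0⟩ := ((e1.and e2).filter_mono (nhdsWithin_le_nhds (s := Ioi 0)) |>.and
      self_mem_nhdsWithin).exists
    exact ⟨ε, hε0, hε.1.le, hε.2⟩
  obtain ⟨δ, hδ0, hδ2⟩ : ∃ δ : ℝ, 0 < δ ∧ δ ^ 2 = ε :=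
    ⟨Real.sqrt ε, Real.sqrt_pos.2 hε0, Real.sq_sqrt hε0.le⟩
  -- The three entries serve, in order, the final contradiction, `A / δ < eg` and `A / δ < ef`.
  refine ⟨max (1 / q) (max (3 * (A / δ) / w₀ ^ 2) (15 * (A / δ + 1) / w₀ ^ 5 + 1)), ?_⟩
  intro h u v p t H hh huv hu hf hg h0 h1
  by_contra! hlt
  obtain ⟨l1, hlt⟩ := max_lt_iff.1 hlt
  obtain ⟨l2, l3⟩ := max_lt_iff.1 hlt
  have hAδ : 0 ≤ A / δ := by positivity
  have ht := H.2
  have hu1 : u ≤ 1 := (sq_le_one_iff₀ hu.le).1 (by linarith [sq_nonneg v])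
  have hS := H.sn_pos'
  have hSw : w₀ ≤ sn h t := h0.trans (mul_le_of_le_one_left hS.le hu1)
  have hS1 : sn h t ≤ 1 := (abs_le.1 (abs_sn_le_one H.1 t)).2
  have huw : w₀ ≤ u := h0.trans (mul_le_of_le_one_right hu.le hS1)
  have hhw : w₀ ^ 2 ≤ h := by
    have := pow_le_pow_left₀ hw₀.le huw 2
    linarith [sq_nonneg p]
  have hg1 : A / δ < eg h t := by
    refine lt_of_lt_of_le ?_ H.sn_sq_mul_le_eg
    rw [div_lt_iff₀ (by positivity)] at l2
    have := mul_le_mul_of_nonneg_right (pow_le_pow_left₀ hw₀.le hSw 2) ht.le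
    linarith
  have hf1 : A / δ < ef h t := by
    refine lt_of_lt_of_le ?_ H.mul_sn_pow_mul_sub_le_ef
    have e1 : 15 * (A / δ + 1) / w₀ ^ 5 < t - 1 := by linarith
    rw [div_lt_iff₀ (by positivity)] at e1
    have e2 : w₀ ^ 5 ≤ h * sn h t ^ 3 := by
      calc w₀ ^ 5 = w₀ ^ 2 * w₀ ^ 3 := by ring
        _ ≤ _ := by gcongr; exact H.1.le
    have e3 : w₀ ^ 5 * t ^ 2 ≤ h * sn h t ^ 3 * t ^ 2 := by gcongr
    have e4 : 0 < t - 1 := pos_of_mul_pos_left (lt_of_le_of_lt (by positivity) e1) (by positivity)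
    have e5 := mul_lt_mul_of_pos_right e1 ht
    have e6 : A / δ ≤ A / δ * t := le_mul_of_one_le_right hAδ (by linarith)
    have e7 : 0 ≤ w₀ ^ 5 * t := by positivity
    linarith
  have small : ∀ x F : ℝ, A / δ < F → |x * F| ≤ A → x ^ 2 ≤ ε := fun x F hF hx => by
    have hF0 : 0 < F := hAδ.trans_lt hF
    rw [abs_mul, abs_of_pos hF0] at hx
    rw [div_lt_iff₀ hδ0] at hF
    rw [← hδ2, ← sq_abs]
    refine pow_le_pow_left₀ (abs_nonneg _) ?_ 2
    by_contra! hlt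
    have h1 := mul_lt_mul_of_pos_right hlt hF0
    have h2 := mul_lt_mul_of_pos_left hF hδ0
    linarith
  have := H.mul_time_le_one hh huv hu hw₀ (sq_le_sq' (abs_le.1 hf).1 (abs_le.1 hf).2)
    (sq_le_sq' (abs_le.1 hg).1 (abs_le.1 hg).2) h0 (q := q)
    ((pow_le_pow_left₀ (hw₀.le.trans h0) h1 2).trans (by linarith)) hq hε1 hε2 (small _ _ hf1 hf) (small _ _ hg1 hg)
  rw [div_lt_iff₀ hq] at l1
  linarith

end SH2
end

noncomputable section

namespace SH2

/-! ### Bijectivity of proper local homeomorphisms with a one-point fibre -/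

/-- The points of `V` with exactly one preimage form a set that is open and closed in `V`.
Properness traps all preimages of nearby points near the original ones. -/
theorem existsUnique_of_proper {X Y : Type*} [TopologicalSpace X] [T2Space X] [TopologicalSpace Y]
    [T2Space Y] {F : X → Y} {U : Set X} {V : Set Y} (hU : IsOpen U) (hV : IsOpen V)
    (hVc : IsPreconnected V) (hF : ContinuousOn F U) (hopen : ∀ x ∈ U, Filter.map F (𝓝 x) = 𝓝 (F x))
    (hinj : ∀ x ∈ U, ∃ W ∈ 𝓝 x, InjOn F W)
    (hproper : ∀ y ∈ V, ∃ L ∈ 𝓝 y, ∃ K ⊆ U, IsCompact K ∧ ∀ x ∈ U, F x ∈ L → x ∈ K)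
    {y₀ : Y} (hy₀ : y₀ ∈ V) (hx₀ : ∃! x, x ∈ U ∧ F x = y₀) {y : Y} (hy : y ∈ V) :
    ∃! x, x ∈ U ∧ F x = y := by
  -- near `y`, all preimages lie in a given neighbourhood of the preimages of `y`
  have near : ∀ y ∈ V, ∀ W : Set X, IsOpen W → (∀ x ∈ U, F x = y → x ∈ W) →
      ∀ᶠ z in 𝓝 y, ∀ x ∈ U, F x = z → x ∈ W := fun y hy W hW hyW => by
    obtain ⟨L, hL, K, hKU, hK, hLK⟩ := hproper y hy
    have hc : IsClosed (F '' (K \ W)) :=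
      ((hK.diff hW).image_of_continuousOn (hF.mono (sdiff_subset.trans hKU))).isClosed
    have hn : y ∉ F '' (K \ W) := by
      rintro ⟨x, hx, rfl⟩
      exact hx.2 (hyW x (hKU hx.1) rfl)
    filter_upwards [hL, hc.isOpen_compl.mem_nhds hn] with z hzL hz x hx hxz
    by_contra hxW
    exact hz ⟨x, ⟨hLK x hx (hxz ▸ hzL), hxW⟩, hxz⟩
  have cover : ∀ x ∈ U, ∀ W ∈ 𝓝 x, ∀ᶠ z in 𝓝 (F x), ∃ x' ∈ W ∩ U, F x' = z := fun x hx W hW => by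
    rw [← hopen x hx]
    exact Filter.image_mem_map (Filter.inter_mem hW (hU.mem_nhds hx))
  set P : Set Y := {y | ∃! x, x ∈ U ∧ F x = y} with hP
  have hPo : IsOpen (V ∩ P) := by
    rw [isOpen_iff_mem_nhds]
    rintro y ⟨hy, x, ⟨hx, rfl⟩, hu⟩
    obtain ⟨W, hW, hWi⟩ := hinj x hx
    obtain ⟨W', hW', hW'o, hxW'⟩ := mem_nhds_iff.1 hW
    filter_upwards [hV.mem_nhds hy, cover x hx W' (hW'o.mem_nhds hxW'),
      near _ hy W' hW'o (fun x' hx' he => by rw [hu x' ⟨hx', he⟩]; exact hxW')] with z hz hz1 hz2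
    obtain ⟨x', hx', rfl⟩ := hz1
    exact ⟨hz, x', ⟨hx'.2, rfl⟩, fun x'' hx'' =>
      hWi (hW' (hz2 x'' hx''.1 hx''.2)) (hW' hx'.1) hx''.2⟩
  -- Two distinct preimages persist because the map is open; an empty fibre stays empty by
  -- properness.
  have hPc : IsOpen (V ∩ Pᶜ) := by
    rw [isOpen_iff_mem_nhds]
    rintro y ⟨hy, hyP⟩
    by_cases he : ∃ x ∈ U, F x = y
    · obtain ⟨x, hx, rfl⟩ := he
      have : ∃ x' ∈ U, F x' = F x ∧ x' ≠ x := by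
        by_contra! hcon
        exact hyP ⟨x, ⟨hx, rfl⟩, fun x' hx' => hcon x' hx'.1 hx'.2⟩
      obtain ⟨x', hx', hxx, hne⟩ := this
      obtain ⟨W, W', hW, hW', hxW, hxW', hd⟩ := t2_separation hne
      have c1 := cover x' hx' W (hW.mem_nhds hxW)
      rw [hxx] at c1
      filter_upwards [hV.mem_nhds hy, cover x hx W' (hW'.mem_nhds hxW'), c1] with z hz h1 h2
      refine ⟨hz, fun ⟨w, _, hw⟩ => ?_⟩
      obtain ⟨a, ha, haz⟩ := h1
      obtain ⟨b, hb, hbz⟩ := h2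
      have : a = b := (hw a ⟨ha.2, haz⟩).trans (hw b ⟨hb.2, hbz⟩).symm
      exact disjoint_left.1 hd hb.1 (this ▸ ha.1)
    · push Not at he
      filter_upwards [hV.mem_nhds hy, near y hy ∅ isOpen_empty fun x hx h => he x hx h] with z hz hz1
      exact ⟨hz, fun ⟨x, hx, _⟩ => hz1 x hx.1 hx.2⟩
  by_contra hyP
  obtain ⟨z, -, hz1, hz2⟩ := hVc (V ∩ P) (V ∩ Pᶜ) hPo hPc
    (fun z hz => by by_cases h : z ∈ P; exacts [Or.inl ⟨hz, h⟩, Or.inr ⟨hz, h⟩])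
    ⟨y₀, hy₀, hy₀, hx₀⟩ ⟨y, hy, hy, hyP⟩
  exact hz2.2 hz1.2

/-! ### Bijectivity of `midExp` -/

/-- The half of the domain of `midExp` where `sin θ > 0`. -/
def midUpper : Set (ℝ × ℝ × ℝ) := {m | m.1 ∈ Ioo 0 Real.pi ∧ BeforeZero (param m) m.2.2}

theorem midUpper_subset : midUpper ⊆ midDomain := fun _ hm =>
  ⟨(Real.sin_pos_of_mem_Ioo hm.1).ne', hm.2⟩

theorem isOpen_midUpper : IsOpen midUpper := by
  have : midUpper = midDomain ∩ Prod.fst ⁻¹' Ioo 0 Real.pi :=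
    Subset.antisymm (fun m hm => ⟨midUpper_subset hm, hm.1⟩) (fun m hm => ⟨hm.2, hm.1.2⟩)
  rw [this]
  exact isOpen_midDomain.inter (isOpen_Ioo.preimage continuous_fst)

/-- A limit of trajectories before the first zero of `sn` is one. -/
theorem beforeZero_of_forall_nonneg {h t : ℝ} (hh : 0 < h) (ht : 0 ≤ t) (hS : 0 < sn h t)
    (hnn : ∀ r ∈ Icc (0 : ℝ) 1, 0 ≤ sn h (r * t)) : BeforeZero h t := by
  have ht0 : 0 < t := ht.lt_of_ne fun h0 => by rw [← h0, sn_zero hh] at hS; exact hS.false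
  have hnn' : ∀ s ∈ Icc 0 t, 0 ≤ sn h s := fun s hs => by
    have := hnn (s / t) ⟨div_nonneg hs.1 ht, (div_le_one ht0).2 hs.2⟩
    rwa [div_mul_cancel₀ _ ht0.ne'] at this
  refine ⟨hh, ht0, fun s hs => (hnn' s (Ioc_subset_Icc_self hs)).lt_of_ne fun h0 => ?_⟩
  rcases hs.2.eq_or_lt with rfl | hst
  · exact hS.ne h0
  -- An interior zero of the nonnegative `sn` would be a minimum, but there `cn ^ 2 = dn ^ 2 = 1`,
  -- so the derivative does not vanish.
  have hmin : IsLocalMin (sn h) s := by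
    filter_upwards [Icc_mem_nhds hs.1 hst] with r hr
    rw [← h0]
    exact hnn' r hr
  have hd := hmin.hasDerivAt_eq_zero (hasDerivAt_sn hh s)
  have e1 := sn_sq_add_cn_sq hh s
  have e2 := dn_sq_add_sn_sq hh s
  rw [← h0] at e1 e2
  rcases mul_eq_zero.1 hd with h1 | h1 <;> simp [h1] at e1 e2

theorem sn_one_strictMono : StrictMono (sn 1) :=
  strictMono_of_hasDerivAt_pos (fun t => hasDerivAt_sn one_pos t) fun t =>
    mul_pos (cn_pos_of_one_le one_pos le_rfl t) (dn_pos_of_le_one one_pos le_rfl t)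

theorem continuousOn_midExp : ContinuousOn midExp midUpper := fun _ hm =>
  (contDiffAt_midExp hm.2.1).continuousAt.continuousWithinAt

/-- The value `1` would need `sin θ = 1` and `sn = 1`; then `h ≥ 1`, so `cn > 0`, contradicting `cn
^ 2 = 0`. -/
theorem midExp_mem {m : ℝ × ℝ × ℝ} (hm : m ∈ midUpper) : (midExp m).2.2 ∈ Ioo (0 : ℝ) 1 := by
  have hu := Real.sin_pos_of_mem_Ioo hm.1
  have hS := hm.2.sn_pos'
  have hS1 := (abs_le.1 (abs_sn_le_one hm.2.1 m.2.2)).2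
  have hu1 := Real.sin_le_one m.1
  refine ⟨mul_pos hu hS, lt_of_not_ge fun hle => ?_⟩
  change 1 ≤ Real.sin m.1 * sn (param m) m.2.2 at hle
  have e1 : Real.sin m.1 = 1 := le_antisymm hu1 (hle.trans (mul_le_of_le_one_right hu.le hS1))
  have e2 : sn (param m) m.2.2 = 1 := le_antisymm hS1 (hle.trans (mul_le_of_le_one_left hS.le hu1))
  have e3 := sn_sq_add_cn_sq hm.2.1 m.2.2
  have hc := cn_pos_of_one_le hm.2.1 (by rw [param, e1]; linarith [sq_nonneg m.2.1]) m.2.2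
  rw [e2] at e3
  nlinarith

/-- The compact set is cut out of a box by closed conditions: `sn ≥ 0` along the trajectory replaces
strict positivity, which `beforeZero_of_forall_nonneg` recovers. The box uses `w₀ ^ 2 * h ≤ 1` for
`p` and `exists_time_bound` for the time. -/
theorem midExp_proper {A w₀ w₁ : ℝ} (hw₀ : 0 < w₀) (hw₁ : w₁ < 1) :
    ∃ K ⊆ midUpper, IsCompact K ∧ ∀ m ∈ midUpper,
      midExp m ∈ Icc (-A) A ×ˢ Icc (-A) A ×ˢ Icc w₀ w₁ → m ∈ K := by
  obtain ⟨T, hT⟩ := exists_time_bound A hw₀ hw₁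
  set B : Set (ℝ × ℝ × ℝ) := (Icc 0 Real.pi ×ˢ Icc (-(1 / w₀)) (1 / w₀) ×ˢ Icc 0 T) ∩
    {m | w₀ ^ 2 ≤ param m} with hB
  have hBc : IsCompact B := (isCompact_Icc.prod (isCompact_Icc.prod isCompact_Icc)).inter_right
    (isClosed_le continuous_const contDiff_param.continuous)
  have hpos : ∀ m ∈ B, 0 < param m := fun m hm => (pow_pos hw₀ 2).trans_le hm.2
  set K : Set (ℝ × ℝ × ℝ) := B ∩ {m | w₀ ≤ (midExp m).2.2 ∧
    ∀ r ∈ Icc (0 : ℝ) 1, 0 ≤ sn (param m) (r * m.2.2)} with hK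
  have hKc : IsCompact K := by
    have h1 : ContinuousOn (fun m => (midExp m).2.2) B := fun m hm =>
      (contDiffAt_midExp (hpos m hm)).continuousAt.continuousWithinAt.snd.snd
    have h2 : ∀ r : ℝ, ContinuousOn (fun m => sn (param m) (r * m.2.2)) B := fun r m hm => by
      refine ContinuousAt.continuousWithinAt ?_
      exact ContinuousAt.comp (g := fun q : ℝ × ℝ => sn q.1 q.2)
        (f := fun m : ℝ × ℝ × ℝ => (param m, r * m.2.2))
        (contDiffAt_sn (hpos m hm) (r * m.2.2)).continuousAt
        (contDiff_param.continuous.prodMk (by fun_prop)).continuousAt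
    have h3 : K = (B ∩ (fun m => (midExp m).2.2) ⁻¹' Ici w₀) ∩
        ⋂ r : Icc (0 : ℝ) 1, B ∩ (fun m => sn (param m) (r * m.2.2)) ⁻¹' Ici 0 := by
      ext m
      simp only [hK, mem_inter_iff, mem_ofPred_eq, mem_iInter, mem_preimage, mem_Ici, Subtype.forall]
      constructor
      · rintro ⟨a, b, c⟩
        exact ⟨⟨a, b⟩, fun r hr => ⟨a, c r hr⟩⟩
      · rintro ⟨⟨a, b⟩, c⟩
        exact ⟨a, b, fun r hr => (c r hr).2⟩
    rw [h3]
    refine (hBc.of_isClosed_subset (h1.preimage_isClosed_of_isClosed hBc.isClosed isClosed_Ici)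
      inter_subset_left).inter_right (isClosed_iInter fun r => ?_)
    exact (h2 r).preimage_isClosed_of_isClosed hBc.isClosed isClosed_Ici
  refine ⟨K, ?_, hKc, ?_⟩
  · rintro m ⟨hm, hw, hr⟩
    have hu0 := Real.sin_nonneg_of_mem_Icc hm.1.1
    have hmul : 0 < Real.sin m.1 * sn (param m) m.2.2 := hw₀.trans_le hw
    have hS := pos_of_mul_pos_right hmul hu0
    have hu : 0 < Real.sin m.1 := pos_of_mul_pos_left hmul hS.le
    refine ⟨⟨hm.1.1.1.lt_of_ne fun h0 => ?_, hm.1.1.2.lt_of_ne fun h0 => ?_⟩,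
      beforeZero_of_forall_nonneg (hpos m hm) hm.1.2.2.1 hS hr⟩
    · rw [← h0, Real.sin_zero] at hu; exact hu.false
    · rw [h0, Real.sin_pi] at hu; exact hu.false
  · rintro m hm ⟨ha, hb, hw⟩
    obtain ⟨hθ, H⟩ := hm
    have hu := Real.sin_pos_of_mem_Ioo hθ
    have hu1 := Real.sin_le_one m.1
    have hS := H.sn_pos'
    have hS1 := (abs_le.1 (abs_sn_le_one H.1 m.2.2)).2
    have hw' : w₀ ≤ Real.sin m.1 * sn (param m) m.2.2 := hw.1
    have hSw : w₀ ≤ sn (param m) m.2.2 := hw'.trans (mul_le_of_le_one_left hS.le hu1)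
    have hle := H.mul_param_le_one hw₀.le hSw
    have huw : w₀ ≤ Real.sin m.1 := hw'.trans (mul_le_of_le_one_right hu.le hS1)
    refine ⟨⟨⟨Ioo_subset_Icc_self hθ, ?_, H.2.le, ?_⟩, ?_⟩, hw.1, fun r hr => ?_⟩
    · refine abs_le.1 ?_
      rw [le_div_iff₀ hw₀, ← sq_le_one_iff₀ (by positivity), mul_pow, sq_abs]
      refine le_trans ?_ hle
      rw [param]
      nlinarith [mul_nonneg (sq_nonneg w₀) (sq_nonneg (Real.sin m.1))]
    · exact hT (param m) (Real.sin m.1) (Real.cos m.1) m.2.1 m.2.2 H rfl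
        (Real.sin_sq_add_cos_sq _) hu (abs_le.2 ha) (abs_le.2 hb) hw.1 hw.2
    · change w₀ ^ 2 ≤ _
      rw [param]
      linarith [sq_nonneg m.2.1, pow_le_pow_left₀ hw₀.le huw 2]
    · exact H.sn_nonneg ⟨mul_nonneg hr.1 H.2.le, mul_le_of_le_one_left H.2.le hr.2⟩

/-- The one-point fibre is over the image of `(π / 2, 0, 1)`: zero first and second coordinates
force `θ = π / 2` and `p = 0`, hence `h = 1`, and `sn 1` is injective. -/
theorem existsUnique_midExp {y : ℝ × ℝ × ℝ} (hy : y.2.2 ∈ Ioo (0 : ℝ) 1) :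
    ∃! m, m ∈ midUpper ∧ midExp m = y := by
  have strict : ∀ m ∈ midUpper, ∃ e : (ℝ × ℝ × ℝ) ≃L[ℝ] (ℝ × ℝ × ℝ),
      HasStrictFDerivAt midExp (e : (ℝ × ℝ × ℝ) →L[ℝ] _) m := fun m hm => by
    obtain ⟨e, he⟩ := exists_equiv_hasFDerivAt_midExp (midUpper_subset hm)
    refine ⟨e, ?_⟩
    have := (contDiffAt_midExp hm.2.1).hasStrictFDerivAt (by simp)
    rwa [he.fderiv] at this
  have hw : (midExp (Real.pi / 2, 0, 1)).2.2 = sn 1 1 := by simp [midExp, param]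
  have hone : BeforeZero 1 1 := ⟨one_pos, one_pos, fun s hs => by
    rw [← sn_zero one_pos]; exact sn_one_strictMono hs.1⟩
  have hmem : ((Real.pi / 2, 0, 1) : ℝ × ℝ × ℝ) ∈ midUpper := by
    refine ⟨⟨by positivity, by linarith [Real.pi_pos]⟩, ?_⟩
    simpa [param] using hone
  refine existsUnique_of_proper (F := midExp) (U := midUpper) (V := univ ×ˢ univ ×ˢ Ioo (0 : ℝ) 1)
    (y₀ := midExp (Real.pi / 2, 0, 1))
    isOpen_midUpper (isOpen_univ.prod (isOpen_univ.prod isOpen_Ioo))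
    (isPreconnected_univ.prod (isPreconnected_univ.prod isPreconnected_Ioo)) continuousOn_midExp
    (fun m hm => ?_) (fun m hm => ?_) (fun y hy => ?_) ⟨trivial, trivial, midExp_mem hmem⟩
    ⟨_, ⟨hmem, rfl⟩, ?_⟩ ⟨trivial, trivial, hy⟩
  · obtain ⟨e, he⟩ := strict m hm
    exact he.map_nhds_eq_of_equiv
  · obtain ⟨e, he⟩ := strict m hm
    refine ⟨(he.toOpenPartialHomeomorph midExp).source, ?_, ?_⟩
    · exact (he.toOpenPartialHomeomorph midExp).open_source.mem_nhds
        he.mem_toOpenPartialHomeomorph_source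
    · exact (he.toOpenPartialHomeomorph midExp).injOn
  · obtain ⟨-, -, h0, h1⟩ := hy
    obtain ⟨a, b, w⟩ := y
    obtain ⟨w₀, hw₀, hw₀'⟩ := exists_between h0
    obtain ⟨w₁, hw₁', hw₁⟩ := exists_between h1
    obtain ⟨K, hKU, hK, hKm⟩ := midExp_proper (A := max |a| |b| + 1) hw₀ hw₁
    refine ⟨_, prod_mem_nhds (Icc_mem_nhds ?_ ?_) (prod_mem_nhds (Icc_mem_nhds ?_ ?_)
      (Icc_mem_nhds hw₀' hw₁')), K, hKU, hK, hKm⟩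
    · linarith [neg_abs_le a, le_max_left |a| |b|]
    · linarith [le_abs_self a, le_max_left |a| |b|]
    · linarith [neg_abs_le b, le_max_right |a| |b|]
    · linarith [le_abs_self b, le_max_right |a| |b|]
  · rintro ⟨θ, p, τ⟩ ⟨⟨hθ, H⟩, he⟩
    simp only [midExp, Prod.mk.injEq, Real.cos_pi_div_two, zero_mul, Real.sin_pi_div_two] at he
    obtain ⟨e1, e2, e3⟩ := he
    have hp : p = 0 := (mul_eq_zero.1 e2).resolve_right H.eg_pos.ne'
    have hc : Real.cos θ = 0 := (mul_eq_zero.1 e1).resolve_right H.ef_pos.ne'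
    have hθ' : θ = Real.pi / 2 := by
      refine Real.injOn_cos (Ioo_subset_Icc_self hθ) ⟨by positivity, by linarith [Real.pi_pos]⟩ ?_
      rw [hc, Real.cos_pi_div_two]
    subst hp hθ'
    simp only [param, Real.sin_pi_div_two] at e3
    norm_num at e3
    rw [sn_one_strictMono.injective e3]

end SH2
end

noncomputable section

namespace SH2

/-! ### The inverse of `midExp` -/

open Classical in
/-- The inverse of `midExp` on `midUpper`. -/
def midLogUpper (y : ℝ × ℝ × ℝ) : ℝ × ℝ × ℝ :=
  if hy : y.2.2 ∈ Ioo (0 : ℝ) 1 then (existsUnique_midExp hy).choose else 0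

theorem midLogUpper_mem {y : ℝ × ℝ × ℝ} (hy : y.2.2 ∈ Ioo (0 : ℝ) 1) :
    midLogUpper y ∈ midUpper ∧ midExp (midLogUpper y) = y := by
  rw [midLogUpper, dif_pos hy]
  exact (existsUnique_midExp hy).choose_spec.1

theorem midLogUpper_midExp {m : ℝ × ℝ × ℝ} (hm : m ∈ midUpper) : midLogUpper (midExp m) = m :=
  (existsUnique_midExp (midExp_mem hm)).unique (midLogUpper_mem (midExp_mem hm)) ⟨hm, rfl⟩

/-- Uniqueness of preimages in `midUpper` makes the global inverse agree with the local inverse near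
each point. -/
theorem contDiffAt_midLogUpper {y : ℝ × ℝ × ℝ} (hy : y.2.2 ∈ Ioo (0 : ℝ) 1) :
    ContDiffAt ℝ ∞ midLogUpper y := by
  obtain ⟨hm, he⟩ := midLogUpper_mem hy
  generalize midLogUpper y = m at hm he
  subst he
  obtain ⟨e, hd⟩ := exists_equiv_hasFDerivAt_midExp (midUpper_subset hm)
  have hc := contDiffAt_midExp hm.2.1
  have hs := hc.hasStrictFDerivAt' hd (by simp)
  refine (hc.to_localInverse hd (by simp)).congr_of_eventuallyEq ?_
  have h1 := hs.eventually_right_inverse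
  have h2 := hs.localInverse_continuousAt
  have h3 : ∀ᶠ z in 𝓝 (midExp m), hs.localInverse midExp e m z ∈ midUpper := by
    refine h2.eventually_mem ?_
    rw [hs.localInverse_apply_image]
    exact isOpen_midUpper.mem_nhds hm
  filter_upwards [h1, h3] with z hz1 hz2
  change midLogUpper z = hs.localInverse midExp e m z
  nth_rw 1 [← hz1]
  exact midLogUpper_midExp hz2

/-- The symmetry `(θ, p) ↦ (-θ, -p)` of the pendulum. -/
def midFlip (m : ℝ × ℝ × ℝ) : ℝ × ℝ × ℝ := (-m.1, -m.2.1, m.2.2)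

/-- The symmetry of the target that corresponds to `midFlip`. -/
def targetFlip (y : ℝ × ℝ × ℝ) : ℝ × ℝ × ℝ := (y.1, -y.2.1, -y.2.2)

theorem midExp_midFlip (m : ℝ × ℝ × ℝ) : midExp (midFlip m) = targetFlip (midExp m) := by
  simp [midExp, midFlip, targetFlip, param]

theorem midFlip_mem {m : ℝ × ℝ × ℝ} (hm : m ∈ midDomain) : midFlip m ∈ midDomain := by
  simpa [midDomain, midFlip, param] using hm

/-- The inverse of `midExp`. -/
def midLog (y : ℝ × ℝ × ℝ) : ℝ × ℝ × ℝ :=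
  if 0 < y.2.2 then midLogUpper y else midFlip (midLogUpper (targetFlip y))

theorem targetFlip_mem {y : ℝ × ℝ × ℝ} (h1 : |y.2.2| < 1) (hneg : y.2.2 < 0) :
    (targetFlip y).2.2 ∈ Ioo (0 : ℝ) 1 :=
  ⟨neg_pos.2 hneg, neg_lt.1 (abs_lt.1 h1).1⟩

theorem midLog_mem {y : ℝ × ℝ × ℝ} (h0 : y.2.2 ≠ 0) (h1 : |y.2.2| < 1) :
    midLog y ∈ midDomain ∧ midExp (midLog y) = y := by
  rw [midLog]
  rcases h0.lt_or_gt with hneg | hpos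
  · rw [if_neg hneg.not_gt]
    obtain ⟨e1, e2⟩ := midLogUpper_mem (targetFlip_mem h1 hneg)
    refine ⟨midFlip_mem (midUpper_subset e1), ?_⟩
    rw [midExp_midFlip, e2]
    simp [targetFlip]
  · rw [if_pos hpos]
    obtain ⟨e1, e2⟩ := midLogUpper_mem (y := y) ⟨hpos, (abs_lt.1 h1).2⟩
    exact ⟨midUpper_subset e1, e2⟩

theorem contDiffAt_midLog {y : ℝ × ℝ × ℝ} (h0 : y.2.2 ≠ 0) (h1 : |y.2.2| < 1) :
    ContDiffAt ℝ ∞ midLog y := by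
  have hc : ContinuousAt (fun y : ℝ × ℝ × ℝ => y.2.2) y := by fun_prop
  rcases h0.lt_or_gt with hneg | hpos
  · have hf : ContDiffAt ℝ ∞ targetFlip y := by unfold targetFlip; fun_prop
    have hg : ContDiff ℝ ∞ midFlip := by unfold midFlip; fun_prop
    have h2 := hg.contDiffAt.comp y
      ((contDiffAt_midLogUpper (targetFlip_mem h1 hneg)).comp y hf)
    refine h2.congr_of_eventuallyEq ?_
    filter_upwards [hc.tendsto.eventually_lt_const hneg] with z hz
    exact if_neg hz.not_gt
  · refine (contDiffAt_midLogUpper (y := y) ⟨hpos, (abs_lt.1 h1).2⟩).congr_of_eventuallyEq ?_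
    filter_upwards [hc.tendsto.eventually_const_lt hpos] with z hz
    exact if_pos hz

/-- Reduction of the angle modulo `2π`: positivity of the sine leaves only `(0, π)`. -/
theorem exists_add_mem_midUpper {m : ℝ × ℝ × ℝ} (hm : m ∈ midDomain) (hs : 0 < Real.sin m.1) :
    ∃ k : ℤ, (m.1 + k * (2 * Real.pi), m.2) ∈ midUpper ∧
      midExp (m.1 + k * (2 * Real.pi), m.2) = midExp m := by
  have hθ := toIcoMod_mem_Ico Real.two_pi_pos 0 m.1
  have e : toIcoMod Real.two_pi_pos 0 m.1 =
      m.1 + ((-toIcoDiv Real.two_pi_pos 0 m.1 : ℤ) : ℝ) * (2 * Real.pi) := by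
    rw [toIcoMod]
    push_cast
    rw [zsmul_eq_mul]
    ring
  rw [e, zero_add] at hθ
  generalize -toIcoDiv Real.two_pi_pos 0 m.1 = k at hθ
  have h1 := Real.sin_add_int_mul_two_pi m.1 k
  have h2 := Real.cos_add_int_mul_two_pi m.1 k
  refine ⟨k, ⟨⟨?_, ?_⟩, ?_⟩, ?_⟩
  · refine hθ.1.lt_of_ne fun h0 => ?_
    rw [← h1, ← h0, Real.sin_zero] at hs
    exact hs.false
  · by_contra! hle
    have := Real.sin_nonneg_of_nonneg_of_le_pi (x := m.1 + k * (2 * Real.pi) - Real.pi)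
      (by linarith) (by linarith [hθ.2])
    rw [Real.sin_sub_pi, h1] at this
    linarith
  · simpa only [param, h1] using hm.2
  · simp only [midExp, param, h1, h2]

theorem midLog_midExp {m : ℝ × ℝ × ℝ} (hm : m ∈ midDomain) :
    ∃ k : ℤ, midLog (midExp m) = (m.1 + k * (2 * Real.pi), m.2) := by
  have hS := hm.2.sn_pos'
  rcases hm.1.lt_or_gt with hneg | hpos
  · have hf : 0 < Real.sin (midFlip m).1 := by
      simpa [midFlip] using hneg
    obtain ⟨k, hk, hk'⟩ := exists_add_mem_midUpper (midFlip_mem hm) hf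
    have hw : (midExp m).2.2 < 0 := mul_neg_of_neg_of_pos hneg hS
    refine ⟨-k, ?_⟩
    rw [midLog, if_neg hw.not_gt, ← midExp_midFlip, ← hk', midLogUpper_midExp hk]
    simp only [midFlip, neg_neg, Prod.mk.injEq, and_true]
    push_cast
    ring
  · obtain ⟨k, hk, hk'⟩ := exists_add_mem_midUpper hm hpos
    have hw : 0 < (midExp m).2.2 := mul_pos hpos hS
    refine ⟨k, ?_⟩
    rw [midLog, if_pos hw, ← hk', midLogUpper_midExp hk]

theorem midExp_bounds {m : ℝ × ℝ × ℝ} (hm : m ∈ midDomain) :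
    (midExp m).2.2 ≠ 0 ∧ |(midExp m).2.2| < 1 := by
  have hS := hm.2.sn_pos'
  refine ⟨mul_ne_zero hm.1 hS.ne', ?_⟩
  rcases hm.1.lt_or_gt with hneg | hpos
  · have hf : 0 < Real.sin (midFlip m).1 := by
      simpa [midFlip] using hneg
    obtain ⟨k, hk, hk'⟩ := exists_add_mem_midUpper (midFlip_mem hm) hf
    have := midExp_mem hk
    rw [hk', midExp_midFlip] at this
    have h1 : 0 < -(midExp m).2.2 := this.1
    have h2 : -(midExp m).2.2 < 1 := this.2
    exact abs_lt.2 ⟨by linarith, by linarith⟩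
  · obtain ⟨k, hk, hk'⟩ := exists_add_mem_midUpper hm hpos
    have := midExp_mem hk
    rw [hk'] at this
    exact abs_lt.2 ⟨by linarith [this.1], this.2⟩

end SH2
end

noncomputable section

namespace SH2

/-! ### Extremals in terms of their midpoints -/

/-- The equations of the pendulum for the sine and the cosine of the half-angle and half the
velocity. -/
structure HalfPendulum (a b c : ℝ → ℝ) : Prop where
  deriv_sin : ∀ s, HasDerivAt a (b s * c s) s
  deriv_cos : ∀ s, HasDerivAt b (-(a s * c s)) s
  deriv_vel : ∀ s, HasDerivAt c (-(a s * b s)) s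

namespace HalfPendulum

variable {a b c a' b' c' : ℝ → ℝ}

theorem unique (H : HalfPendulum a b c) (H' : HalfPendulum a' b' c') (h1 : a 0 = a' 0)
    (h2 : b 0 = b' 0) (h3 : c 0 = c' 0) : a = a' ∧ b = b' ∧ c = c' := by
  let V : ℝ × ℝ × ℝ → ℝ × ℝ × ℝ := fun q => (q.2.1 * q.2.2, -(q.1 * q.2.2), -(q.1 * q.2.1))
  have hV : ContDiff ℝ 1 V := by fun_prop
  have hc : ∀ {a b c : ℝ → ℝ}, HalfPendulum a b c →
      IsMIntegralCurve (I := 𝓘(ℝ, ℝ × ℝ × ℝ)) (fun s => (a s, b s, c s)) (fun y => V y) :=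
    fun {a b c} H s => hasMFDerivAt_iff_hasFDerivAt.2
      ((H.deriv_sin s).prodMk ((H.deriv_cos s).prodMk (H.deriv_vel s))).hasFDerivAt
  have key := isMIntegralCurve_Ioo_eq_of_contMDiff_boundaryless (t₀ := 0)
    (I := 𝓘(ℝ, ℝ × ℝ × ℝ)) (v := fun y => V y)
    (contMDiff_vectorSpace_iff_contDiff.2 hV) (hc H) (hc H') (by simp [h1, h2, h3])
  refine ⟨?_, ?_, ?_⟩ <;> funext s
  · exact congrArg Prod.fst (congrFun key s)
  · exact congrArg (fun q => q.2.1) (congrFun key s)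
  · exact congrArg (fun q => q.2.2) (congrFun key s)

theorem comp_const_add (H : HalfPendulum a b c) (r : ℝ) :
    HalfPendulum (fun s => a (r + s)) (fun s => b (r + s)) (fun s => c (r + s)) :=
  ⟨fun s => (H.1 (r + s)).comp_const_add r s, fun s => (H.2 (r + s)).comp_const_add r s,
    fun s => (H.3 (r + s)).comp_const_add r s⟩

theorem comp_const_sub (H : HalfPendulum a b c) (r : ℝ) :
    HalfPendulum (fun s => a (r - s)) (fun s => b (r - s)) (fun s => -c (r - s)) :=
  ⟨fun s => ((H.1 (r - s)).comp_const_sub r s).congr_deriv (by ring),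
    fun s => ((H.2 (r - s)).comp_const_sub r s).congr_deriv (by ring),
    fun s => ((H.3 (r - s)).comp_const_sub r s).neg.congr_deriv (by ring)⟩

theorem neg (H : HalfPendulum a b c) :
    HalfPendulum (fun s => -a s) b (fun s => -c s) :=
  ⟨fun s => (H.1 s).neg.congr_deriv (by ring), fun s => (H.2 s).congr_deriv (by ring),
    fun s => (H.3 s).neg.congr_deriv (by ring)⟩

end HalfPendulum

/-- This keeps the denominators of the addition formulas nonzero. Equality would force `u ^ 2 = 1`,
hence `h ≥ 1` and `cn > 0`, against `sn ^ 2 = 1`. -/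
theorem abs_mul_sn_lt_one {h u v p : ℝ} (hh : 0 < h) (hhe : h = p ^ 2 + u ^ 2)
    (huv : u ^ 2 + v ^ 2 = 1) (s : ℝ) : |u * sn h s| < 1 := by
  have hu : |u| ≤ 1 := (sq_le_one_iff_abs_le_one u).1 (by linarith [sq_nonneg v])
  have hS := abs_sn_le_one hh s
  rw [abs_mul]
  by_contra! hle
  have e1 : |u| = 1 := le_antisymm hu (hle.trans (mul_le_of_le_one_right (abs_nonneg _) hS))
  have e2 : |sn h s| = 1 := le_antisymm hS (hle.trans (mul_le_of_le_one_left (abs_nonneg _) hu))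
  have e3 := sn_sq_add_cn_sq hh s
  have e4 : u ^ 2 = 1 := by rw [← sq_abs, e1, one_pow]
  have hc := cn_pos_of_one_le hh (by linarith [sq_nonneg p]) s
  rw [← sq_abs (sn h s), e2] at e3
  have := pow_pos hc 2
  linarith

/-- The addition formulas for the solutions of the pendulum equation. -/
theorem halfPendulum_div {h u v p : ℝ} (hh : 0 < h) (hhe : h = p ^ 2 + u ^ 2)
    (huv : u ^ 2 + v ^ 2 = 1) : HalfPendulum
      (fun s => (u * cn h s * dn h s + v * p * sn h s) / (1 - u ^ 2 * sn h s ^ 2))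
      (fun s => (v * dn h s - u * p * sn h s * cn h s) / (1 - u ^ 2 * sn h s ^ 2))
      (fun s => (p * cn h s - u * v * sn h s * dn h s) / (1 - u ^ 2 * sn h s ^ 2)) := by
  have hS := hasDerivAt_sn hh
  have hC := hasDerivAt_cn hh
  have hD := hasDerivAt_dn hh
  have hQ : ∀ s, 1 - u ^ 2 * sn h s ^ 2 ≠ 0 := fun s => by
    have := (sq_lt_one_iff_abs_lt_one _).2 (abs_mul_sn_lt_one hh hhe huv s)
    rw [mul_pow] at this
    linarith
  have dQ : ∀ s, HasDerivAt (fun s => 1 - u ^ 2 * sn h s ^ 2)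
      (-(2 * u ^ 2 * sn h s * (cn h s * dn h s))) s := fun s => by
    refine ((((hS s).pow 2).const_mul (u ^ 2)).const_sub 1).congr_deriv ?_
    simp
    ring
  have d1 : ∀ s, HasDerivAt (fun s => u * cn h s * dn h s + v * p * sn h s)
      (u * (-(sn h s * dn h s * dn h s) - h * sn h s * cn h s * cn h s) +
        v * p * (cn h s * dn h s)) s := fun s => by
    refine ((((hC s).const_mul u).mul (hD s)).add ((hS s).const_mul (v * p))).congr_deriv ?_
    ring
  have d2 : ∀ s, HasDerivAt (fun s => v * dn h s - u * p * sn h s * cn h s)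
      (-(v * h * sn h s * cn h s) -
        u * p * (cn h s * cn h s * dn h s - sn h s * sn h s * dn h s)) s := fun s => by
    refine (((hD s).const_mul v).sub (((hS s).const_mul (u * p)).mul (hC s))).congr_deriv ?_
    ring
  have d3 : ∀ s, HasDerivAt (fun s => p * cn h s - u * v * sn h s * dn h s)
      (-(p * sn h s * dn h s) -
        u * v * (cn h s * dn h s * dn h s - h * sn h s * sn h s * cn h s)) s := fun s => by
    refine (((hC s).const_mul p).sub (((hS s).const_mul (u * v)).mul (hD s))).congr_deriv ?_
    ring
  refine ⟨fun s => ((d1 s).div (dQ s) (hQ s)).congr_deriv ?_,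
    fun s => ((d2 s).div (dQ s) (hQ s)).congr_deriv ?_,
    fun s => ((d3 s).div (dQ s) (hQ s)).congr_deriv ?_⟩ <;>
  · have hQs := hQ s
    have i1 := sn_sq_add_cn_sq hh s
    have i2 := dn_sq_add_sn_sq hh s
    clear d1 d2 d3 dQ hQ hS hC hD
    generalize sn h s = S at *
    generalize cn h s = C at *
    generalize dn h s = D at *
    try rw [div_mul_div_comm]
    try rw [← neg_div]
    rw [← sq (1 - u ^ 2 * S ^ 2), div_left_inj' (pow_ne_zero 2 hQs)]
    -- The alternatives are the sine, cosine and velocity equations, reduced to polynomial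
    -- identities modulo the relations among `S`, `C`, `D`, `u`, `v`, `p`.
    first
    | linear_combination (- u * S * C ^ 2 + u ^ 3 * S ^ 3 - u ^ 3 * S ^ 3 * C ^ 2 - u ^ 3 * S ^ 5) *
        hhe + (u * S * D ^ 2) * huv + (- u ^ 3 * S + 2 * u ^ 3 * S * C ^ 2 + u ^ 3 * S ^ 3) * i2 +
        (u ^ 3 * S - u ^ 3 * p ^ 2 * S ^ 3 - u ^ 5 * S ^ 3) * i1
    | linear_combination (- v * S * C) * hhe + (- u * p * S ^ 2 * D) * huv +
        (u ^ 2 * v * S * C) * i2 + (- u ^ 3 * p * S ^ 2 * D) * i1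
    | linear_combination (u * v * S ^ 2 * C) * hhe + (p * S * D) * huv +
        (- u ^ 3 * v * S ^ 2 * C) * i2 + (u ^ 2 * p * S * D) * i1

theorem HalfPendulum.eq_div {a b c : ℝ → ℝ} (H : HalfPendulum a b c) {h u v p : ℝ} (hh : 0 < h)
    (hhe : h = p ^ 2 + u ^ 2) (huv : u ^ 2 + v ^ 2 = 1) (ha : a 0 = u) (hb : b 0 = v)
    (hc : c 0 = p) (s : ℝ) :
    a s * (1 - u ^ 2 * sn h s ^ 2) = u * cn h s * dn h s + v * p * sn h s ∧
    b s * (1 - u ^ 2 * sn h s ^ 2) = v * dn h s - u * p * sn h s * cn h s := by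
  obtain ⟨e1, e2, -⟩ := H.unique (halfPendulum_div hh hhe huv)
    (by simp [sn_zero hh, cn_zero hh, dn_zero hh, ha])
    (by simp [sn_zero hh, dn_zero hh, hb]) (by simp [sn_zero hh, cn_zero hh, hc])
  have hQ : 1 - u ^ 2 * sn h s ^ 2 ≠ 0 := by
    have := (sq_lt_one_iff_abs_lt_one _).2 (abs_mul_sn_lt_one hh hhe huv s)
    rw [mul_pow] at this
    linarith
  rw [e1, e2]
  exact ⟨div_mul_cancel₀ _ hQ, div_mul_cancel₀ _ hQ⟩

/-- The increments over a symmetric interval around `r` of the integrals `Z` of `a` and `X` of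
`b * exp Z`. -/
theorem HalfPendulum.increments {a b c Z X : ℝ → ℝ} (H : HalfPendulum a b c)
    (hZ : ∀ s, HasDerivAt Z (a s) s) (hX : ∀ s, HasDerivAt X (b s * Real.exp (Z s)) s)
    {h r : ℝ} (hh : 0 < h) (hhe : h = c r ^ 2 + a r ^ 2) (hab : a r ^ 2 + b r ^ 2 = 1) (s : ℝ) :
    Real.exp (Z (r + s)) * (1 - a r * sn h s) = Real.exp (Z (r - s)) * (1 + a r * sn h s) ∧
    X (r + s) - X (r - s) = (Real.exp (Z (r + s)) + Real.exp (Z (r - s))) *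
      (b r * ef h s - c r * eg h s) := by
  have hp := fun s => (H.comp_const_add r).eq_div hh hhe hab (by simp) (by simp) (by simp) s
  have hm := fun s => (H.comp_const_sub r).eq_div (p := -c r) hh (by rw [neg_sq]; exact hhe) hab
    (by simp) (by simp) (by simp) s
  have hS := hasDerivAt_sn hh
  have hlt := fun s => abs_lt.1 (abs_mul_sn_lt_one hh hhe hab s)
  have hpos : ∀ s, 0 < 1 + a r * sn h s := fun s => by linarith [(hlt s).1]
  have hneg : ∀ s, 0 < 1 - a r * sn h s := fun s => by linarith [(hlt s).2]
  have dZp : ∀ s, HasDerivAt (fun s => Z (r + s)) (a (r + s)) s := fun s =>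
    (hZ (r + s)).comp_const_add r s
  have dZm : ∀ s, HasDerivAt (fun s => Z (r - s)) (-a (r - s)) s := fun s =>
    (hZ (r - s)).comp_const_sub r s
  have dXp : ∀ s, HasDerivAt (fun s => X (r + s)) (b (r + s) * Real.exp (Z (r + s))) s := fun s =>
    (hX (r + s)).comp_const_add r s
  have dXm : ∀ s, HasDerivAt (fun s => X (r - s)) (-(b (r - s) * Real.exp (Z (r - s)))) s :=
    fun s => (hX (r - s)).comp_const_sub r s
  -- By the addition formula, `a (r + s) + a (r - s)` is the logarithmic derivative of `(1 + a r *
  -- sn) / (1 - a r * sn)`.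
  have hexp : ∀ s, Real.exp (Z (r + s)) * (1 - a r * sn h s) =
      Real.exp (Z (r - s)) * (1 + a r * sn h s) := fun s => by
    have hL : ∀ s, HasDerivAt (fun s => Z (r + s) - Z (r - s) -
        (Real.log (1 + a r * sn h s) - Real.log (1 - a r * sn h s))) 0 s := fun s => by
      have h1 := (((hS s).const_mul (a r)).const_add 1).log (hpos s).ne'
      have h2 := (((hS s).const_mul (a r)).const_sub 1).log (hneg s).ne'
      refine (((dZp s).sub (dZm s)).sub (h1.sub h2)).congr_deriv ?_
      have e1 := (hp s).1
      have e2 := (hm s).1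
      have p1 := (hpos s).ne'
      have p2 := (hneg s).ne'
      field_simp
      linear_combination e1 + e2
    have := eq_of_hasDerivAt_zero hL s
    simp only [sn_zero hh, mul_zero, add_zero, sub_zero, sub_self] at this
    have h3 : Z (r + s) + Real.log (1 - a r * sn h s) = Z (r - s) + Real.log (1 + a r * sn h s) := by
      linarith
    have h4 := congrArg Real.exp h3
    rwa [Real.exp_add, Real.exp_add, Real.exp_log (hpos s), Real.exp_log (hneg s)] at h4
  refine ⟨hexp s, ?_⟩
  have hL : ∀ s, HasDerivAt (fun s => X (r + s) - X (r - s) -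
      (Real.exp (Z (r + s)) + Real.exp (Z (r - s))) * (b r * ef h s - c r * eg h s)) 0 s :=
    fun s => by
    refine (((dXp s).sub (dXm s)).sub (((dZp s).exp.add (dZm s).exp).mul
      (((hasDerivAt_ef hh s).const_mul (b r)).sub
        ((hasDerivAt_eg hh s).const_mul (c r))))).congr_deriv ?_
    obtain ⟨e1, e2⟩ := hp s
    obtain ⟨e3, e4⟩ := hm s
    -- The two exponentials are `k * (1 + a r * sn)` and `k * (1 - a r * sn)`, which leaves a
    -- polynomial identity times `k`.
    obtain ⟨k, hk⟩ : ∃ k, k * (1 - a r * sn h s) = Real.exp (Z (r - s)) :=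
      ⟨_, div_mul_cancel₀ _ (hneg s).ne'⟩
    have hk' : Real.exp (Z (r + s)) = k * (1 + a r * sn h s) := by
      refine mul_right_cancel₀ (hneg s).ne' ?_
      rw [hexp s, ← hk]
      ring
    have hQ : 1 - a r ^ 2 * sn h s ^ 2 ≠ 0 := by
      have := mul_pos (hpos s) (hneg s)
      nlinarith
    have i1 := sn_sq_add_cn_sq hh s
    have i2 := dn_sq_add_sn_sq hh s
    have i3 := ef_mul_cn_add_eg_mul_dn hh s
    simp only [Pi.add_apply, Pi.sub_apply, hk', ← hk]
    clear dZp dZm dXp dXm hk hk' hp hm hS hlt hpos hneg hexp hX hZ H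
    generalize a r = u at *
    generalize b r = v at *
    generalize c r = p at *
    generalize sn h s = S at *
    generalize cn h s = C at *
    generalize dn h s = D at *
    generalize ef h s = f at *
    generalize eg h s = g at *
    generalize a (r + s) = ap at *
    generalize b (r + s) = bp at *
    generalize a (r - s) = am at *
    generalize b (r - s) = bm at *
    refine (mul_eq_zero.1 (?_ : (1 - u ^ 2 * S ^ 2) * _ = 0)).resolve_left hQ
    linear_combination k * (1 + u * S) * e2 + k * (1 - u * S) * e4 -
      (k * (1 + u * S) * e1 - k * (1 - u * S) * e3) * (v * f - p * g) -
      2 * k * (p * S * f * hab + p * S * u ^ 2 * f * i1 + S * v * g * hhe - S * u ^ 2 * v * g * i2 +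
        S * u ^ 2 * (v * D - p * C) * i3)
  have := eq_of_hasDerivAt_zero hL s
  simp only [add_zero, sub_zero, sub_self, ef_zero hh, eg_zero hh, mul_zero] at this
  linarith

end SH2
end

noncomputable section

namespace SH2

/-! ### The first zero of `sn` -/

/-- The incomplete elliptic integral of the first kind. -/
def ellipticF (k φ : ℝ) : ℝ := ∫ θ in (0 : ℝ)..φ, 1 / Real.sqrt (1 - k ^ 2 * Real.sin θ ^ 2)

section Amplitude

variable {k : ℝ}

theorem one_sub_mul_sin_sq_pos (hk : k ^ 2 < 1) (θ : ℝ) : 0 < 1 - k ^ 2 * Real.sin θ ^ 2 := by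
  have h1 := Real.sin_sq_le_one θ
  nlinarith [sq_nonneg k]

theorem continuous_ellipticF_integrand (hk : k ^ 2 < 1) :
    Continuous fun θ => 1 / Real.sqrt (1 - k ^ 2 * Real.sin θ ^ 2) :=
  continuous_const.div (by fun_prop) fun θ => (Real.sqrt_pos.2 (one_sub_mul_sin_sq_pos hk θ)).ne'

theorem hasDerivAt_ellipticF (hk : k ^ 2 < 1) (φ : ℝ) :
    HasDerivAt (ellipticF k) (1 / Real.sqrt (1 - k ^ 2 * Real.sin φ ^ 2)) φ :=
  have hc := continuous_ellipticF_integrand hk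
  intervalIntegral.integral_hasDerivAt_right (hc.intervalIntegrable _ _)
    hc.stronglyMeasurable.stronglyMeasurableAtFilter hc.continuousAt

theorem ellipticF_strictMono (hk : k ^ 2 < 1) : StrictMono (ellipticF k) :=
  strictMono_of_hasDerivAt_pos (hasDerivAt_ellipticF hk) fun φ =>
    one_div_pos.2 (Real.sqrt_pos.2 (one_sub_mul_sin_sq_pos hk φ))

theorem ellipticF_pi (hk : k ^ 2 < 1) : ellipticF k Real.pi = 2 * ellipticK k := by
  have hc := continuous_ellipticF_integrand hk
  have h1 := intervalIntegral.integral_add_adjacent_intervals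
    (hc.intervalIntegrable 0 (Real.pi / 2)) (hc.intervalIntegrable (Real.pi / 2) Real.pi)
    (μ := MeasureTheory.volume)
  have h2 := intervalIntegral.integral_comp_sub_left (a := 0) (b := Real.pi / 2)
    (fun θ => 1 / Real.sqrt (1 - k ^ 2 * Real.sin θ ^ 2)) Real.pi
  simp only [Real.sin_pi_sub, sub_zero, show Real.pi - Real.pi / 2 = Real.pi / 2 by ring] at h2
  rw [ellipticF, ← h1, ← h2, ellipticK]
  ring

/-- With `φ' = r * W` and `φ 0 = 0`, `A = sin φ` and the elliptic integral of `φ s` is `r * s`. So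
`φ` reaches `π` exactly at `2 * K / r`. One statement serves both energy ranges. -/
theorem pos_and_eq_zero_of_amplitude (hk : k ^ 2 < 1) {A B W : ℝ → ℝ} {r : ℝ} (hr : 0 < r) (hW : Continuous W)
    (hA : ∀ s, HasDerivAt A (r * W s * B s) s) (hB : ∀ s, HasDerivAt B (-(r * W s * A s)) s)
    (hA0 : A 0 = 0) (hB0 : B 0 = 1) (hW0 : ∀ s, 0 < W s)
    (hW2 : ∀ s, W s ^ 2 = 1 - k ^ 2 * A s ^ 2) :
    (∀ s, 0 < s → s < 2 * ellipticK k / r → 0 < A s) ∧ A (2 * ellipticK k / r) = 0 ∧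
      0 < 2 * ellipticK k / r := by
  have hrW : Continuous fun s => r * W s := by fun_prop
  obtain ⟨φ, hφ0, hφ⟩ : ∃ φ : ℝ → ℝ, φ 0 = 0 ∧ ∀ s, HasDerivAt φ (r * W s) s :=
    ⟨fun t => ∫ s in (0 : ℝ)..t, r * W s, by simp, fun t =>
      intervalIntegral.integral_hasDerivAt_right (hrW.intervalIntegrable _ _)
        hrW.stronglyMeasurable.stronglyMeasurableAtFilter hrW.continuousAt⟩
  have hsin : ∀ s, A s = Real.sin (φ s) := fun s => by
    have := eq_of_hasDerivAt_zero
      (F := fun s => (A s - Real.sin (φ s)) ^ 2 + (B s - Real.cos (φ s)) ^ 2) (fun s => by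
        refine ((((hA s).sub (hφ s).sin).pow 2).add
          (((hB s).sub (hφ s).cos).pow 2)).congr_deriv ?_
        simp only [Pi.sub_apply, Nat.cast_ofNat, Nat.add_one_sub_one, pow_one]
        ring) s
    simp only [hA0, hB0, hφ0, Real.sin_zero, Real.cos_zero, sub_self] at this
    have h1 : (A s - Real.sin (φ s)) ^ 2 = 0 := by
      nlinarith [sq_nonneg (A s - Real.sin (φ s)), sq_nonneg (B s - Real.cos (φ s))]
    exact sub_eq_zero.1 (pow_eq_zero_iff two_ne_zero |>.1 h1)
  have hF : ∀ s, ellipticF k (φ s) = r * s := fun s => by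
    have := eq_of_hasDerivAt_zero (F := fun s => ellipticF k (φ s) - r * s) (fun s => by
      refine (((hasDerivAt_ellipticF hk (φ s)).comp s (hφ s)).sub
        ((hasDerivAt_id s).const_mul r)).congr_deriv ?_
      rw [← hsin, ← hW2, Real.sqrt_sq (hW0 s).le]
      have := (hW0 s).ne'
      field_simp
      ring) s
    simp only [hφ0, ellipticF, intervalIntegral.integral_same, mul_zero, sub_self] at this
    exact sub_eq_zero.1 this
  have hmono := ellipticF_strictMono hk
  have hφmono : StrictMono φ := strictMono_of_hasDerivAt_pos hφ fun s => mul_pos hr (hW0 s)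
  have hφT : φ (2 * ellipticK k / r) = Real.pi := by
    refine hmono.injective ?_
    rw [hF, ellipticF_pi hk]
    field_simp
  refine ⟨fun s h0 h1 => ?_, by rw [hsin, hφT, Real.sin_pi], ?_⟩
  · rw [hsin]
    refine Real.sin_pos_of_pos_of_lt_pi ?_ ?_
    · rw [← hφ0]; exact hφmono h0
    · rw [← hφT]; exact hφmono h1
  · refine hφmono.lt_iff_lt.1 ?_
    rw [hφ0, hφT]
    exact Real.pi_pos

end Amplitude

theorem beforeZero_iff_lt {h t T : ℝ} (hh : 0 < h) (hT : 0 < T) (hT0 : sn h T = 0)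
    (hpos : ∀ s, 0 < s → s < T → 0 < sn h s) (ht : 0 < t) : BeforeZero h t ↔ t < T := by
  refine ⟨fun H => lt_of_not_ge fun hle => ?_, fun hlt =>
    ⟨hh, ht, fun s hs => hpos s hs.1 (hs.2.trans_lt hlt)⟩⟩
  exact (H.3 T ⟨hT, hle⟩).ne' hT0

theorem beforeZero_iff_of_lt_one {h t : ℝ} (hh : 0 < h) (h1 : h < 1) (ht : 0 < t) :
    BeforeZero h t ↔ t < 2 * ellipticK (Real.sqrt h) := by
  obtain ⟨a, b, c⟩ := pos_and_eq_zero_of_amplitude (k := Real.sqrt h)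
    (by rwa [Real.sq_sqrt hh.le]) one_pos (continuous_of_hasDerivAt (hasDerivAt_dn hh))
    (fun s => (hasDerivAt_sn hh s).congr_deriv (by ring))
    (fun s => (hasDerivAt_cn hh s).congr_deriv (by ring)) (sn_zero hh) (cn_zero hh)
    (dn_pos_of_le_one hh h1.le)
    (fun s => by rw [Real.sq_sqrt hh.le]; linarith [dn_sq_add_sn_sq hh s])
  rw [div_one] at a b c
  exact beforeZero_iff_lt hh c b a ht

/-- For `h > 1` the reciprocal modulus is used: `√h * sn` plays the sine and `dn` the cosine, with
speed factors `r = √h` and `W = cn`. -/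
theorem beforeZero_iff_of_one_lt {h t : ℝ} (h1 : 1 < h) (ht : 0 < t) :
    BeforeZero h t ↔ t < 2 * Real.sqrt (1 / h) * ellipticK (Real.sqrt (1 / h)) := by
  have hh : 0 < h := one_pos.trans h1
  have hs : 0 < Real.sqrt h := Real.sqrt_pos.2 hh
  have hss : Real.sqrt h ^ 2 = h := Real.sq_sqrt hh.le
  have hk : Real.sqrt (1 / h) ^ 2 = 1 / h := Real.sq_sqrt (by positivity)
  obtain ⟨a, b, c⟩ := pos_and_eq_zero_of_amplitude (k := Real.sqrt (1 / h))
    (A := fun s => Real.sqrt h * sn h s) (B := dn h)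
    (by rwa [hk, div_lt_one hh]) hs (continuous_of_hasDerivAt (hasDerivAt_cn hh))
    (fun s => ((hasDerivAt_sn hh s).const_mul (Real.sqrt h)).congr_deriv (by ring))
    (fun s => (hasDerivAt_dn hh s).congr_deriv (by linear_combination sn h s * cn h s * hss))
    (by simp [sn_zero hh]) (dn_zero hh) (cn_pos_of_one_le hh h1.le)
    (fun s => by
      rw [hk, mul_pow, hss, ← mul_assoc, one_div_mul_cancel hh.ne', one_mul]
      linarith [sn_sq_add_cn_sq hh s])
  have e : 2 * ellipticK (Real.sqrt (1 / h)) / Real.sqrt h =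
      2 * Real.sqrt (1 / h) * ellipticK (Real.sqrt (1 / h)) := by
    rw [Real.sqrt_div zero_le_one h, Real.sqrt_one]
    field_simp
  rw [e] at a b c
  exact beforeZero_iff_lt hh c ((mul_eq_zero.1 b).resolve_left hs.ne')
    (fun s h0 h1 => pos_of_mul_pos_right (a s h0 h1) hs.le) ht

theorem beforeZero_one {t : ℝ} (ht : 0 < t) : BeforeZero 1 t :=
  ⟨one_pos, ht, fun s hs => by rw [← sn_zero one_pos]; exact sn_one_strictMono hs.1⟩

/-- The three formulas for `𝐭` say the same thing: `t / 2` precedes the first positive zero of `sn`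
for `h = (E + 1) / 2`, with no zero when `E = 1`. -/
theorem coe_lt_tBound_iff {lam : PhaseCylinder} (hE : -1 < energy lam) {t : ℝ} (ht : 0 < t) :
    (t : EReal) < tBound lam ↔ BeforeZero ((energy lam + 1) / 2) (t / 2) := by
  have ht2 : 0 < t / 2 := by positivity
  rcases lt_trichotomy (energy lam) 1 with h1 | h1 | h1
  · have hC : lam ∈ C₁ := ⟨hE, h1⟩
    rw [tBound, if_pos hC, EReal.coe_lt_coe_iff,
      beforeZero_iff_of_lt_one (by linarith) (by linarith) ht2, modulusC₁]
    constructor <;> intro h <;> linarith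
  · have hC1 : lam ∉ C₁ := fun h => h.2.ne h1
    have hC2 : lam ∉ C₂ := fun h => (mem_Ioi.1 h).ne' h1
    have hC4 : lam ∉ C₄ := fun h => by linarith [h.1]
    rw [tBound, if_neg hC1, if_neg hC2, if_neg hC4, h1]
    norm_num
    exact beforeZero_one ht2
  · have hC1 : lam ∉ C₁ := fun h => h.2.not_gt h1
    have hC2 : lam ∈ C₂ := h1
    rw [tBound, if_neg hC1, if_pos hC2, EReal.coe_lt_coe_iff,
      beforeZero_iff_of_one_lt (by linarith) ht2, modulusC₂, one_div_div]
    constructor <;> intro h <;> linarith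

/-! ### The domain `Ñ` in terms of the midpoint -/

namespace NormalExtremal

variable {lam : PhaseCylinder} (e : NormalExtremal lam)

/-- The half-angle and its velocity at the midpoint, and half the length. -/
def mid (t : ℝ) : ℝ × ℝ × ℝ := (e.γ (t / 2) / 2, e.c (t / 2) / 2, t / 2)

theorem energy_eq (s : ℝ) : e.c s ^ 2 / 2 - Real.cos (e.γ s) = energy lam := by
  have h0 : energy lam = e.c 0 ^ 2 / 2 - Real.cos (e.γ 0) := by
    rw [← energy_coe, e.γ_zero, e.c_zero]
  rw [h0]
  exact eq_of_hasDerivAt_zero (F := fun s => e.c s ^ 2 / 2 - Real.cos (e.γ s)) (fun s => by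
    refine ((((e.deriv_c s).pow 2).div_const 2).sub (e.deriv_γ s).cos).congr_deriv ?_
    simp only [Nat.cast_ofNat, Nat.add_one_sub_one, pow_one]
    ring) s

theorem param_mid (t : ℝ) : param (e.mid t) = (energy lam + 1) / 2 := by
  rw [← e.energy_eq (t / 2), param, mid]
  have h1 := Real.cos_sq (e.γ (t / 2) / 2)
  have h2 := Real.sin_sq_add_cos_sq (e.γ (t / 2) / 2)
  rw [mul_div_cancel₀ _ two_ne_zero] at h1
  simp only
  linarith

/-- On `C₅` the pendulum rests at an angle with cosine `-1`, so the extra condition in Ñ is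
automatic there. -/
theorem sin_half_ne_zero_of_mem (hlam : lam ∈ C₅) (s : ℝ) : Real.sin (e.γ s / 2) ≠ 0 := by
  obtain ⟨hE, hc⟩ := hlam
  have h0 := e.energy_eq 0
  rw [hE, e.c_zero, hc] at h0
  have hcos : Real.cos (e.γ 0) = -1 := by linarith
  have hsin : Real.sin (e.γ 0) = 0 := by
    have := Real.sin_sq_add_cos_sq (e.γ 0)
    rw [hcos] at this
    exact pow_eq_zero_iff two_ne_zero |>.1 (by linarith)
  have key := pendulum_unique (a := fun s => (e.γ s, e.c s)) (b := fun _ => (e.γ 0, 0)) (t₀ := 0)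
    (fun s => (e.deriv_γ s).prodMk (e.deriv_c s)) (fun s => by
      refine (hasDerivAt_const s ((e.γ 0, 0) : ℝ × ℝ)).congr_deriv ?_
      simp [pendulum, hsin]
      rfl)
    (by simp [e.c_zero, hc])
  have hγ : e.γ s = e.γ 0 := congrArg Prod.fst (congrFun key s)
  have h1 := Real.cos_sq (e.γ s / 2)
  rw [mul_div_cancel₀ _ two_ne_zero, hγ, hcos] at h1
  intro h2
  have := Real.sin_sq_add_cos_sq (e.γ 0 / 2)
  rw [← hγ, h2, hγ] at this
  linarith

end NormalExtremal

/-- All strata merge into one condition on the midpoint; `C₄` drops out because `BeforeZero`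
requires a positive parameter. -/
theorem mem_NTilde_iff (ν : PhaseCylinder × ℝ) :
    ν ∈ NTilde ↔ (extremal ν.1).mid ν.2 ∈ midDomain := by
  obtain ⟨lam, t⟩ := ν
  have hpar := (extremal lam).param_mid t
  simp only [NTilde, midDomain, mem_union, mem_ofPred_eq, hpar]
  constructor
  · rintro (⟨ht, hC, hlt, hs⟩ | ⟨ht, hC⟩)
    · have hE : -1 < energy lam := by
        rcases hC with (h | h) | h
        · exact h.1
        · exact lt_trans (by norm_num) (mem_Ioi.1 h)
        · rw [h.1]; norm_num
      exact ⟨hs, (coe_lt_tBound_iff hE ht).1 hlt⟩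
    · have ht : 0 < t := ht
      refine ⟨(extremal lam).sin_half_ne_zero_of_mem hC _, ?_⟩
      rw [hC.1]
      norm_num
      exact beforeZero_one (half_pos ht)
  · rintro ⟨hs, H⟩
    have ht : 0 < t := by linarith [show 0 < t / 2 from H.2]
    have hE : -1 < energy lam := by linarith [H.1]
    by_cases hC : lam ∈ C₅
    · exact Or.inr ⟨ht, hC⟩
    · refine Or.inl ⟨ht, ?_, (coe_lt_tBound_iff hE ht).2 H, hs⟩
      rcases lt_trichotomy (energy lam) 1 with h1 | h1 | h1
      · exact Or.inl (Or.inl ⟨hE, h1⟩)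
      · exact Or.inr ⟨h1, fun h2 => hC ⟨h1, h2⟩⟩
      · exact Or.inl (Or.inr h1)

end SH2
end

noncomputable section

namespace SH2

/-! ### The target -/

/-- Coordinates on `SH(2)` in which the exponential mapping is `midExp` of the midpoint. -/
def targetChart (q : ℝ × ℝ × ℝ) : ℝ × ℝ × ℝ :=
  (((q.1 + q.2.1) / (1 + Real.exp q.2.2) + (q.1 - q.2.1) / (1 + Real.exp (-q.2.2))) / 2,
    ((q.1 - q.2.1) / (1 + Real.exp (-q.2.2)) - (q.1 + q.2.1) / (1 + Real.exp q.2.2)) / 2,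
    (Real.exp q.2.2 - 1) / (Real.exp q.2.2 + 1))

theorem contDiff_targetChart : ContDiff ℝ ∞ targetChart := by
  have h1 : ∀ q : ℝ × ℝ × ℝ, 1 + Real.exp q.2.2 ≠ 0 := fun q => by positivity
  have h2 : ∀ q : ℝ × ℝ × ℝ, 1 + Real.exp (-q.2.2) ≠ 0 := fun q => by positivity
  have h3 : ∀ q : ℝ × ℝ × ℝ, Real.exp q.2.2 + 1 ≠ 0 := fun q => by positivity
  unfold targetChart
  fun_prop (disch := assumption)

theorem targetChart_injective : Function.Injective targetChart := by
  rintro ⟨x, y, z⟩ ⟨x', y', z'⟩ h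
  simp only [targetChart, Prod.mk.injEq] at h
  obtain ⟨h1, h2, h3⟩ := h
  have hz : z = z' := by
    rw [div_eq_div_iff (by positivity) (by positivity)] at h3
    exact Real.exp_injective (by linarith)
  subst hz
  have e1 : (x + y) / (1 + Real.exp z) = (x' + y') / (1 + Real.exp z) := by linarith
  have e2 : (x - y) / (1 + Real.exp (-z)) = (x' - y') / (1 + Real.exp (-z)) := by linarith
  rw [div_left_inj' (by positivity)] at e1 e2
  rw [Prod.mk.injEq, Prod.mk.injEq]
  exact ⟨by linarith, by linarith, rfl⟩

theorem targetChart_bounds {q : ℝ × ℝ × ℝ} (hq : q.2.2 ≠ 0) :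
    (targetChart q).2.2 ≠ 0 ∧ |(targetChart q).2.2| < 1 := by
  have hpos := Real.exp_pos q.2.2
  refine ⟨div_ne_zero (sub_ne_zero.2 fun h => hq (Real.exp_eq_one_iff _ |>.1 h)) (by positivity), ?_⟩
  change |(Real.exp q.2.2 - 1) / (Real.exp q.2.2 + 1)| < 1
  rw [abs_lt, lt_div_iff₀ (by positivity), div_lt_one (by positivity)]
  constructor <;> linarith

theorem snd_snd_ne_zero_of_targetChart {q : ℝ × ℝ × ℝ} (hq : (targetChart q).2.2 ≠ 0) :
    q.2.2 ≠ 0 := fun h => hq (by simp [targetChart, h])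

theorem NormalExtremal.targetChart_eq {lam : PhaseCylinder} (e : NormalExtremal lam) {t : ℝ}
    (hm : 0 < param (e.mid t)) :
    targetChart (e.x t, e.y t, e.z t) = midExp (e.mid t) := by
  obtain ⟨r, hr⟩ : ∃ r, r = t / 2 := ⟨_, rfl⟩
  have ht : r + r = t := by rw [hr]; ring
  have H : HalfPendulum (fun s => Real.sin (e.γ s / 2)) (fun s => Real.cos (e.γ s / 2))
      (fun s => e.c s / 2) :=
    ⟨fun s => hasDerivAt_sin_half (e.deriv_γ s), fun s => hasDerivAt_cos_half (e.deriv_γ s),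
      fun s => hasDerivAt_half_snd (e.deriv_c s)⟩
  have hp : ∀ s, HasDerivAt (fun s => e.x s + e.y s) (Real.cos (e.γ s / 2) * Real.exp (e.z s)) s :=
    fun s => ((e.deriv_x s).add (e.deriv_y s)).congr_deriv
      (by rw [← mul_add, Real.cosh_add_sinh])
  have hn : ∀ s, HasDerivAt (fun s => e.x s - e.y s) (Real.cos (e.γ s / 2) * Real.exp (-e.z s)) s :=
    fun s => ((e.deriv_x s).sub (e.deriv_y s)).congr_deriv
      (by rw [← mul_sub, Real.cosh_sub_sinh])
  have hh : param (e.mid t) = (e.c r / 2) ^ 2 + Real.sin (e.γ r / 2) ^ 2 := by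
    rw [param, NormalExtremal.mid, hr]
  obtain ⟨i1, i2⟩ := H.increments e.deriv_z hp hm hh (Real.sin_sq_add_cos_sq _) r
  -- Reversing the signs of angle and velocity turns `z` into `-z`, which yields the increment of `x
  -- - y` alongside that of `x + y`.
  obtain ⟨-, i3⟩ := H.neg.increments (fun s => (e.deriv_z s).neg) hn hm
    (by simpa only [neg_sq] using hh) (by simpa only [neg_sq] using Real.sin_sq_add_cos_sq _) r
  simp only [ht, sub_self, e.x_zero, e.y_zero, e.z_zero, neg_zero, Real.exp_zero, add_zero,
    sub_zero, one_mul, Pi.neg_apply] at i1 i2 i3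
  have hmid : midExp (e.mid t) = (Real.cos (e.γ r / 2) * ef (param (e.mid t)) r,
      e.c r / 2 * eg (param (e.mid t)) r, Real.sin (e.γ r / 2) * sn (param (e.mid t)) r) := by
    rw [midExp, NormalExtremal.mid, hr]
  rw [hmid]
  generalize param (e.mid t) = h at *
  have p1 : 1 + Real.exp (e.z t) ≠ 0 := by positivity
  have p2 : 1 + Real.exp (-e.z t) ≠ 0 := by positivity
  have p3 : Real.exp (e.z t) + 1 ≠ 0 := by positivity
  have a1 : (e.x t + e.y t) / (1 + Real.exp (e.z t)) =
      Real.cos (e.γ r / 2) * ef h r - e.c r / 2 * eg h r := by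
    rw [div_eq_iff p1]; linear_combination i2
  have a2 : (e.x t - e.y t) / (1 + Real.exp (-e.z t)) =
      Real.cos (e.γ r / 2) * ef h r + e.c r / 2 * eg h r := by
    rw [div_eq_iff p2]; linear_combination i3
  simp only [targetChart, a1, a2, Prod.mk.injEq]
  refine ⟨by ring, by ring, ?_⟩
  rw [div_eq_iff p3]
  linear_combination i1

/-! ### Lifts to the universal cover of the phase cylinder -/

theorem pendulumFlow_pendulumFlow (s : ℝ × ℝ) (a b : ℝ) :
    pendulumFlow (pendulumFlow s a) b = pendulumFlow s (a + b) := by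
  refine congrFun (pendulum_unique (t₀ := 0) (hasDerivAt_pendulumFlow _)
    (b := fun b => pendulumFlow s (a + b)) (fun b => ?_) ?_) b
  · exact (hasDerivAt_pendulumFlow s (a + b)).comp_const_add a b
  · simp [pendulumFlow_zero]

theorem sin_add_int_mul_four_pi (x : ℝ) (k : ℤ) :
    Real.sin (x + k * (4 * Real.pi)) = Real.sin x := by
  have := Real.sin_add_int_mul_two_pi x (2 * k)
  rw [← this]
  push_cast
  ring_nf

/-- A solution of the pendulum equation projects to the cylinder `C`. -/
theorem NormalExtremal.exists_eq_of_pendulum {lam : PhaseCylinder} (e : NormalExtremal lam)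
    {a : ℝ → ℝ × ℝ} (ha : ∀ t, HasDerivAt a (pendulum (a t)) t)
    (h1 : ((a 0).1 : AddCircle (4 * Real.pi)) = lam.1) (h2 : (a 0).2 = lam.2) :
    ∃ k : ℤ, ∀ t, e.γ t = (a t).1 + k * (4 * Real.pi) ∧ e.c t = (a t).2 := by
  obtain ⟨k, hk⟩ : ∃ k : ℤ, e.γ 0 = (a 0).1 + k * (4 * Real.pi) := by
    have h := e.γ_zero.trans h1.symm
    rw [QuotientAddGroup.eq_iff_sub_mem] at h
    obtain ⟨m, hm⟩ := AddSubgroup.mem_zmultiples_iff.1 h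
    refine ⟨m, ?_⟩
    rw [zsmul_eq_mul] at hm
    linarith
  refine ⟨k, fun t => ?_⟩
  have key := pendulum_unique (t₀ := 0) (a := fun t => (e.γ t, e.c t))
    (b := fun t => ((a t).1 + k * (4 * Real.pi), (a t).2))
    (fun t => (e.deriv_γ t).prodMk (e.deriv_c t)) (fun t => ?_) (by simp [hk, e.c_zero, h2])
  · exact ⟨congrArg Prod.fst (congrFun key t), congrArg Prod.snd (congrFun key t)⟩
  · refine (((hasDerivAt_comp_fst (ha t)).add_const _).prodMk
      (hasDerivAt_comp_snd (ha t))).congr_deriv ?_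
    simp [pendulum, sin_add_int_mul_four_pi]

/-- The point of the phase cylinder below a point of its universal cover. -/
def project (s : ℝ × ℝ) : PhaseCylinder := ((s.1 : AddCircle (4 * Real.pi)), s.2)

/-- The midpoint as a function on the universal cover. -/
def liftMid (q : (ℝ × ℝ) × ℝ) : ℝ × ℝ × ℝ :=
  ((pendulumFlow q.1 (q.2 / 2)).1 / 2, (pendulumFlow q.1 (q.2 / 2)).2 / 2, q.2 / 2)

theorem mid_project (s : ℝ × ℝ) (e : NormalExtremal (project s)) :
    ∃ k : ℤ, ∀ t, e.γ t = (pendulumFlow s t).1 + k * (4 * Real.pi) ∧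
      e.c t = (pendulumFlow s t).2 :=
  e.exists_eq_of_pendulum (hasDerivAt_pendulumFlow s)
    (by rw [pendulumFlow_zero]; rfl) (by rw [pendulumFlow_zero]; rfl)

theorem mem_midDomain_add_iff (m : ℝ × ℝ × ℝ) (k : ℤ) :
    (m.1 + k * (2 * Real.pi), m.2) ∈ midDomain ↔ m ∈ midDomain := by
  simp [midDomain, param, Real.sin_add_int_mul_two_pi]

theorem midExp_add (m : ℝ × ℝ × ℝ) (k : ℤ) :
    midExp (m.1 + k * (2 * Real.pi), m.2) = midExp m := by
  simp [midExp, param, Real.sin_add_int_mul_two_pi, Real.cos_add_int_mul_two_pi]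

theorem mem_NTilde_project_iff (s : ℝ × ℝ) (t : ℝ) :
    (project s, t) ∈ NTilde ↔ liftMid (s, t) ∈ midDomain := by
  rw [mem_NTilde_iff]
  obtain ⟨k, hk⟩ := mid_project s (extremal (project s))
  rw [← mem_midDomain_add_iff (liftMid (s, t)) k]
  have : (extremal (project s)).mid t =
      ((liftMid (s, t)).1 + k * (2 * Real.pi), (liftMid (s, t)).2) := by
    simp only [NormalExtremal.mid, liftMid, hk, Prod.mk.injEq, and_true]
    ring
  rw [this]

theorem contDiff_liftMid : ContDiff ℝ ∞ liftMid := by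
  have h : ContDiff ℝ ∞ fun q : (ℝ × ℝ) × ℝ => pendulumFlow q.1 (q.2 / 2) :=
    contDiff_pendulumFlow.comp (f := fun q : (ℝ × ℝ) × ℝ => (q.1, q.2 / 2)) (by fun_prop)
  exact (h.fst.div_const 2).prodMk ((h.snd.div_const 2).prodMk (by fun_prop))

/-- The Hamiltonian vector field. -/
def hamiltonianField (s : ℝ × ℝ × ℝ × ℝ × ℝ) : ℝ × ℝ × ℝ × ℝ × ℝ :=
  (s.2.1, -Real.sin s.1, Real.cos (s.1 / 2) * Real.cosh s.2.2.2.2,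
    Real.cos (s.1 / 2) * Real.sinh s.2.2.2.2, Real.sin (s.1 / 2))

/-- The angle chosen in `extremal` need not depend continuously on the initial point. On the
universal cover the pendulum flow replaces it, changing the half-angle only by multiples of `2π`. -/
theorem contDiff_expMap_project :
    ContDiff ℝ ∞ fun q : (ℝ × ℝ) × ℝ => expMap (project q.1, q.2) := by
  have hV : ContDiff ℝ ∞ hamiltonianField := by unfold hamiltonianField; fun_prop
  rw [contDiff_iff_contDiffAt]
  rintro ⟨s, t⟩
  have key := contDiffAt_solution (P := ℝ × ℝ) hV (ι := fun s => (s.1, s.2, 0, 0, 0))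
    (φ := fun s t => ((pendulumFlow s t).1, (pendulumFlow s t).2, expMap (project s, t)))
    isOpen_univ (by fun_prop)
    (fun s _ => by
      simp [pendulumFlow_zero, expMap, NormalExtremal.x_zero, NormalExtremal.y_zero,
        NormalExtremal.z_zero])
    (fun s _ t => ?_) (mem_univ s) t
  · exact key.snd.snd
  · set e := extremal (project s)
    obtain ⟨k, hk⟩ := mid_project s e
    have hhalf : e.γ t / 2 = (pendulumFlow s t).1 / 2 + k * (2 * Real.pi) := by
      rw [(hk t).1]; ring
    refine ((hasDerivAt_pendulumFlow_fst s t).prodMk ((hasDerivAt_pendulumFlow_snd s t).prodMk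
      ((e.deriv_x t).prodMk ((e.deriv_y t).prodMk (e.deriv_z t))))).congr_deriv ?_
    rw [hhalf, Real.cos_add_int_mul_two_pi, Real.sin_add_int_mul_two_pi]
    rfl

end SH2
end

noncomputable section

namespace SH2

/-! ### Smoothness on the phase cylinder -/

theorem contMDiff_coe_addCircle (p : ℝ) [hp : Fact (0 < p)] :
    ContMDiff 𝓘(ℝ, ℝ) 𝓘(ℝ, ℝ) ∞ (fun r : ℝ => (r : AddCircle p)) := fun r => by
  have hmem : (AddCircle.openPartialHomeomorphCoe p (r - p / 2)).symm ∈
      IsManifold.maximalAtlas 𝓘(ℝ, ℝ) ∞ (AddCircle p) :=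
    IsManifold.subset_maximalAtlas ⟨_, rfl⟩
  have h := contMDiffOn_symm_of_mem_maximalAtlas hmem
  refine (h r ?_).contMDiffAt ?_
  · have := hp.out
    change r ∈ Ioo (r - p / 2) (r - p / 2 + p)
    constructor <;> linarith
  · have := hp.out
    exact Ioo_mem_nhds (by linarith) (by linarith)

/-- A local section of the projection of the universal cover. -/
def localLift (ν₀ ν : PhaseCylinder × ℝ) : (ℝ × ℝ) × ℝ :=
  ((chartAt ℝ ν₀.1.1 ν.1.1, ν.1.2), ν.2)

theorem contMDiffAt_localLift (ν₀ : PhaseCylinder × ℝ) :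
    ContMDiffAt ((𝓘(ℝ, ℝ).prod 𝓘(ℝ, ℝ)).prod 𝓘(ℝ, ℝ)) 𝓘(ℝ, (ℝ × ℝ) × ℝ) ∞ (localLift ν₀) ν₀ := by
  have h1 : ContMDiffAt 𝓘(ℝ, ℝ) 𝓘(ℝ, ℝ) ∞ (chartAt ℝ ν₀.1.1) ν₀.1.1 :=
    (contMDiffOn_chart (I := 𝓘(ℝ, ℝ)) (n := ∞) (x := ν₀.1.1)).contMDiffAt
      (chart_source_mem_nhds ℝ ν₀.1.1)
  have h2 : ContMDiffAt ((𝓘(ℝ, ℝ).prod 𝓘(ℝ, ℝ)).prod 𝓘(ℝ, ℝ)) 𝓘(ℝ, ℝ) ∞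
      (fun ν : PhaseCylinder × ℝ => chartAt ℝ ν₀.1.1 ν.1.1) ν₀ :=
    ContMDiffAt.comp (g := chartAt ℝ ν₀.1.1) (f := fun ν : PhaseCylinder × ℝ => ν.1.1) ν₀ h1
      (contMDiffAt_fst.comp ν₀ contMDiffAt_fst)
  exact (h2.prodMk_space (contMDiffAt_snd.comp ν₀ contMDiffAt_fst)).prodMk_space contMDiffAt_snd

theorem eventually_project_localLift (ν₀ : PhaseCylinder × ℝ) :
    ∀ᶠ ν in 𝓝 ν₀, (project (localLift ν₀ ν).1, (localLift ν₀ ν).2) = ν := by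
  have hc : ContinuousAt (fun ν : PhaseCylinder × ℝ => ν.1.1) ν₀ := by fun_prop
  filter_upwards [hc.preimage_mem_nhds (chart_source_mem_nhds ℝ ν₀.1.1)] with ν hν
  have := (chartAt ℝ ν₀.1.1).left_inv hν
  change ((project (_, _)), _) = ((ν.1.1, ν.1.2), ν.2)
  rw [project]
  exact congrArg (fun x => ((x, ν.1.2), ν.2)) this

theorem contMDiff_expMap :
    ContMDiff ((𝓘(ℝ, ℝ).prod 𝓘(ℝ, ℝ)).prod 𝓘(ℝ, ℝ)) 𝓘(ℝ, ℝ × ℝ × ℝ) ∞ expMap := fun ν₀ => by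
  refine (ContMDiffAt.comp (g := fun q : (ℝ × ℝ) × ℝ => expMap (project q.1, q.2)) ν₀
    contDiff_expMap_project.contMDiff.contMDiffAt (contMDiffAt_localLift ν₀)).congr_of_eventuallyEq ?_
  filter_upwards [eventually_project_localLift ν₀] with ν hν
  exact congrArg expMap hν.symm

theorem isOpen_NTilde : IsOpen NTilde := by
  rw [isOpen_iff_mem_nhds]
  intro ν₀ hν₀
  have h0 := (eventually_project_localLift ν₀).self_of_nhds
  have hc : ContinuousAt (fun ν => liftMid (localLift ν₀ ν)) ν₀ :=
    contDiff_liftMid.continuous.continuousAt.comp (contMDiffAt_localLift ν₀).continuousAt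
  have hmem : liftMid (localLift ν₀ ν₀) ∈ midDomain := by
    rwa [← h0, mem_NTilde_project_iff] at hν₀
  filter_upwards [eventually_project_localLift ν₀,
    hc.preimage_mem_nhds (isOpen_midDomain.mem_nhds hmem)] with ν h1 h2
  rw [← h1, mem_NTilde_project_iff]
  exact h2

theorem isOpen_MTilde : IsOpen MTilde :=
  isOpen_ne_fun (by fun_prop) continuous_const

/-! ### The inverse of the exponential mapping -/

/-- The inverse of the exponential mapping, with values in the universal cover. -/
def liftLog (q : ℝ × ℝ × ℝ) : (ℝ × ℝ) × ℝ :=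
  (pendulumFlow (2 * (midLog (targetChart q)).1, 2 * (midLog (targetChart q)).2.1)
    (-(midLog (targetChart q)).2.2), 2 * (midLog (targetChart q)).2.2)

/-- The inverse of the exponential mapping. -/
def logMap (q : ℝ × ℝ × ℝ) : PhaseCylinder × ℝ := (project (liftLog q).1, (liftLog q).2)

theorem liftMid_liftLog (q : ℝ × ℝ × ℝ) : liftMid (liftLog q) = midLog (targetChart q) := by
  rw [liftMid, liftLog, pendulumFlow_pendulumFlow]
  simp [pendulumFlow_zero]

theorem contDiffAt_liftLog {q : ℝ × ℝ × ℝ} (hq : q ∈ MTilde) : ContDiffAt ℝ ∞ liftLog q := by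
  obtain ⟨h0, h1⟩ := targetChart_bounds hq
  have hm : ContDiffAt ℝ ∞ (fun q => midLog (targetChart q)) q :=
    (contDiffAt_midLog h0 h1).comp q contDiff_targetChart.contDiffAt
  have hf := contDiff_pendulumFlow.contDiffAt.comp q
    (((contDiffAt_const.mul hm.fst).prodMk (contDiffAt_const.mul hm.snd.fst)).prodMk hm.snd.snd.neg)
    (f := fun q => ((2 * (midLog (targetChart q)).1, 2 * (midLog (targetChart q)).2.1),
      -(midLog (targetChart q)).2.2))
  exact hf.prodMk (contDiffAt_const.mul hm.snd.snd)

theorem contMDiffOn_logMap :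
    ContMDiffOn 𝓘(ℝ, ℝ × ℝ × ℝ) ((𝓘(ℝ, ℝ).prod 𝓘(ℝ, ℝ)).prod 𝓘(ℝ, ℝ)) ∞ logMap MTilde :=
    fun q hq => by
  have h := contDiffAt_liftLog hq
  exact ((((contMDiff_coe_addCircle (4 * Real.pi)).contMDiffAt.comp q h.fst.fst.contMDiffAt).prodMk
    h.fst.snd.contMDiffAt).prodMk h.snd.contMDiffAt).contMDiffWithinAt

theorem targetChart_expMap {ν : PhaseCylinder × ℝ} (hν : ν ∈ NTilde) :
    targetChart (expMap ν) = midExp ((extremal ν.1).mid ν.2) :=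
  (extremal ν.1).targetChart_eq ((mem_NTilde_iff ν).1 hν).2.1

theorem logMap_mem {q : ℝ × ℝ × ℝ} (hq : q ∈ MTilde) : logMap q ∈ NTilde := by
  obtain ⟨h0, h1⟩ := targetChart_bounds hq
  rw [logMap, mem_NTilde_project_iff]
  change liftMid (liftLog q) ∈ midDomain
  rw [liftMid_liftLog]
  exact (midLog_mem h0 h1).1

theorem expMap_mem {ν : PhaseCylinder × ℝ} (hν : ν ∈ NTilde) : expMap ν ∈ MTilde := by
  refine snd_snd_ne_zero_of_targetChart ?_
  rw [targetChart_expMap hν]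
  exact (midExp_bounds ((mem_NTilde_iff ν).1 hν)).1

theorem midExp_mid_project (s : ℝ × ℝ) (t : ℝ) :
    midExp ((extremal (project s)).mid t) = midExp (liftMid (s, t)) := by
  obtain ⟨k, hk⟩ := mid_project s (extremal (project s))
  rw [← midExp_add (liftMid (s, t)) k]
  congr 1
  simp only [NormalExtremal.mid, liftMid, hk, Prod.mk.injEq, and_true]
  ring

theorem expMap_logMap {q : ℝ × ℝ × ℝ} (hq : q ∈ MTilde) : expMap (logMap q) = q := by
  obtain ⟨h0, h1⟩ := targetChart_bounds hq
  refine targetChart_injective ?_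
  rw [targetChart_expMap (logMap_mem hq), logMap, midExp_mid_project]
  change midExp (liftMid (liftLog q)) = _
  rw [liftMid_liftLog, (midLog_mem h0 h1).2]

/-- The inverse flows backwards from the midpoint by half the length. The midpoint is recovered only
up to a multiple of `4π` in the angle, which is zero on the circle. -/
theorem logMap_expMap {ν : PhaseCylinder × ℝ} (hν : ν ∈ NTilde) : logMap (expMap ν) = ν := by
  obtain ⟨lam, t⟩ := ν
  obtain ⟨k, hk⟩ := midLog_midExp ((mem_NTilde_iff _).1 hν)
  rw [← targetChart_expMap hν] at hk
  simp only [logMap, liftLog, hk]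
  set e := extremal lam
  have hshift : ∀ r, HasDerivAt (fun r => (e.γ (t / 2 + r) + k * (4 * Real.pi), e.c (t / 2 + r)))
      (pendulum (e.γ (t / 2 + r) + k * (4 * Real.pi), e.c (t / 2 + r))) r := fun r => by
    simp only [pendulum, sin_add_int_mul_four_pi]
    exact (((e.deriv_γ (t / 2 + r)).comp_const_add (t / 2) r).add_const _).prodMk
      ((e.deriv_c (t / 2 + r)).comp_const_add (t / 2) r)
  have key := pendulum_unique (t₀ := 0)
    (hasDerivAt_pendulumFlow (e.γ (t / 2) + k * (4 * Real.pi), e.c (t / 2))) hshift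
    (by simp [pendulumFlow_zero])
  have e1 : (2 * ((e.mid t).1 + k * (2 * Real.pi)), 2 * (e.mid t).2.1) =
      (e.γ (t / 2) + k * (4 * Real.pi), e.c (t / 2)) := by
    simp only [NormalExtremal.mid, Prod.mk.injEq]
    constructor <;> ring
  have e2 : (e.mid t).2.2 = t / 2 := rfl
  rw [e1, e2, key]
  beta_reduce
  rw [add_neg_cancel, mul_div_cancel₀ _ two_ne_zero, project, e.c_zero]
  refine congrArg (fun x => ((x, lam.2), t)) ?_
  rw [← e.γ_zero, AddCircle.coe_add, add_eq_left, ← zsmul_eq_mul, AddCircle.coe_zsmul,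
    AddCircle.coe_period, zsmul_zero]

end SH2

end

/-! ### Assembly of the diffeomorphism. -/

theorem mainTheorem4 :
    ∃ Φ : PartialDiffeomorph ((𝓘(ℝ, ℝ).prod 𝓘(ℝ, ℝ)).prod 𝓘(ℝ, ℝ)) 𝓘(ℝ, ℝ × ℝ × ℝ)
        (SH2.PhaseCylinder × ℝ) (ℝ × ℝ × ℝ) ∞,
      Φ.source = SH2.NTilde ∧ Φ.target = SH2.MTilde ∧ EqOn Φ SH2.expMap SH2.NTilde := by
  refine ⟨{ toFun := SH2.expMap
            invFun := SH2.logMap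
            source := SH2.NTilde
            target := SH2.MTilde
            map_source' := fun _ => SH2.expMap_mem
            map_target' := fun _ => SH2.logMap_mem
            left_inv' := fun _ => SH2.logMap_expMap
            right_inv' := fun _ => SH2.expMap_logMap
            open_source := SH2.isOpen_NTilde
            open_target := SH2.isOpen_MTilde
            contMDiffOn_toFun := SH2.contMDiff_expMap.contMDiffOn
            contMDiffOn_invFun := SH2.contMDiffOn_logMap }, rfl, rfl, fun _ _ => rfl⟩
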